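/- Let $m,n$ be positive integers with $\gcd(m,n)=1$ and let $\mathbb H=\mathbb H_{m/n}=\{(z_1,z_2)\in\mathbb C^2:\ |z_1|^{m/n}<|z_2|<1\}$, with Lebesgue measure $dV$. Let $2\le p<\infty$. Let $A^p$ be the space of holomorphic functions in $L^p(\mathbb H)$, let $G^{2,p}$ be the closure of $A^p$ in the $L^2$ norm, and let $\widetilde{\boldsymbol B}^p$ be the orthogonal projection of $L^2(\mathbb H)$ onto $G^{2,p}$. Write $e_\alpha(z)=z_1^{\alpha_1}z_2^{\alpha_2}$ for $\alpha\in\mathbb Z^2$, and $\mathcal S_p=\{\alpha\in\mathbb Z^2: e_\alpha\in A^p\}$. Then: (a) $A^2$ is closed in $L^2(\mathbb H)$, $\mathcal S_p\subseteq\mathcal S_2$, and the series $$B(z,w)=\sum_{\alpha\in\mathcal S_2}\frac{e_\alpha(z)\overline{e_\alpha(w)}}{\|e_\alpha\|_2^2},\qquad \widetilde B^p(z,w)=\sum_{\alpha\in\mathcal S_p}\frac{e_\alpha(z)\overline{e_\alpha(w)}}{\|e_\alpha\|_2^2}$$ converge absolutely at all $z,w\in\mathbb H$. $B$ is the Bergman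 kernel, i.e. the kernel of the orthogonal projection of $L^2(\mathbb H)$ onto $A^2$, and the subseries $\widetilde B^p$ is the kernel of $\widetilde{\boldsymbol B}^p$. The latter means: for every $f\in L^2(\mathbb H)$ the integral $\int_{\mathbb H}\widetilde B^p(z,w)f(w)\,dV(w)$ converges absolutely at every $z\in\mathbb H$, is a holomorphic function of $z$, and equals $\widetilde{\boldsymbol B}^pf$ almost everywhere; likewise for $B$. (b) The operator $|\widetilde{\boldsymbol B}^p|f(z)=\int_{\mathbb H}|\widetilde B^p(z,w)|\,f(w)\,dV(w)$ is bounded on $L^p(\mathbb H)$: there is a constant $C$ such that, for every $f\in L^p(\mathbb H)$, the integral converges absolutely at every $z\in\mathbb H$ and $\||\widetilde{\boldsymbol B}^p|f\|_p\le C\|f\|_p$. Also $\widetilde{\boldsymbol B}^p$ maps $L^p(\mathbb H)$ boundedly into $A^p$. (c) $\widetilde{\boldsymbol B}^ph=h$ for every $h\in A^p$. (d) For every $g\in L^p(\mathbb H)$, $\widetilde{\boldsymbol B}^pg$ is the unique element of $A^p$ nearest to $g$ in the $L^2$ norm. -/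

import Mathlib

open MeasureTheory
open scoped ENNReal NNReal ComplexConjugate

noncomputable section

namespace GenHartogs

/-- The power-generalized Hartogs triangle of exponent `γ`. -/
def domain (γ : ℝ) : Set (ℂ × ℂ) :=
  {z | ‖z.1‖ ^ γ < ‖z.2‖ ∧ ‖z.2‖ < 1}

/-- Lebesgue measure `dV` restricted to the domain. -/
def vol (γ : ℝ) : Measure (ℂ × ℂ) := volume.restrict (domain γ)

/-- `f` belongs to the Bergman space `A^p`: it is holomorphic on the domain and lies in `L^p`. -/
def MemBergman (γ : ℝ) (p : ℝ≥0∞) (f : ℂ × ℂ → ℂ) : Prop :=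
  DifferentiableOn ℂ f (domain γ) ∧ MemLp f p (vol γ)

/-- The space `L^2` of the domain, as a Hilbert space. -/
abbrev L2 (γ : ℝ) : Type := Lp ℂ 2 (vol γ)

/-- `A^p ∩ L^2` as a subspace of `L^2`; for `p ≥ 2` this is `A^p`, the domain being bounded. -/
def bergmanSubspace (γ : ℝ) (p : ℝ≥0∞) : Submodule ℂ (L2 γ) where
  carrier := {F | ∃ f : ℂ × ℂ → ℂ, MemBergman γ p f ∧ F =ᵐ[vol γ] f}
  zero_mem' := ⟨0, ⟨differentiableOn_const 0, MemLp.zero⟩, Lp.coeFn_zero _ _ _⟩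
  add_mem' := by
    rintro F G ⟨f, hf, hF⟩ ⟨g, hg, hG⟩
    exact ⟨f + g, ⟨hf.1.add hg.1, hf.2.add hg.2⟩, (Lp.coeFn_add F G).trans (hF.add hG)⟩
  smul_mem' := by
    rintro c F ⟨f, hf, hF⟩
    exact ⟨c • f, ⟨hf.1.const_smul c, hf.2.const_smul c⟩,
      (Lp.coeFn_smul c F).trans (hF.const_smul c)⟩

/-- `G^{2,p}`: the closure of `A^p` in the `L^2` norm. -/
def closedBergmanSubspace (γ : ℝ) (p : ℝ≥0∞) : Submodule ℂ (L2 γ) :=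
  (bergmanSubspace γ p).topologicalClosure

instance (γ : ℝ) (p : ℝ≥0∞) : CompleteSpace (closedBergmanSubspace γ p) :=
  inferInstanceAs (CompleteSpace (bergmanSubspace γ p).topologicalClosure)

/-- The `L^p` sub-Bergman projection: the orthogonal projection of `L^2` onto `G^{2,p}`.
For `p = 2` it is the Bergman projection. -/
def subBergmanProjection (γ : ℝ) (p : ℝ≥0∞) : L2 γ →L[ℂ] L2 γ :=
  (closedBergmanSubspace γ p).starProjection

/-- The Laurent monomial `e_α(z) = z₁^{α₁} z₂^{α₂}`. -/
def monomial (α : ℤ × ℤ) (z : ℂ × ℂ) : ℂ := z.1 ^ α.1 * z.2 ^ α.2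

/-- The `L^p`-allowable multi-indices: those `α ∈ ℤ²` with `e_α ∈ A^p`. -/
def allowable (γ : ℝ) (p : ℝ≥0∞) : Set (ℤ × ℤ) := {α | MemBergman γ p (monomial α)}

/-- The term `e_α(z) conj(e_α(w)) / ‖e_α‖₂²` of the Bergman kernel series. -/
def kernelTerm (γ : ℝ) (z w : ℂ × ℂ) (α : ℤ × ℤ) : ℂ :=
  monomial α z * conj (monomial α w) / ((∫ v in domain γ, ‖monomial α v‖ ^ 2 : ℝ) : ℂ)

/-- The sum of the Bergman kernel series over the `L^p`-allowable multi-indices. -/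
def subBergmanKernel (γ : ℝ) (p : ℝ≥0∞) (z w : ℂ × ℂ) : ℂ :=
  ∑' α : allowable γ p, kernelTerm γ z w α

/-- The integral operator with kernel `K`. -/
def integralOp (γ : ℝ) (K : ℂ × ℂ → ℂ × ℂ → ℂ) (f : ℂ × ℂ → ℂ) (z : ℂ × ℂ) : ℂ :=
  ∫ w in domain γ, K z w * f w

/-- The kernel `|K|` of the absolute-value operator. -/
def absKernel (K : ℂ × ℂ → ℂ × ℂ → ℂ) (z w : ℂ × ℂ) : ℂ := ((‖K z w‖ : ℝ) : ℂ)

/-- `K` represents the operator `P` on `L^2`: for every `f ∈ L^2` the integral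
`∫ K(z,w) f(w) dV(w)` converges absolutely at every point `z` of the domain, and it is a
holomorphic function of `z` which is equal to `P f` almost everywhere. -/
def IsRepresentingKernel (γ : ℝ) (K : ℂ × ℂ → ℂ × ℂ → ℂ) (P : L2 γ →L[ℂ] L2 γ) : Prop :=
  ∀ (f : ℂ × ℂ → ℂ) (hf : MemLp f 2 (vol γ)),
    (∀ z ∈ domain γ, IntegrableOn (fun w => K z w * f w) (domain γ)) ∧
    DifferentiableOn ℂ (integralOp γ K f) (domain γ) ∧
    P (hf.toLp f) =ᵐ[vol γ] integralOp γ K f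

/-- The integral operator with kernel `K` is defined and bounded on `L^p`. -/
def IsBoundedOnLp (γ : ℝ) (p : ℝ≥0∞) (K : ℂ × ℂ → ℂ × ℂ → ℂ) : Prop :=
  ∃ C : ℝ≥0, ∀ f : ℂ × ℂ → ℂ, MemLp f p (vol γ) →
    (∀ z ∈ domain γ, IntegrableOn (fun w => K z w * f w) (domain γ)) ∧
    MemLp (integralOp γ K f) p (vol γ) ∧
    eLpNorm (integralOp γ K f) p (vol γ) ≤ C * eLpNorm f p (vol γ)

end GenHartogs

end

noncomputable section

namespace GenHartogs

open Set Real

/-! ### Integrals in one variable -/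

/-! The domain is invariant under rotation of each coordinate, so the monomials are orthogonal and
both halves of the theorem reduce to counting exponents.

Projection. The Laurent coefficient `c_α` of a holomorphic `h` is the average of `h · e_{-α}` over a
torus `|z₁|, |z₂| = const`; Cauchy's theorem on annuli makes it independent of the torus
(`torusMean_eq`). Jensen's inequality on each torus gives `|c_α| ‖e_α‖_p ≤ ‖h‖_p`, so only
`L^p`-allowable monomials occur in a function of `A^p` (`mem_allowable_of_laurentCoeff_ne_zero`). On
a torus, `Σ c_α e_α` is an absolutely summable Fourier series, hence equals the continuous function
`h`: the subseries kernel reproduces `A^p` (`integralOp_eq_self`). With orthogonality, the integral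
operator is then the orthogonal projection onto the closure of `A^p` (`subBergmanProjection_ae_eq`),
and the nearest-point property is Pythagoras.

Boundedness. For `γ = m/n`, allowability means `α₁ ≥ 0` and `n α₁ + m α₂ > -τ` with `τ = 2(m+n)/p`.
The form `n α₁ + m α₂` is integer-valued and unchanged by the shift `(m, -n)`, so the allowable set
splits into `m` copies of `ℕ × ℕ`, on each of which the kernel factors into two geometric-type
series. Writing `s = z₁ conj w₁` and `t = z₂ conj w₂`, one gets `|K| ≤ C |t|^{-c} |1 - s^m/t^n|^{-2}
|1 - t|^{-2}` with `c p < 2 + 2/γ` (`exists_norm_subBergmanKernel_le`). The strict inequality is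
decisive, and it comes from the gap between `-τ` and the next larger integer. Schur's test, with
weights singular at the boundary and at the origin, then bounds the majorant on `L^p`
(`exists_lintegral_kernelMajorant_le`, `lintegral_rpow_lintegral_mul_le`). -/

theorem lintegral_complex_eq_polar {f : ℂ → ℝ≥0∞} (hf : Measurable f) :
    ∫⁻ z, f z = ∫⁻ r in Ioi (0 : ℝ), ∫⁻ θ in Ioo (-π) π,
      ENNReal.ofReal r * f (circleMap 0 r θ) := by
  rw [← Complex.lintegral_comp_polarCoord_symm]
  have h1 : ∀ p : ℝ × ℝ, Complex.polarCoord.symm p = circleMap 0 p.1 p.2 := by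
    intro p
    simp [circleMap, Complex.exp_mul_I]
  simp_rw [h1, smul_eq_mul]
  rw [show polarCoord.target = Ioi (0 : ℝ) ×ˢ Ioo (-π) π from rfl, Measure.volume_eq_prod,
    setLIntegral_prod]
  refine Measurable.aemeasurable ?_
  refine (ENNReal.measurable_ofReal.comp measurable_fst).mul (hf.comp ?_)
  unfold circleMap
  fun_prop

theorem lintegral_complex_norm {φ : ℝ → ℝ≥0∞} (hφ : Measurable φ) :
    ∫⁻ z : ℂ, φ ‖z‖ =
      ENNReal.ofReal (2 * π) * ∫⁻ r in Ioi (0 : ℝ), ENNReal.ofReal r * φ r := by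
  rw [lintegral_complex_eq_polar (f := fun z => φ ‖z‖) (hφ.comp measurable_norm),
    ← lintegral_const_mul _ (by fun_prop)]
  refine setLIntegral_congr_fun measurableSet_Ioi fun r hr => ?_
  have hr' : |r| = r := abs_of_pos hr
  simp only [norm_circleMap_zero, hr', lintegral_const, Measure.restrict_apply MeasurableSet.univ,
    univ_inter, Real.volume_Ioo]
  rw [mul_comm]
  congr 2
  ring

/-- Poisson kernel: `Re ((1 + v)/(1 - v)) = (1 - |v|²)/|1 - v|²` with `v = a ζ^m`, and the circle
mean of the holomorphic function on the left is its value `1` at the centre. -/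
theorem integral_inv_normSq_one_sub {a : ℂ} {r : ℝ} {m : ℕ} (hm : 0 < m) (hr : 0 ≤ r)
    (h : ‖a‖ * r ^ m < 1) :
    ∫ θ in (0 : ℝ)..2 * π, (‖1 - a * circleMap 0 r θ ^ m‖ ^ 2)⁻¹ =
      2 * π * (1 - (‖a‖ * r ^ m) ^ 2)⁻¹ := by
  set F : ℂ → ℂ := fun ζ => (1 + a * ζ ^ m) / (1 - a * ζ ^ m) with hF
  have hne : ∀ ζ : ℂ, ‖ζ‖ ≤ r → 1 - a * ζ ^ m ≠ 0 := by
    intro ζ hζ h0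
    have h1 : a * ζ ^ m = 1 := (sub_eq_zero.mp h0).symm
    have h2 : ‖a * ζ ^ m‖ < 1 := by
      rw [norm_mul, norm_pow]
      exact lt_of_le_of_lt (by gcongr) h
    rw [h1] at h2
    simp at h2
  have hd : DiffContOnCl ℂ F (Metric.ball 0 |r|) := by
    rw [abs_of_nonneg hr]
    refine DifferentiableOn.diffContOnCl fun ζ hζ => ?_
    have hζ' : ‖ζ‖ ≤ r := by
      simpa using Metric.closure_ball_subset_closedBall hζ
    have h1 : DifferentiableAt ℂ (fun ζ : ℂ => 1 + a * ζ ^ m) ζ := by fun_prop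
    have h2 : DifferentiableAt ℂ (fun ζ : ℂ => 1 - a * ζ ^ m) ζ := by fun_prop
    exact (h1.div h2 (hne ζ hζ')).differentiableWithinAt
  have hav := hd.circleAverage
  have hF0 : F 0 = 1 := by simp [hF, hm.ne']
  rw [hF0] at hav
  have hci : CircleIntegrable F 0 r := by
    refine ContinuousOn.circleIntegrable hr ?_
    intro ζ hζ
    have hζ' : ‖ζ‖ ≤ r := by simpa using le_of_eq (mem_sphere_iff_norm.mp hζ)
    have h1 : ContinuousAt (fun ζ : ℂ => 1 + a * ζ ^ m) ζ := by fun_prop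
    have h2 : ContinuousAt (fun ζ : ℂ => 1 - a * ζ ^ m) ζ := by fun_prop
    exact (h1.div h2 (hne ζ hζ')).continuousWithinAt
  have hre := Complex.reCLM.circleAverage_comp_comm (c := 0) (R := r) hci
  rw [hav] at hre
  rw [circleAverage_def] at hre
  have hpt : ∀ θ : ℝ, (⇑Complex.reCLM ∘ F) (circleMap 0 r θ) =
      (1 - (‖a‖ * r ^ m) ^ 2) * (‖1 - a * circleMap 0 r θ ^ m‖ ^ 2)⁻¹ := by
    intro θ
    have hn : ‖a * circleMap 0 r θ ^ m‖ = ‖a‖ * r ^ m := by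
      simp [abs_of_nonneg hr]
    rw [← hn]
    simp only [hF, Function.comp]
    generalize a * circleMap 0 r θ ^ m = v
    rw [Complex.reCLM_apply]
    rw [Complex.div_re, ← Complex.sq_norm, ← add_div, div_eq_mul_inv]
    congr 1
    rw [Complex.sq_norm, Complex.normSq_apply]
    simp
    ring
  simp_rw [hpt] at hre
  rw [intervalIntegral.integral_const_mul] at hre
  have hpos : 0 < 1 - (‖a‖ * r ^ m) ^ 2 := by
    have : 0 ≤ ‖a‖ * r ^ m := by positivity
    nlinarith
  simp only [Complex.reCLM_apply, Complex.one_re, smul_eq_mul] at hre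
  rw [inv_mul_eq_iff_eq_mul₀ (by positivity), mul_one] at hre
  rw [eq_mul_inv_iff_mul_eq₀ hpos.ne', mul_comm, hre]

theorem lintegral_inv_normSq_one_sub {a : ℂ} {r : ℝ} {m : ℕ} (hm : 0 < m) (hr : 0 ≤ r)
    (h : ‖a‖ * r ^ m < 1) :
    ∫⁻ θ in Ioo (-π) π, ENNReal.ofReal (‖1 - a * circleMap 0 r θ ^ m‖ ^ 2)⁻¹ =
      ENNReal.ofReal (2 * π * (1 - (‖a‖ * r ^ m) ^ 2)⁻¹) := by
  rw [← integral_inv_normSq_one_sub hm hr h]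
  have hper : Function.Periodic (fun θ : ℝ => (‖1 - a * circleMap 0 r θ ^ m‖ ^ 2)⁻¹) (2 * π) := by
    intro θ
    simp only [periodic_circleMap 0 r θ]
  have h1 := hper.intervalIntegral_add_eq (-π) 0
  rw [zero_add, show -π + 2 * π = π by ring] at h1
  rw [← h1, intervalIntegral.integral_of_le (by linarith [Real.pi_pos]),
    ofReal_integral_eq_lintegral_ofReal]
  · rw [restrict_Ioo_eq_restrict_Ioc]
  · refine (Continuous.integrableOn_Icc ?_).mono_set Ioc_subset_Icc_self
    refine Continuous.inv₀ ?_ ?_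
    · have := continuous_circleMap (0 : ℂ) r
      fun_prop
    · intro θ h0
      have h1 : a * circleMap 0 r θ ^ m = 1 := by
        have := pow_eq_zero_iff (two_ne_zero) |>.mp h0
        exact (sub_eq_zero.mp (norm_eq_zero.mp this)).symm
      have hn : ‖a * circleMap 0 r θ ^ m‖ = ‖a‖ * r ^ m := by
        simp [abs_of_nonneg hr]
      rw [h1] at hn
      simp at hn
      linarith
  · exact Filter.Eventually.of_forall fun θ => by positivity

theorem lintegral_complex_kernel {a : ℂ} {m : ℕ} (hm : 0 < m) {φ : ℝ → ℝ≥0∞} (hφ : Measurable φ)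
    {ρ : ℝ} (hρ : ‖a‖ * ρ ^ m ≤ 1) (hρ0 : 0 < ρ) :
    ∫⁻ z in Metric.ball (0 : ℂ) ρ, ENNReal.ofReal (‖1 - a * z ^ m‖ ^ 2)⁻¹ * φ ‖z‖ =
      ENNReal.ofReal (2 * π) * ∫⁻ r in Ioo (0 : ℝ) ρ,
        ENNReal.ofReal (r * (1 - (‖a‖ * r ^ m) ^ 2)⁻¹) * φ r := by
  rw [← lintegral_indicator Metric.isOpen_ball.measurableSet, lintegral_complex_eq_polar]
  swap
  · refine Measurable.indicator ?_ Metric.isOpen_ball.measurableSet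
    fun_prop
  have h1 : Ioi (0 : ℝ) = Ioo 0 ρ ∪ Ici ρ := by
    ext x; simp only [mem_Ioi, mem_union, mem_Ioo, mem_Ici]
    constructor
    · intro hx; rcases lt_or_ge x ρ with h | h <;> simp [*]
    · rintro (h | h) <;> linarith [h, hρ0]
  rw [h1, lintegral_union measurableSet_Ici]
  swap
  · rw [Set.disjoint_left]; intro x hx hx'; simp at hx hx'; linarith
  have h2 : ∫⁻ r in Ici ρ, ∫⁻ θ in Ioo (-π) π, ENNReal.ofReal r *
      (Metric.ball (0 : ℂ) ρ).indicator (fun z => ENNReal.ofReal (‖1 - a * z ^ m‖ ^ 2)⁻¹ * φ ‖z‖)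
        (circleMap 0 r θ) = 0 := by
    rw [setLIntegral_congr_fun (g := fun _ => 0) measurableSet_Ici, lintegral_zero]
    intro r hr
    have hr' : |r| = r := abs_of_pos (lt_of_lt_of_le hρ0 hr)
    have : ∀ θ, circleMap 0 r θ ∉ Metric.ball (0 : ℂ) ρ := by
      intro θ; simp only [mem_ball_zero_iff, norm_circleMap_zero, hr', not_lt]; exact hr
    simp [this]
  rw [h2, add_zero, ← lintegral_const_mul]
  swap
  · fun_prop
  refine setLIntegral_congr_fun measurableSet_Ioo fun r hr => ?_
  have hr' : |r| = r := abs_of_pos hr.1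
  have : ∀ θ, circleMap 0 r θ ∈ Metric.ball (0 : ℂ) ρ := by
    intro θ; simpa [hr'] using hr.2
  simp only [this, indicator_of_mem, norm_circleMap_zero, hr']
  have hlt : ‖a‖ * r ^ m < 1 := by
    rcases eq_or_lt_of_le (norm_nonneg a) with h | h
    · simp [← h]
    -- Equality `‖a‖ ρ ^ m = 1` is permitted, because only radii `r < ρ` are integrated.
    · refine lt_of_lt_of_le ?_ hρ
      have := pow_lt_pow_left₀ hr.2 hr.1.le hm.ne'
      gcongr
  simp_rw [mul_comm _ (φ r), mul_left_comm _ (φ r)]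
  rw [lintegral_const_mul, lintegral_const_mul, lintegral_inv_normSq_one_sub hm hr.1.le hlt,
    ← ENNReal.ofReal_mul hr.1.le, ← ENNReal.ofReal_mul (by positivity)]
  · congr 2; ring
  · have := (continuous_circleMap (0 : ℂ) r).measurable
    fun_prop
  · have := (continuous_circleMap (0 : ℂ) r).measurable
    fun_prop

theorem lintegral_Ioo_rpow {s t : ℝ} (hs : -1 < s) (ht : 0 ≤ t) :
    ∫⁻ x in Ioo 0 t, ENNReal.ofReal (x ^ s) = ENNReal.ofReal (t ^ (s + 1) / (s + 1)) := by
  have h1 : ∫ x in (0 : ℝ)..t, x ^ s = t ^ (s + 1) / (s + 1) := by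
    rw [integral_rpow (Or.inl hs), Real.zero_rpow (by linarith), sub_zero]
  rw [← h1, intervalIntegral.integral_of_le ht, ofReal_integral_eq_lintegral_ofReal,
    restrict_Ioo_eq_restrict_Ioc]
  · exact (intervalIntegrable_iff_integrableOn_Ioc_of_le ht).mp
      (intervalIntegral.intervalIntegrable_rpow' hs)
  · filter_upwards [ae_restrict_mem measurableSet_Ioc] with x hx
    exact Real.rpow_nonneg hx.1.le _

theorem lintegral_Ioo_rpow_eq_top {s t : ℝ} (hs : s ≤ -1) (ht : 0 < t) :
    ∫⁻ x in Ioo 0 t, ENNReal.ofReal (x ^ s) = ⊤ := by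
  by_contra hne
  have : IntegrableOn (fun x : ℝ => x ^ s) (Ioo 0 t) := by
    refine ⟨(by fun_prop : Measurable fun x : ℝ => x ^ s).aestronglyMeasurable, ?_⟩
    rw [hasFiniteIntegral_iff_ofReal]
    · exact lt_top_iff_ne_top.mpr hne
    · filter_upwards [ae_restrict_mem measurableSet_Ioo] with x hx
      exact Real.rpow_nonneg hx.1.le _
  rw [intervalIntegral.integrableOn_Ioo_rpow_iff ht] at this
  linarith

theorem lintegral_Ioi_rpow {s t : ℝ} (hs : s < -1) (ht : 0 < t) :
    ∫⁻ x in Ioi t, ENNReal.ofReal (x ^ s) = ENNReal.ofReal (-t ^ (s + 1) / (s + 1)) := by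
  rw [← integral_Ioi_rpow_of_lt hs ht, ofReal_integral_eq_lintegral_ofReal]
  · exact integrableOn_Ioi_rpow_of_lt hs ht
  · filter_upwards [ae_restrict_mem measurableSet_Ioi] with x hx
    exact Real.rpow_nonneg (ht.trans hx).le _

theorem lintegral_Ioo_one_sub (f : ℝ → ℝ≥0∞) :
    ∫⁻ x in Ioo (0 : ℝ) 1, f (1 - x) = ∫⁻ x in Ioo (0 : ℝ) 1, f x := by
  rw [← lintegral_indicator measurableSet_Ioo, ← lintegral_indicator measurableSet_Ioo,
    ← lintegral_sub_left_eq_self (fun x => (Ioo (0 : ℝ) 1).indicator f x) 1]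
  congr 1
  ext x
  simp only [indicator, mem_Ioo]
  congr 1
  simp only [eq_iff_iff]
  constructor <;> rintro ⟨h1, h2⟩ <;> constructor <;> linarith

/-- With `s = 1 - r` and `τ = 1 - R`, the denominator `1 - (1 - s) R` is at least `max s τ`.
Splitting at `s = τ` leaves `τ⁻¹ ∫₀^τ s^{-ε}` and `∫_τ^∞ s^{-ε-1}`, both multiples of `τ^{-ε}`;
convergence needs `ε < 1` for the former and `ε > 0` for the latter. -/
theorem lintegral_singular_weight_le {ε : ℝ} (hε0 : 0 < ε) (hε1 : ε < 1) {R : ℝ} (hR0 : 0 ≤ R)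
    (hR1 : R < 1) :
    ∫⁻ r in Ioo (0 : ℝ) 1, ENNReal.ofReal ((1 - r) ^ (-ε) * (1 - r * R)⁻¹) ≤
      ENNReal.ofReal ((1 / (1 - ε) + 1 / ε) * (1 - R) ^ (-ε)) := by
  have hτ : 0 < 1 - R := by linarith
  set τ := 1 - R with hτd
  calc ∫⁻ r in Ioo (0 : ℝ) 1, ENNReal.ofReal ((1 - r) ^ (-ε) * (1 - r * R)⁻¹)
      = ∫⁻ r in Ioo (0 : ℝ) 1,
          (fun s => ENNReal.ofReal (s ^ (-ε) * (1 - (1 - s) * R)⁻¹)) (1 - r) := by simp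
    _ = ∫⁻ s in Ioo (0 : ℝ) 1, ENNReal.ofReal (s ^ (-ε) * (1 - (1 - s) * R)⁻¹) :=
        lintegral_Ioo_one_sub fun s => ENNReal.ofReal (s ^ (-ε) * (1 - (1 - s) * R)⁻¹)
    _ ≤ ∫⁻ s in Ioo 0 τ ∪ Ici τ, ENNReal.ofReal (s ^ (-ε) * (max s τ)⁻¹) := by
        refine (setLIntegral_mono' measurableSet_Ioo fun s hs => ?_).trans
          (lintegral_mono_set ?_)
        · refine ENNReal.ofReal_le_ofReal ?_
          have h1 : max s τ ≤ 1 - (1 - s) * R := by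
            refine max_le ?_ ?_ <;> nlinarith [hs.1, hs.2]
          have h2 : 0 < max s τ := lt_max_of_lt_right hτ
          have := Real.rpow_nonneg hs.1.le (-ε)
          gcongr
        · intro s hs
          rcases lt_or_ge s τ with h | h
          · exact Or.inl ⟨hs.1, h⟩
          · exact Or.inr h
    _ ≤ (∫⁻ s in Ioo 0 τ, ENNReal.ofReal (s ^ (-ε) * (max s τ)⁻¹)) +
          ∫⁻ s in Ici τ, ENNReal.ofReal (s ^ (-ε) * (max s τ)⁻¹) := lintegral_union_le _ _ _
    _ ≤ ENNReal.ofReal (τ⁻¹) * ENNReal.ofReal (τ ^ (-ε + 1) / (-ε + 1)) +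
          ENNReal.ofReal (-τ ^ ((-ε - 1) + 1) / ((-ε - 1) + 1)) := by
        refine add_le_add ?_ ?_
        · rw [← lintegral_Ioo_rpow (by linarith) hτ.le, ← lintegral_const_mul _ (by fun_prop)]
          refine setLIntegral_mono' measurableSet_Ioo fun s hs => ?_
          rw [max_eq_right hs.2.le, mul_comm, ENNReal.ofReal_mul (by positivity)]
        · rw [← lintegral_Ioi_rpow (by linarith) hτ, restrict_Ioi_eq_restrict_Ici]
          refine setLIntegral_mono' measurableSet_Ici fun s hs => ?_
          rw [max_eq_left hs, Real.rpow_sub_one (lt_of_lt_of_le hτ hs).ne']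
          rfl
    _ = ENNReal.ofReal ((1 / (1 - ε) + 1 / ε) * τ ^ (-ε)) := by
        rw [← ENNReal.ofReal_mul (by positivity), ← ENNReal.ofReal_add]
        · congr 1
          rw [Real.rpow_add_one hτ.ne', sub_add_cancel]
          have : -ε + 1 ≠ 0 := by linarith
          have : 1 - ε ≠ 0 := by linarith
          field_simp
          ring
        · have : 0 < -ε + 1 := by linarith
          positivity
        · rw [sub_add_cancel, neg_div_neg_eq]
          positivity

theorem exists_lintegral_weight_le {δ ε : ℝ} (hδ : 0 < δ) (hε0 : 0 < ε) (hε1 : ε < 1) :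
    ∃ C : ℝ, 0 ≤ C ∧ ∀ R : ℝ, 0 ≤ R → R < 1 →
      ∫⁻ r in Ioo (0 : ℝ) 1, ENNReal.ofReal (r ^ (δ - 1) * (1 - r) ^ (-ε) * (1 - r * R)⁻¹) ≤
        ENNReal.ofReal (C * (1 - R) ^ (-ε)) := by
  -- The integral is split at `r = 1/2`. `N` bounds the factors singular at `1` on the left half;
  -- `M` bounds `r ^ (δ - 1)` on the right half, whatever the sign of `δ - 1`.
  set M : ℝ := (1 / 2 : ℝ) ^ (-|δ - 1|) with hM
  set N : ℝ := 2 * (1 / 2 : ℝ) ^ (-ε) with hN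
  have hM0 : 0 ≤ M := by positivity
  have hN0 : 0 ≤ N := by positivity
  have hε' : 0 < 1 - ε := by linarith
  refine ⟨N * (1 / δ) + M * (1 / (1 - ε) + 1 / ε), by positivity, fun R hR0 hR1 => ?_⟩
  have hτ1 : 1 ≤ (1 - R) ^ (-ε) :=
    Real.one_le_rpow_of_pos_of_le_one_of_nonpos (by linarith) (by linarith) (by linarith)
  calc ∫⁻ r in Ioo (0 : ℝ) 1, ENNReal.ofReal (r ^ (δ - 1) * (1 - r) ^ (-ε) * (1 - r * R)⁻¹)
      ≤ ∫⁻ r in Ioo (0 : ℝ) 1, (ENNReal.ofReal N * ENNReal.ofReal (r ^ (δ - 1)) +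
          ENNReal.ofReal M * ENNReal.ofReal ((1 - r) ^ (-ε) * (1 - r * R)⁻¹)) := by
        refine setLIntegral_mono' measurableSet_Ioo fun r hr => ?_
        have hrR : 0 < 1 - r * R := by nlinarith [hr.1, hr.2]
        have hr1 : 0 < 1 - r := by linarith [hr.2]
        have hr0 := hr.1
        rw [← ENNReal.ofReal_mul hN0, ← ENNReal.ofReal_mul hM0,
          ← ENNReal.ofReal_add (by positivity) (by positivity)]
        refine ENNReal.ofReal_le_ofReal ?_
        rcases le_total r (1 / 2) with h | h
        · have h1 : (1 - r) ^ (-ε) ≤ (1 / 2 : ℝ) ^ (-ε) :=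
            Real.rpow_le_rpow_of_nonpos (by norm_num) (by linarith) (by linarith)
          have h2 : (1 - r * R)⁻¹ ≤ 2 := by
            rw [inv_le_comm₀ hrR (by norm_num)]
            nlinarith
          calc r ^ (δ - 1) * (1 - r) ^ (-ε) * (1 - r * R)⁻¹
              ≤ r ^ (δ - 1) * (1 / 2 : ℝ) ^ (-ε) * 2 := by gcongr
            _ = N * r ^ (δ - 1) := by rw [hN]; ring
            _ ≤ _ := le_add_of_nonneg_right (by positivity)
        · have h1 : r ^ (δ - 1) ≤ M := by
            calc r ^ (δ - 1) ≤ r ^ (-|δ - 1|) :=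
                  Real.rpow_le_rpow_of_exponent_ge hr0 hr.2.le (neg_abs_le _)
              _ ≤ M := Real.rpow_le_rpow_of_nonpos (by norm_num) h
                  (neg_nonpos.mpr (abs_nonneg _))
          calc r ^ (δ - 1) * (1 - r) ^ (-ε) * (1 - r * R)⁻¹
              ≤ M * (1 - r) ^ (-ε) * (1 - r * R)⁻¹ := by gcongr
            _ = M * ((1 - r) ^ (-ε) * (1 - r * R)⁻¹) := by ring
            _ ≤ _ := le_add_of_nonneg_left (by positivity)
    _ = ENNReal.ofReal N * ENNReal.ofReal (1 / δ) + ENNReal.ofReal M *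
          ∫⁻ r in Ioo (0 : ℝ) 1, ENNReal.ofReal ((1 - r) ^ (-ε) * (1 - r * R)⁻¹) := by
        rw [lintegral_add_left (by fun_prop), lintegral_const_mul _ (by fun_prop),
          lintegral_const_mul _ (by fun_prop), lintegral_Ioo_rpow (by linarith) zero_le_one]
        simp
    _ ≤ ENNReal.ofReal N * ENNReal.ofReal (1 / δ) + ENNReal.ofReal M *
          ENNReal.ofReal ((1 / (1 - ε) + 1 / ε) * (1 - R) ^ (-ε)) := by
        gcongr
        exact lintegral_singular_weight_le hε0 hε1 hR0 hR1
    _ ≤ ENNReal.ofReal ((N * (1 / δ) + M * (1 / (1 - ε) + 1 / ε)) * (1 - R) ^ (-ε)) := by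
        rw [← ENNReal.ofReal_mul hN0, ← ENNReal.ofReal_mul hM0,
          ← ENNReal.ofReal_add (by positivity) (by positivity)]
        refine ENNReal.ofReal_le_ofReal ?_
        have : N * (1 / δ) ≤ N * (1 / δ) * (1 - R) ^ (-ε) :=
          le_mul_of_one_le_right (by positivity) hτ1
        nlinarith

/-! ### The domain -/

theorem mem_domain_iff {γ : ℝ} (hγ : 0 < γ) {z : ℂ × ℂ} :
    z ∈ domain γ ↔ ‖z.2‖ < 1 ∧ ‖z.1‖ < ‖z.2‖ ^ γ⁻¹ := by
  rw [Real.lt_rpow_inv_iff_of_pos (norm_nonneg _) (norm_nonneg _) hγ, and_comm]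
  rfl

theorem snd_ne_zero_of_mem_domain {γ : ℝ} {z : ℂ × ℂ} (hz : z ∈ domain γ) : z.2 ≠ 0 := by
  have := lt_of_le_of_lt (Real.rpow_nonneg (norm_nonneg z.1) γ) hz.1
  exact norm_pos_iff.mp this

theorem isOpen_domain {γ : ℝ} (hγ : 0 < γ) : IsOpen (domain γ) := by
  have h : Continuous fun z : ℂ × ℂ => ‖z.1‖ ^ γ :=
    continuous_fst.norm.rpow_const fun _ => Or.inr hγ.le
  exact (isOpen_lt h continuous_snd.norm).inter (isOpen_lt continuous_snd.norm continuous_const)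

theorem measurableSet_domain {γ : ℝ} (hγ : 0 < γ) : MeasurableSet (domain γ) :=
  (isOpen_domain hγ).measurableSet

theorem isFiniteMeasure_vol {γ : ℝ} (hγ : 0 < γ) : IsFiniteMeasure (vol γ) := by
  refine ⟨?_⟩
  rw [vol, Measure.restrict_apply_univ]
  refine lt_of_le_of_lt (measure_mono (t := Metric.ball (0 : ℂ × ℂ) 1) ?_) measure_ball_lt_top
  intro z hz
  have h := (mem_domain_iff hγ).mp hz
  rw [mem_ball_zero_iff, Prod.norm_def, max_lt_iff]
  exact ⟨h.2.trans_le (Real.rpow_le_one (norm_nonneg _) h.1.le (by positivity)), h.1⟩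

theorem lintegral_domain {γ : ℝ} (hγ : 0 < γ) {F : ℂ × ℂ → ℝ≥0∞} (hF : Measurable F) :
    ∫⁻ z in domain γ, F z =
      ∫⁻ w₂ in Metric.ball (0 : ℂ) 1, ∫⁻ w₁ in Metric.ball (0 : ℂ) (‖w₂‖ ^ γ⁻¹), F (w₁, w₂) := by
  rw [← lintegral_indicator (measurableSet_domain hγ), Measure.volume_eq_prod,
    lintegral_prod_symm _ (hF.indicator (measurableSet_domain hγ)).aemeasurable,
    ← lintegral_indicator Metric.isOpen_ball.measurableSet]
  congr 1
  ext w₂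
  by_cases h : w₂ ∈ Metric.ball (0 : ℂ) 1
  · rw [indicator_of_mem h, ← lintegral_indicator Metric.isOpen_ball.measurableSet]
    congr 1
    ext w₁
    simp only [indicator]
    congr 1
    simp only [mem_domain_iff hγ, mem_ball_zero_iff] at h ⊢
    simp [h]
  · rw [indicator_of_notMem h]
    refine (lintegral_congr fun w₁ => ?_).trans lintegral_zero
    refine indicator_of_notMem (fun h' => h ?_) _
    simpa using ((mem_domain_iff hγ).mp h').1

theorem lintegral_ball_norm {φ : ℝ → ℝ≥0∞} (hφ : Measurable φ) (ρ : ℝ) :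
    ∫⁻ z in Metric.ball (0 : ℂ) ρ, φ ‖z‖ =
      ENNReal.ofReal (2 * π) * ∫⁻ r in Ioo 0 ρ, ENNReal.ofReal r * φ r := by
  have h := lintegral_complex_norm (hφ.indicator (measurableSet_Iio (a := ρ)))
  have h1 : ∀ z : ℂ, (Iio ρ).indicator φ ‖z‖ =
      (Metric.ball (0 : ℂ) ρ).indicator (fun z => φ ‖z‖) z := by
    intro z
    simp [indicator]
  simp_rw [h1] at h
  rw [lintegral_indicator Metric.isOpen_ball.measurableSet] at h
  rw [h]
  congr 1
  have h2 : ∀ r : ℝ, ENNReal.ofReal r * (Iio ρ).indicator φ r =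
      (Iio ρ).indicator (fun r => ENNReal.ofReal r * φ r) r := by
    intro r
    by_cases hr : r ∈ Iio ρ <;> simp [hr]
  simp_rw [h2]
  rw [lintegral_indicator measurableSet_Iio, Measure.restrict_restrict measurableSet_Iio,
    inter_comm, Ioi_inter_Iio]

theorem lintegral_ball_rpow {a ρ : ℝ} (hρ : 0 ≤ ρ) (ha : -2 < a) :
    ∫⁻ z in Metric.ball (0 : ℂ) ρ, ENNReal.ofReal (‖z‖ ^ a) =
      ENNReal.ofReal (2 * π / (a + 2) * ρ ^ (a + 2)) := by
  rw [lintegral_ball_norm (φ := fun r => ENNReal.ofReal (r ^ a)) (by fun_prop)]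
  have : ∫⁻ r in Ioo 0 ρ, ENNReal.ofReal r * ENNReal.ofReal (r ^ a) =
      ∫⁻ r in Ioo 0 ρ, ENNReal.ofReal (r ^ (a + 1)) := by
    refine setLIntegral_congr_fun measurableSet_Ioo fun r hr => ?_
    rw [← ENNReal.ofReal_mul hr.1.le, Real.rpow_add_one hr.1.ne', mul_comm]
  rw [this, lintegral_Ioo_rpow (by linarith) hρ, ← ENNReal.ofReal_mul (by positivity)]
  congr 1
  rw [show a + 1 + 1 = a + 2 by ring]
  ring

theorem lintegral_ball_rpow_eq_top {a ρ : ℝ} (hρ : 0 < ρ) (ha : a ≤ -2) :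
    ∫⁻ z in Metric.ball (0 : ℂ) ρ, ENNReal.ofReal (‖z‖ ^ a) = ⊤ := by
  rw [lintegral_ball_norm (φ := fun r => ENNReal.ofReal (r ^ a)) (by fun_prop)]
  have : ∫⁻ r in Ioo 0 ρ, ENNReal.ofReal r * ENNReal.ofReal (r ^ a) =
      ∫⁻ r in Ioo 0 ρ, ENNReal.ofReal (r ^ (a + 1)) := by
    refine setLIntegral_congr_fun measurableSet_Ioo fun r hr => ?_
    rw [← ENNReal.ofReal_mul hr.1.le, Real.rpow_add_one hr.1.ne', mul_comm]
  rw [this, lintegral_Ioo_rpow_eq_top (by linarith) hρ]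
  refine ENNReal.mul_top ?_
  simp [Real.pi_pos]

theorem lintegral_domain_rpow_inner {γ : ℝ} (hγ : 0 < γ) {a : ℝ} (b : ℝ) (ha : -2 < a) :
    ∫⁻ v in domain γ, ENNReal.ofReal (‖v.1‖ ^ a * ‖v.2‖ ^ b) =
      ENNReal.ofReal (2 * π / (a + 2)) *
        ∫⁻ w in Metric.ball (0 : ℂ) 1, ENNReal.ofReal (‖w‖ ^ ((a + 2) / γ + b)) := by
  rw [lintegral_domain hγ (by fun_prop), ← lintegral_const_mul _ (by fun_prop)]
  have h0 : ∀ᵐ w : ℂ ∂(volume.restrict (Metric.ball (0 : ℂ) 1)), w ≠ 0 :=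
    Measure.ae_ne _ _
  refine lintegral_congr_ae ?_
  filter_upwards [h0] with w hw
  have hw' : 0 < ‖w‖ := norm_pos_iff.mpr hw
  have h1 : ∀ w₁ : ℂ, ENNReal.ofReal (‖w₁‖ ^ a * ‖w‖ ^ b) =
      ENNReal.ofReal (‖w₁‖ ^ a) * ENNReal.ofReal (‖w‖ ^ b) := fun w₁ =>
    ENNReal.ofReal_mul (by positivity)
  have ha' : 0 < a + 2 := by linarith
  simp_rw [h1]
  rw [lintegral_mul_const _ (by fun_prop), lintegral_ball_rpow (by positivity) ha,
    ← ENNReal.ofReal_mul (by positivity), ← ENNReal.ofReal_mul (by positivity), mul_assoc]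
  congr 2
  rw [← Real.rpow_mul hw'.le, ← Real.rpow_add hw']
  congr 1
  ring

theorem lintegral_domain_rpow {γ : ℝ} (hγ : 0 < γ) {a b : ℝ} (ha : -2 < a)
    (hb : 0 < (a + 2) / γ + b + 2) :
    ∫⁻ v in domain γ, ENNReal.ofReal (‖v.1‖ ^ a * ‖v.2‖ ^ b) =
      ENNReal.ofReal ((2 * π) ^ 2 / ((a + 2) * ((a + 2) / γ + b + 2))) := by
  have ha' : 0 < a + 2 := by linarith
  rw [lintegral_domain_rpow_inner hγ b ha, lintegral_ball_rpow zero_le_one (by linarith),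
    ← ENNReal.ofReal_mul (by positivity)]
  congr 1
  rw [Real.one_rpow]
  field_simp

/-- If `a ≤ -2`, the integral over every slice `z₂ ≠ 0` already diverges. Otherwise the slice
integrates to a multiple of `‖z₂‖ ^ ((a + 2)/γ + b)`, which must be integrable at the origin of the
disc. -/
theorem of_lintegral_domain_rpow_ne_top {γ : ℝ} (hγ : 0 < γ) {a b : ℝ}
    (h : ∫⁻ v in domain γ, ENNReal.ofReal (‖v.1‖ ^ a * ‖v.2‖ ^ b) ≠ ⊤) :
    -2 < a ∧ 0 < (a + 2) / γ + b + 2 := by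
  have ha : -2 < a := by
    by_contra ha
    refine h ?_
    rw [lintegral_domain hγ (by fun_prop)]
    have h2 : ∀ w ∈ Metric.ball (0 : ℂ) 1 \ {0}, ∫⁻ w₁ in Metric.ball (0 : ℂ) (‖w‖ ^ γ⁻¹),
        ENNReal.ofReal (‖w₁‖ ^ a * ‖w‖ ^ b) = ⊤ := by
      intro w hw
      have hw' : 0 < ‖w‖ := norm_pos_iff.mpr hw.2
      have h1 : ∀ w₁ : ℂ, ENNReal.ofReal (‖w₁‖ ^ a * ‖w‖ ^ b) =
          ENNReal.ofReal (‖w₁‖ ^ a) * ENNReal.ofReal (‖w‖ ^ b) := fun w₁ =>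
        ENNReal.ofReal_mul (by positivity)
      simp_rw [h1]
      rw [lintegral_mul_const _ (by fun_prop),
        lintegral_ball_rpow_eq_top (by positivity) (not_lt.mp ha)]
      exact ENNReal.top_mul (by simpa using by positivity)
    refine eq_top_mono (lintegral_mono_set (s := Metric.ball (0 : ℂ) 1 \ {0}) sdiff_subset) ?_
    rw [setLIntegral_congr_fun (Metric.isOpen_ball.measurableSet.diff (measurableSet_singleton 0))
      h2, setLIntegral_const]
    refine ENNReal.top_mul ?_
    rw [measure_sdiff_null (measure_singleton 0)]
    exact (Metric.measure_ball_pos _ _ one_pos).ne'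
  refine ⟨ha, ?_⟩
  by_contra hb
  refine h ?_
  rw [lintegral_domain_rpow_inner hγ b ha,
    lintegral_ball_rpow_eq_top one_pos (by linarith)]
  have ha' : 0 < a + 2 := by linarith
  refine ENNReal.mul_top ?_
  have : 0 < 2 * π / (a + 2) := by positivity
  simpa using this

/-! ### Monomials -/

theorem norm_monomial (α : ℤ × ℤ) (z : ℂ × ℂ) :
    ‖monomial α z‖ = ‖z.1‖ ^ α.1 * ‖z.2‖ ^ α.2 := by
  simp [monomial]

@[fun_prop]
theorem measurable_monomial (α : ℤ × ℤ) : Measurable (monomial α) := by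
  unfold monomial
  fun_prop

theorem enorm_monomial_rpow (α : ℤ × ℤ) {p : ℝ} (hp : 0 ≤ p) (z : ℂ × ℂ) :
    ‖monomial α z‖ₑ ^ p = ENNReal.ofReal (‖z.1‖ ^ (α.1 * p) * ‖z.2‖ ^ (α.2 * p)) := by
  rw [← ofReal_norm, ENNReal.ofReal_rpow_of_nonneg (norm_nonneg _) hp, norm_monomial,
    Real.mul_rpow (by positivity) (by positivity), Real.rpow_mul (norm_nonneg _),
    Real.rpow_mul (norm_nonneg _), Real.rpow_intCast, Real.rpow_intCast]

theorem differentiableOn_monomial {γ : ℝ} {α : ℤ × ℤ} (hα : 0 ≤ α.1) :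
    DifferentiableOn ℂ (monomial α) (domain γ) := by
  intro z hz
  have h2 := snd_ne_zero_of_mem_domain hz
  refine DifferentiableAt.differentiableWithinAt ?_
  exact (differentiableAt_fst.zpow (Or.inr hα)).mul (differentiableAt_snd.zpow (Or.inl h2))

theorem mem_allowable_iff {γ : ℝ} (hγ : 0 < γ) {p : ℝ≥0∞} (hp : 2 ≤ p) (hp' : p ≠ ∞)
    {α : ℤ × ℤ} :
    α ∈ allowable γ p ↔ 0 ≤ α.1 ∧ 0 < (α.1 * p.toReal + 2) / γ + α.2 * p.toReal + 2 := by
  have hp0 : p ≠ 0 := by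
    rintro rfl; simp at hp
  have hpr : 2 ≤ p.toReal := by
    simpa using ENNReal.toReal_mono hp' hp
  have key : (∫⁻ v in domain γ, ‖monomial α v‖ₑ ^ p.toReal) =
      ∫⁻ v in domain γ, ENNReal.ofReal (‖v.1‖ ^ (α.1 * p.toReal) * ‖v.2‖ ^ (α.2 * p.toReal)) :=
    lintegral_congr fun v => enorm_monomial_rpow α (by linarith) v
  constructor
  · rintro ⟨-, h⟩
    have h1 := (eLpNorm_lt_top_iff_lintegral_rpow_enorm_lt_top hp0 hp').mp h.2
    rw [vol, key] at h1
    obtain ⟨h2, h3⟩ := of_lintegral_domain_rpow_ne_top hγ h1.ne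
    refine ⟨?_, h3⟩
    by_contra h4
    -- Here `p ≥ 2` enters: a negative `α₁` gives `α₁ p ≤ -2`, which contradicts integrability
    -- across `z₁ = 0`.
    have h5 : (α.1 : ℝ) ≤ -1 := by exact_mod_cast (by omega : α.1 ≤ -1)
    nlinarith
  · rintro ⟨h1, h2⟩
    refine ⟨differentiableOn_monomial h1, (measurable_monomial α).aestronglyMeasurable, ?_⟩
    rw [eLpNorm_lt_top_iff_lintegral_rpow_enorm_lt_top hp0 hp', vol, key,
      lintegral_domain_rpow hγ _ h2]
    · exact ENNReal.ofReal_lt_top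
    · have : (0 : ℝ) ≤ α.1 := by exact_mod_cast h1
      nlinarith

theorem mem_allowable_of_lintegral_ne_top {γ : ℝ} (hγ : 0 < γ) {p : ℝ≥0∞} (hp : 2 ≤ p)
    (hp' : p ≠ ∞) {α : ℤ × ℤ} (h : ∫⁻ v in domain γ, ‖monomial α v‖ₑ ^ p.toReal ≠ ⊤) :
    α ∈ allowable γ p := by
  have hpr : 2 ≤ p.toReal := by
    simpa using ENNReal.toReal_mono hp' hp
  rw [mem_allowable_iff hγ hp hp']
  simp_rw [enorm_monomial_rpow α (by linarith : 0 ≤ p.toReal)] at h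
  obtain ⟨h2, h3⟩ := of_lintegral_domain_rpow_ne_top hγ h
  refine ⟨?_, h3⟩
  by_contra h4
  have h5 : (α.1 : ℝ) ≤ -1 := by exact_mod_cast (by omega : α.1 ≤ -1)
  nlinarith

theorem memLp_monomial {γ : ℝ} {p : ℝ≥0∞} {α : ℤ × ℤ} (hα : α ∈ allowable γ p) :
    MemLp (monomial α) p (vol γ) := hα.2

theorem allowable_subset_two {γ : ℝ} (hγ : 0 < γ) {p : ℝ≥0∞} (hp : 2 ≤ p) :
    allowable γ p ⊆ allowable γ 2 := fun _ hα =>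
  have := isFiniteMeasure_vol hγ
  ⟨hα.1, hα.2.mono_exponent hp⟩

theorem fst_nonneg_of_mem_allowable {γ : ℝ} (hγ : 0 < γ) {α : ℤ × ℤ} (hα : α ∈ allowable γ 2) :
    0 ≤ α.1 :=
  ((mem_allowable_iff hγ le_rfl (by simp)).mp hα).1

theorem integral_sq_norm_monomial {γ : ℝ} (hγ : 0 < γ) {α : ℤ × ℤ} (hα : α ∈ allowable γ 2) :
    0 < (α.1 + 1) / γ + α.2 + 1 ∧ ∫ v in domain γ, ‖monomial α v‖ ^ 2 =
      π ^ 2 / ((α.1 + 1) * ((α.1 + 1) / γ + α.2 + 1)) := by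
  obtain ⟨h1, h2⟩ := (mem_allowable_iff hγ le_rfl (by simp)).mp hα
  have h1' : (0 : ℝ) ≤ α.1 := by exact_mod_cast h1
  simp only [ENNReal.toReal_ofNat] at h2
  have h3 : (α.1 * 2 + 2 : ℝ) / γ = 2 * ((α.1 + 1) / γ) := by ring
  have h4 : 0 < (α.1 + 1) / γ + α.2 + 1 := by rw [h3] at h2; linarith
  refine ⟨h4, ?_⟩
  rw [integral_eq_lintegral_of_nonneg_ae (Filter.Eventually.of_forall fun v => by positivity)
    (by fun_prop)]
  have h5 : ∀ v : ℂ × ℂ, ENNReal.ofReal (‖monomial α v‖ ^ 2) =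
      ENNReal.ofReal (‖v.1‖ ^ (α.1 * 2 : ℝ) * ‖v.2‖ ^ (α.2 * 2 : ℝ)) := by
    intro v
    rw [← enorm_monomial_rpow α zero_le_two, ← ofReal_norm,
      ENNReal.ofReal_rpow_of_nonneg (norm_nonneg _) zero_le_two]
    simp
  simp_rw [h5]
  rw [lintegral_domain_rpow hγ (by linarith) h2, ENNReal.toReal_ofReal (by positivity), h3]
  have : (α.1 + 1 : ℝ) ≠ 0 := by positivity
  have h6 : 2 * ((α.1 + 1) / γ) + α.2 * 2 + 2 = 2 * ((α.1 + 1) / γ + α.2 + 1) := by ring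
  have h7 : (α.1 * 2 + 2 : ℝ) = 2 * (α.1 + 1) := by ring
  rw [h6, h7]
  generalize (α.1 + 1 : ℝ) / γ + α.2 + 1 = x at h4 ⊢
  field_simp

/-! ### Series of holomorphic functions -/

/-- Cauchy's estimate in one variable, applied to each complex line `t ↦ w + t v` on the disc of
radius `r / ‖v‖`. -/
theorem norm_fderiv_le_of_norm_le {E : Type*} [NormedAddCommGroup E] [NormedSpace ℂ E]
    {f : E → ℂ} {w : E} {r M : ℝ} (hr : 0 < r)
    (hf : ∀ x, ‖x - w‖ ≤ r → DifferentiableAt ℂ f x) (hM : ∀ x, ‖x - w‖ ≤ r → ‖f x‖ ≤ M) :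
    ‖fderiv ℂ f w‖ ≤ M / r := by
  have hM0 : 0 ≤ M := (norm_nonneg _).trans (hM w (by simpa using hr.le))
  refine ContinuousLinearMap.opNorm_le_bound _ (by positivity) fun v => ?_
  rcases eq_or_ne v 0 with rfl | hv
  · simp
  have hv' : 0 < ‖v‖ := norm_pos_iff.mpr hv
  have hR : 0 < r / ‖v‖ := by positivity
  have hmem : ∀ t : ℂ, ‖t‖ ≤ r / ‖v‖ → ‖w + t • v - w‖ ≤ r := by
    intro t ht
    rw [add_sub_cancel_left, norm_smul]
    exact (le_div_iff₀ hv').mp ht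
  have hline : ∀ t : ℂ, HasDerivAt (fun t : ℂ => w + t • v) v t := by
    intro t
    simpa using ((hasDerivAt_id t).smul_const v).const_add w
  have hd : ∀ t : ℂ, ‖t‖ ≤ r / ‖v‖ → DifferentiableAt ℂ (fun t : ℂ => f (w + t • v)) t :=
    fun t ht => (hf _ (hmem t ht)).comp t (hline t).differentiableAt
  have h1 := Complex.norm_deriv_le_of_forall_mem_sphere_norm_le (c := (0 : ℂ)) (C := M) hR
    (DifferentiableOn.diffContOnCl fun t ht => (hd t (by
      simpa using Metric.closure_ball_subset_closedBall ht)).differentiableWithinAt)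
    (fun t ht => hM _ (hmem t (by simpa using le_of_eq (mem_sphere_iff_norm.mp ht))))
  have h2 : deriv (fun t : ℂ => f (w + t • v)) 0 = fderiv ℂ f w v := by
    have h3 : HasFDerivAt f (fderiv ℂ f w) (w + (0 : ℂ) • v) := by
      simpa using (hf w (by simpa using hr.le)).hasFDerivAt
    exact (h3.comp_hasDerivAt (0 : ℂ) (hline 0)).deriv
  rw [h2] at h1
  refine h1.trans (le_of_eq ?_)
  field_simp

/-- A local summable majorant of the terms yields one of their derivatives by Cauchy's estimate on
half the radius, so the series may be differentiated term by term. -/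
theorem differentiableOn_tsum_of_locally_summable {ι E : Type*} [NormedAddCommGroup E]
    [NormedSpace ℂ E] {s : Set E} (hs : IsOpen s) {f : ι → E → ℂ}
    (hf : ∀ i, DifferentiableOn ℂ (f i) s)
    (hb : ∀ z ∈ s, ∃ U ∈ nhds z, ∃ u : ι → ℝ, Summable u ∧ ∀ i, ∀ w ∈ U, ‖f i w‖ ≤ u i) :
    DifferentiableOn ℂ (fun z => ∑' i, f i z) s := by
  intro z hz
  obtain ⟨U, hU, u, hu, hbd⟩ := hb z hz
  obtain ⟨ε, hε, hball⟩ := Metric.mem_nhds_iff.mp (Filter.inter_mem hU (hs.mem_nhds hz))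
  have hr : 0 < ε / 2 := by positivity
  have hmem : ∀ w ∈ Metric.ball z (ε / 2), ∀ x, ‖x - w‖ ≤ ε / 2 → x ∈ U ∩ s := by
    intro w hw x hx
    refine hball ?_
    rw [mem_ball_iff_norm] at hw ⊢
    calc ‖x - z‖ = ‖(x - w) + (w - z)‖ := by congr 1; abel
      _ ≤ ‖x - w‖ + ‖w - z‖ := norm_add_le _ _
      _ < ε := by linarith
  have hdiff : ∀ i, ∀ w ∈ s, DifferentiableAt ℂ (f i) w := fun i w hw =>
    (hf i).differentiableAt (hs.mem_nhds hw)
  have hzb : z ∈ Metric.ball z (ε / 2) := Metric.mem_ball_self hr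
  have hsm : Summable fun i => f i z :=
    Summable.of_norm_bounded hu fun i => hbd i z (mem_of_mem_nhds hU)
  refine HasFDerivAt.differentiableAt (f' := ∑' i, fderiv ℂ (f i) z) ?_ |>.differentiableWithinAt
  refine hasFDerivAt_tsum_of_isPreconnected (u := fun i => u i / (ε / 2)) (hu.div_const _)
    Metric.isOpen_ball (convex_ball z (ε / 2)).isPreconnected ?_ ?_ hzb hsm hzb
  · intro i w hw
    exact (hdiff i w (hmem w hw w (by simpa using hr.le)).2).hasFDerivAt
  · intro i w hw
    exact norm_fderiv_le_of_norm_le hr (fun x hx => hdiff i x (hmem w hw x hx).2)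
      fun x hx => hbd i x (hmem w hw x hx).1

/-! ### Summability of the kernel series -/

/-- The squared `L^2` norm of a monomial. -/
def monomialNormSq (γ : ℝ) (α : ℤ × ℤ) : ℝ := ∫ v in domain γ, ‖monomial α v‖ ^ 2

theorem monomialNormSq_pos {γ : ℝ} (hγ : 0 < γ) {α : ℤ × ℤ} (hα : α ∈ allowable γ 2) :
    0 < monomialNormSq γ α := by
  obtain ⟨h1, h2⟩ := integral_sq_norm_monomial hγ hα
  have h3 : (0 : ℝ) ≤ α.1 := by exact_mod_cast fst_nonneg_of_mem_allowable hγ hα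
  rw [monomialNormSq, h2]
  positivity

theorem inv_monomialNormSq {γ : ℝ} (hγ : 0 < γ) {α : ℤ × ℤ} (hα : α ∈ allowable γ 2) :
    (monomialNormSq γ α)⁻¹ = (α.1 + 1) * ((α.1 + 1) / γ + α.2 + 1) / π ^ 2 := by
  rw [monomialNormSq, (integral_sq_norm_monomial hγ hα).2, inv_div]

/-- With `x = ‖z₁‖ / ‖z₂‖^{1/γ} < 1`, `R = ‖z₂‖ < 1` and `E = (α₁+1)/γ + α₂ + 1 > 0`, the modulus of
`e_α(z)` is `x^{α₁} R^{E - 1 - 1/γ}`, and the inverse squared norm is polynomial in `α₁` and `E`.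
The added `1` in the weight serves the estimate of the coefficients of a general `L²` function
later. -/
theorem summable_norm_monomial {γ : ℝ} (hγ : 0 < γ) {z : ℂ × ℂ} (hz : z ∈ domain γ) :
    Summable fun α : allowable γ 2 => ‖monomial α z‖ * (1 + (monomialNormSq γ α)⁻¹) := by
  obtain ⟨hR1, hx⟩ := (mem_domain_iff hγ).mp hz
  set R := ‖z.2‖ with hR
  have hR0 : 0 < R := norm_pos_iff.mpr (snd_ne_zero_of_mem_domain hz)
  set x := ‖z.1‖ / R ^ γ⁻¹ with hxdef
  have hRγ : 0 < R ^ γ⁻¹ := by positivity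
  have hx0 : 0 ≤ x := by positivity
  have hx1 : x < 1 := (div_lt_one hRγ).mpr hx
  have hz1 : ‖z.1‖ = x * R ^ γ⁻¹ := by rw [hxdef]; field_simp
  have hgeom : ∀ {y : ℝ}, 0 ≤ y → y < 1 → Summable fun k : ℕ => ((k : ℝ) + 1) * y ^ k := by
    intro y hy0 hy1
    have hy : ‖y‖ < 1 := by rwa [Real.norm_of_nonneg hy0]
    have h1 : Summable fun k : ℕ => (k : ℝ) * y ^ k := by
      simpa using summable_pow_mul_geometric_of_norm_lt_one 1 hy
    have h2 := summable_geometric_of_lt_one hy0 hy1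
    exact (h1.add h2).congr fun k => by ring
  have hprod : Summable fun k : ℕ × ℕ => (((k.1 : ℝ) + 1) * x ^ k.1) * (((k.2 : ℝ) + 1) * R ^ k.2) :=
    (hgeom hx0 hx1).mul_of_nonneg (hgeom hR0.le hR1) (fun k => by positivity)
      fun k => by positivity
  -- `E` need not be an integer, so its ceiling minus one indexes the second geometric series. For
  -- fixed `α₁`, distinct `α₂` give ceilings differing by an integer, hence injectivity.
  let e : allowable γ 2 → ℕ × ℕ := fun α =>
    (α.1.1.toNat, (⌈((α.1.1 : ℝ) + 1) / γ + α.1.2 + 1⌉ - 1).toNat)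
  have hceil : ∀ α : allowable γ 2, 1 ≤ ⌈((α.1.1 : ℝ) + 1) / γ + α.1.2 + 1⌉ := by
    intro α
    exact Int.one_le_ceil_iff.mpr (integral_sq_norm_monomial hγ α.2).1
  have he : Function.Injective e := by
    intro α β h
    simp only [e, Prod.mk.injEq] at h
    have h1 := fst_nonneg_of_mem_allowable hγ α.2
    have h2 := fst_nonneg_of_mem_allowable hγ β.2
    have h3 : α.1.1 = β.1.1 := by omega
    have h4 := hceil α
    have h5 := hceil β
    have h6 : ⌈((α.1.1 : ℝ) + 1) / γ + α.1.2 + 1⌉ = ⌈((β.1.1 : ℝ) + 1) / γ + β.1.2 + 1⌉ := by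
      omega
    rw [h3, add_assoc, add_assoc, add_comm (α.1.2 : ℝ), add_comm (β.1.2 : ℝ), ← add_assoc,
      ← add_assoc, Int.ceil_add_intCast, Int.ceil_add_intCast] at h6
    exact Subtype.ext (Prod.ext h3 (by omega))
  refine Summable.of_nonneg_of_le (fun α => ?_) (fun α => ?_)
    ((hprod.comp_injective he).mul_left (2 * R ^ (-(γ⁻¹ + 1))))
  · have := monomialNormSq_pos hγ α.2
    positivity
  obtain ⟨⟨i, j⟩, hα⟩ := α
  obtain ⟨k, rfl⟩ := Int.eq_ofNat_of_zero_le (fst_nonneg_of_mem_allowable hγ hα)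
  obtain ⟨hE, -⟩ := integral_sq_norm_monomial hγ hα
  have hl := hceil ⟨_, hα⟩
  rw [inv_monomialNormSq hγ hα, norm_monomial]
  simp only [Function.comp, e, Int.toNat_natCast, Int.cast_natCast] at hE hl ⊢
  obtain ⟨l, hl'⟩ := Int.eq_ofNat_of_zero_le (sub_nonneg.mpr hl)
  have hlt := Int.ceil_lt_add_one (((k : ℝ) + 1) / γ + j + 1)
  have hle := Int.le_ceil (((k : ℝ) + 1) / γ + j + 1)
  rw [hl']
  have hl2 : (⌈((k : ℝ) + 1) / γ + j + 1⌉ : ℝ) = l + 1 := by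
    have : ⌈((k : ℝ) + 1) / γ + j + 1⌉ = l + 1 := by omega
    rw [this]; push_cast; ring
  rw [hl2] at hlt hle
  simp only [Int.toNat_natCast]
  rw [zpow_natCast, hz1, mul_pow, ← Real.rpow_natCast (R ^ γ⁻¹), ← Real.rpow_mul hR0.le]
  rw [← hR, ← Real.rpow_intCast R j, mul_assoc (x ^ k), ← Real.rpow_add hR0]
  -- The exponent on the left is `E - (γ⁻¹ + 1)`, and `E > ⌈E⌉ - 1 = l`.
  have h1 : R ^ (γ⁻¹ * k + j) ≤ R ^ (-(γ⁻¹ + 1)) * R ^ l := by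
    rw [← Real.rpow_natCast R l, ← Real.rpow_add hR0]
    refine Real.rpow_le_rpow_of_exponent_ge hR0 hR1.le ?_
    have : ((k : ℝ) + 1) / γ = γ⁻¹ * k + γ⁻¹ := by field_simp
    linarith
  have h2 : 1 + ((k : ℝ) + 1) * (((k : ℝ) + 1) / γ + j + 1) / π ^ 2 ≤
      2 * (((k : ℝ) + 1) * ((l : ℝ) + 1)) := by
    have h3 : ((k : ℝ) + 1) * (((k : ℝ) + 1) / γ + j + 1) / π ^ 2 ≤
        ((k : ℝ) + 1) * ((l : ℝ) + 1) := by
      refine (div_le_self (by positivity) ?_).trans (by gcongr)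
      nlinarith [Real.pi_gt_three]
    have h4 : 1 ≤ ((k : ℝ) + 1) * ((l : ℝ) + 1) := by
      nlinarith [(Nat.cast_nonneg k : (0 : ℝ) ≤ k), (Nat.cast_nonneg l : (0 : ℝ) ≤ l),
        mul_nonneg (Nat.cast_nonneg k : (0 : ℝ) ≤ k) (Nat.cast_nonneg l : (0 : ℝ) ≤ l)]
    linarith
  calc x ^ k * R ^ (γ⁻¹ * k + j) * (1 + ((k : ℝ) + 1) * (((k : ℝ) + 1) / γ + j + 1) / π ^ 2)
      ≤ x ^ k * (R ^ (-(γ⁻¹ + 1)) * R ^ l) * (2 * (((k : ℝ) + 1) * ((l : ℝ) + 1))) := by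
        gcongr
    _ = _ := by ring

/-- The modulus of `e_α(z) conj (e_α(w))` is that of `e_α` at the coordinatewise product, so
summability of the kernel series reduces to summability at a single point. -/
theorem mul_mem_domain {γ : ℝ} (hγ : 0 < γ) {z w : ℂ × ℂ} (hz : z ∈ domain γ)
    (hw : w ∈ domain γ) : (z.1 * w.1, z.2 * w.2) ∈ domain γ := by
  rw [mem_domain_iff hγ] at *
  simp only [norm_mul]
  rw [Real.mul_rpow (norm_nonneg _) (norm_nonneg _)]
  constructor
  · nlinarith [norm_nonneg z.2, norm_nonneg w.2]
  · exact mul_lt_mul'' hz.2 hw.2 (norm_nonneg _) (norm_nonneg _)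

theorem norm_kernelTerm (γ : ℝ) (z w : ℂ × ℂ) (α : ℤ × ℤ) :
    ‖kernelTerm γ z w α‖ = ‖monomial α z‖ * ‖monomial α w‖ * |monomialNormSq γ α|⁻¹ := by
  simp [kernelTerm, monomialNormSq, div_eq_mul_inv]

theorem summable_kernelTerm {γ : ℝ} (hγ : 0 < γ) {z w : ℂ × ℂ} (hz : z ∈ domain γ)
    (hw : w ∈ domain γ) : Summable fun α : allowable γ 2 => kernelTerm γ z w α := by
  refine Summable.of_norm_bounded (summable_norm_monomial hγ (mul_mem_domain hγ hz hw))
    fun α => ?_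
  have := monomialNormSq_pos hγ α.2
  rw [norm_kernelTerm, abs_of_pos this]
  have h1 : ‖monomial α (z.1 * w.1, z.2 * w.2)‖ = ‖monomial α z‖ * ‖monomial α w‖ := by
    simp only [norm_monomial, norm_mul, mul_zpow]
    ring
  rw [h1]
  gcongr
  linarith

theorem summable_subtype_mono {ι : Type*} {s t : Set ι} (h : s ⊆ t) {E : Type*}
    [NormedAddCommGroup E] [CompleteSpace E] {f : ι → E} (hf : Summable fun i : t => f i) :
    Summable fun i : s => f i :=
  hf.comp_injective (Set.inclusion_injective h)

theorem summable_kernelTerm_allowable {γ : ℝ} (hγ : 0 < γ) {p : ℝ≥0∞} (hp : 2 ≤ p)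
    {z w : ℂ × ℂ} (hz : z ∈ domain γ) (hw : w ∈ domain γ) :
    Summable fun α : allowable γ p => kernelTerm γ z w α :=
  summable_subtype_mono (f := kernelTerm γ z w) (allowable_subset_two hγ hp)
    (summable_kernelTerm hγ hz hw)

theorem pow_mul_zpow_le_add {x y x' a b : ℝ} (k : ℕ) (j : ℤ) (hx : 0 ≤ x) (hxx : x ≤ x')
    (ha : 0 < a) (hay : a ≤ y) (hyb : y ≤ b) :
    x ^ k * y ^ j ≤ x' ^ k * a ^ j + x' ^ k * b ^ j := by
  have hy : 0 < y := ha.trans_le hay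
  have hb : 0 < b := hy.trans_le hyb
  have hx' : 0 ≤ x' := hx.trans hxx
  have h0 : y ^ j ≤ a ^ j + b ^ j := by
    rcases le_total 0 j with hj | hj
    · exact (zpow_le_zpow_left₀ hj hy.le hyb).trans (le_add_of_nonneg_left (by positivity))
    · obtain ⟨l, hl⟩ := Int.eq_ofNat_of_zero_le (neg_nonneg.mpr hj)
      obtain rfl : j = -(l : ℤ) := by omega
      refine le_trans ?_ (le_add_of_nonneg_right (by positivity))
      rw [zpow_neg, zpow_neg, zpow_natCast, zpow_natCast]
      gcongr
  rw [← mul_add]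
  gcongr

/-- As `α₂` may have either sign, `‖w₂‖ ^ α₂` is largest at one of the two ends of an interval of
moduli. Two points `a`, `b` with slightly enlarged first coordinate and slightly smaller or larger
second coordinate therefore dominate all monomials at once; this gives locally uniform convergence
from pointwise convergence. -/
theorem exists_nhds_norm_monomial_le {γ : ℝ} (hγ : 0 < γ) {z : ℂ × ℂ} (hz : z ∈ domain γ) :
    ∃ U ∈ nhds z, ∃ a ∈ domain γ, ∃ b ∈ domain γ, ∀ α : ℤ × ℤ, 0 ≤ α.1 → ∀ w ∈ U,
      ‖monomial α w‖ ≤ ‖monomial α a‖ + ‖monomial α b‖ := by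
  have hz2 : 0 < ‖z.2‖ := norm_pos_iff.mpr (snd_ne_zero_of_mem_domain hz)
  have h0 := (mem_domain_iff hγ).mp hz
  have hlt : ∀ σ : ℝ, ∀ᶠ δ : ℝ in nhdsWithin 0 (Ioi 0),
      ‖z.2‖ + σ * δ < 1 ∧ ‖z.1‖ + δ < (‖z.2‖ + σ * δ) ^ γ⁻¹ := by
    intro σ
    have hc : Continuous fun δ : ℝ => (‖z.2‖ + σ * δ) ^ γ⁻¹ - (‖z.1‖ + δ) := by
      refine Continuous.sub (Continuous.rpow_const (by fun_prop) fun _ => Or.inr ?_) (by fun_prop)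
      positivity
    have hc' : Continuous fun δ : ℝ => ‖z.2‖ + σ * δ := by fun_prop
    have h1 := hc.tendsto 0 |>.eventually_const_lt (u := 0) (by simpa using h0.2)
    have h2 := hc'.tendsto 0 |>.eventually_lt_const (u := 1) (by simpa using h0.1)
    refine Filter.Eventually.filter_mono nhdsWithin_le_nhds ?_
    filter_upwards [h1, h2] with δ h1 h2
    exact ⟨h2, by linarith⟩
  have hsmall : ∀ᶠ δ : ℝ in nhdsWithin 0 (Ioi 0), δ < ‖z.2‖ :=
    (eventually_lt_nhds hz2).filter_mono nhdsWithin_le_nhds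
  have hpos : ∀ᶠ δ : ℝ in nhdsWithin 0 (Ioi 0), 0 < δ := eventually_mem_nhdsWithin
  obtain ⟨δ, ⟨ha, ha'⟩, ⟨hb, hb'⟩, hδ, hδ0⟩ :=
    ((hlt (-1)).and ((hlt 1).and (hsmall.and hpos))).exists
  rw [neg_one_mul] at ha ha'
  rw [one_mul] at hb hb'
  have hp1 : 0 < ‖z.1‖ + δ := by positivity
  have hp2 : 0 < ‖z.2‖ + -δ := by linarith
  have hp3 : 0 < ‖z.2‖ + δ := by positivity
  refine ⟨{w | ‖w.1‖ < ‖z.1‖ + δ ∧ ‖z.2‖ + -δ < ‖w.2‖ ∧ ‖w.2‖ < ‖z.2‖ + δ}, ?_,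
    (((‖z.1‖ + δ : ℝ) : ℂ), ((‖z.2‖ + -δ : ℝ) : ℂ)), ?_,
    (((‖z.1‖ + δ : ℝ) : ℂ), ((‖z.2‖ + δ : ℝ) : ℂ)), ?_, ?_⟩
  · have hc1 : Continuous fun w : ℂ × ℂ => ‖w.1‖ := by fun_prop
    have hc2 : Continuous fun w : ℂ × ℂ => ‖w.2‖ := by fun_prop
    filter_upwards [hc1.tendsto z |>.eventually_lt_const (lt_add_of_pos_right _ hδ0),
      hc2.tendsto z |>.eventually_const_lt (u := ‖z.2‖ + -δ) (by linarith),
      hc2.tendsto z |>.eventually_lt_const (lt_add_of_pos_right _ hδ0)] with w h1 h2 h3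
    exact ⟨h1, h2, h3⟩
  · rw [mem_domain_iff hγ, Complex.norm_of_nonneg hp1.le, Complex.norm_of_nonneg hp2.le]
    exact ⟨ha, ha'⟩
  · rw [mem_domain_iff hγ, Complex.norm_of_nonneg hp1.le, Complex.norm_of_nonneg hp3.le]
    exact ⟨hb, hb'⟩
  · rintro ⟨i, j⟩ hi w ⟨h1, h2, h3⟩
    obtain ⟨k, rfl⟩ := Int.eq_ofNat_of_zero_le hi
    rw [norm_monomial, norm_monomial, norm_monomial]
    simp only [zpow_natCast]
    rw [Complex.norm_of_nonneg hp1.le, Complex.norm_of_nonneg hp2.le,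
      Complex.norm_of_nonneg hp3.le]
    exact pow_mul_zpow_le_add k j (norm_nonneg _) h1.le hp2 h2.le h3.le

/-! ### The integral operator as a series -/

theorem integrable_tsum_of_summable_integral_norm {ι X : Type*} [Countable ι]
    [MeasurableSpace X] {μ : Measure X} {F : ι → X → ℂ} (hF : ∀ i, Integrable (F i) μ)
    (hs : Summable fun i => ∫ x, ‖F i x‖ ∂μ) (hp : ∀ᵐ x ∂μ, Summable fun i => F i x) :
    Integrable (fun x => ∑' i, F i x) μ := by
  refine ⟨?_, ?_⟩
  · refine aestronglyMeasurable_of_tendsto_ae Filter.atTop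
      (f := fun (s : Finset ι) x => ∑ i ∈ s, F i x) (fun s => ?_) ?_
    · exact Finset.aestronglyMeasurable_fun_sum s fun i _ => (hF i).1
    · filter_upwards [hp] with x hx using hx.hasSum
  · rw [hasFiniteIntegral_iff_enorm]
    calc ∫⁻ x, ‖∑' i, F i x‖ₑ ∂μ ≤ ∫⁻ x, ∑' i, ‖F i x‖ₑ ∂μ :=
          lintegral_mono fun x => enorm_tsum_le_tsum_enorm
      _ = ∑' i, ∫⁻ x, ‖F i x‖ₑ ∂μ := lintegral_tsum fun i => (hF i).1.enorm
      _ = ∑' i, ENNReal.ofReal (∫ x, ‖F i x‖ ∂μ) := by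
          congr 1; ext i
          rw [ofReal_integral_norm_eq_lintegral_enorm (hF i)]
      _ < ∞ := by
          rw [← ENNReal.ofReal_tsum_of_nonneg
            (fun i => integral_nonneg fun x => norm_nonneg _) hs]
          exact ENNReal.ofReal_lt_top

/-- The coefficient of `f` along the monomial `e_α`. -/
def monomialCoeff (γ : ℝ) (f : ℂ × ℂ → ℂ) (α : ℤ × ℤ) : ℂ :=
  (∫ w in domain γ, conj (monomial α w) * f w) / (monomialNormSq γ α : ℂ)

theorem memLp_conj_monomial {γ : ℝ} {α : ℤ × ℤ} (hα : α ∈ allowable γ 2) :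
    MemLp (fun w => conj (monomial α w)) 2 (vol γ) := by
  refine (memLp_monomial hα).of_le (by fun_prop) (Filter.Eventually.of_forall fun w => ?_)
  simp

theorem integrable_conj_monomial_mul {γ : ℝ} {f : ℂ × ℂ → ℂ} (hf : MemLp f 2 (vol γ))
    {α : ℤ × ℤ} (hα : α ∈ allowable γ 2) :
    Integrable (fun w => conj (monomial α w) * f w) (vol γ) :=
  (memLp_conj_monomial hα).integrable_mul hf

/-- The pointwise inequality `ab ≤ a² + b²` suffices in place of Cauchy–Schwarz, since only
summability in `α` is at stake. -/
theorem integral_norm_monomial_mul_le {γ : ℝ} {f : ℂ × ℂ → ℂ} (hf : MemLp f 2 (vol γ))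
    {α : ℤ × ℤ} (hα : α ∈ allowable γ 2) :
    ∫ w, ‖conj (monomial α w) * f w‖ ∂(vol γ) ≤
      monomialNormSq γ α + ∫ w, ‖f w‖ ^ 2 ∂(vol γ) := by
  have h1 : Integrable (fun w => ‖monomial α w‖ ^ 2) (vol γ) :=
    (memLp_monomial hα).integrable_norm_pow two_ne_zero
  have h2 : Integrable (fun w => ‖f w‖ ^ 2) (vol γ) := hf.integrable_norm_pow two_ne_zero
  have h3 : monomialNormSq γ α = ∫ w, ‖monomial α w‖ ^ 2 ∂(vol γ) := rfl
  rw [h3, ← integral_add h1 h2]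
  refine integral_mono (integrable_conj_monomial_mul hf hα).norm (h1.add h2) fun w => ?_
  simp only [norm_mul, RCLike.norm_conj]
  nlinarith [sq_nonneg (‖monomial α w‖ - ‖f w‖), sq_nonneg ‖monomial α w‖, sq_nonneg ‖f w‖]

theorem norm_monomialCoeff_le {γ : ℝ} (hγ : 0 < γ) {f : ℂ × ℂ → ℂ} (hf : MemLp f 2 (vol γ))
    {α : ℤ × ℤ} (hα : α ∈ allowable γ 2) :
    ‖monomialCoeff γ f α‖ ≤
      (1 + ∫ w, ‖f w‖ ^ 2 ∂(vol γ)) * (1 + (monomialNormSq γ α)⁻¹) := by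
  have hN := monomialNormSq_pos hγ hα
  have hF : 0 ≤ ∫ w, ‖f w‖ ^ 2 ∂(vol γ) := integral_nonneg fun w => by positivity
  have h1 := (norm_integral_le_integral_norm _).trans (integral_norm_monomial_mul_le hf hα)
  rw [monomialCoeff, norm_div, Complex.norm_of_nonneg hN.le, div_eq_mul_inv]
  have h2 : (0 : ℝ) < (monomialNormSq γ α)⁻¹ := by positivity
  calc _ ≤ (monomialNormSq γ α + ∫ w, ‖f w‖ ^ 2 ∂(vol γ)) * (monomialNormSq γ α)⁻¹ := by
        gcongr
        exact h1
    _ = 1 + (∫ w, ‖f w‖ ^ 2 ∂(vol γ)) * (monomialNormSq γ α)⁻¹ := by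
        rw [add_mul, mul_inv_cancel₀ hN.ne']
    _ ≤ _ := by nlinarith

theorem summable_norm_monomial_mul_coeff {γ : ℝ} (hγ : 0 < γ) {f : ℂ × ℂ → ℂ}
    (hf : MemLp f 2 (vol γ)) {z : ℂ × ℂ} (hz : z ∈ domain γ) :
    Summable fun α : allowable γ 2 => ‖monomial α z‖ * ‖monomialCoeff γ f α‖ := by
  refine Summable.of_nonneg_of_le (fun α => by positivity) (fun α => ?_)
    ((summable_norm_monomial hγ hz).mul_left (1 + ∫ w, ‖f w‖ ^ 2 ∂(vol γ)))
  calc ‖monomial α z‖ * ‖monomialCoeff γ f α‖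
      ≤ ‖monomial α z‖ * ((1 + ∫ w, ‖f w‖ ^ 2 ∂(vol γ)) * (1 + (monomialNormSq γ α)⁻¹)) := by
        gcongr
        exact norm_monomialCoeff_le hγ hf α.2
    _ = _ := by ring

theorem kernelTerm_mul (γ : ℝ) (z w : ℂ × ℂ) (α : ℤ × ℤ) (c : ℂ) :
    kernelTerm γ z w α * c =
      monomial α z / (monomialNormSq γ α : ℂ) * (conj (monomial α w) * c) := by
  simp only [kernelTerm, monomialNormSq]
  ring

theorem subBergmanKernel_mul (γ : ℝ) (p : ℝ≥0∞) (z w : ℂ × ℂ) (c : ℂ) :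
    subBergmanKernel γ p z w * c = ∑' α : allowable γ p, kernelTerm γ z w α * c :=
  tsum_mul_right.symm

/-- The kernel series is integrated term by term against `f`: the `L¹` norms of the terms are
dominated by the summable weights of `summable_norm_monomial`. -/
theorem integrableOn_hasSum_integralOp {γ : ℝ} (hγ : 0 < γ) {p : ℝ≥0∞} (hp : 2 ≤ p)
    {f : ℂ × ℂ → ℂ} (hf : MemLp f 2 (vol γ)) {z : ℂ × ℂ} (hz : z ∈ domain γ) :
    IntegrableOn (fun w => subBergmanKernel γ p z w * f w) (domain γ) ∧
      HasSum (fun α : allowable γ p => monomial α z * monomialCoeff γ f α)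
        (integralOp γ (subBergmanKernel γ p) f z) := by
  have hint : ∀ α : allowable γ p, Integrable (fun w => kernelTerm γ z w α * f w) (vol γ) := by
    intro α
    simp_rw [kernelTerm_mul]
    exact (integrable_conj_monomial_mul hf (allowable_subset_two hγ hp α.2)).const_mul _
  have hsum : Summable fun α : allowable γ p =>
      ∫ w, ‖kernelTerm γ z w α * f w‖ ∂(vol γ) := by
    refine summable_subtype_mono
      (f := fun α => ∫ w, ‖kernelTerm γ z w α * f w‖ ∂(vol γ)) (allowable_subset_two hγ hp) ?_
    refine Summable.of_nonneg_of_le (fun α => by positivity) (fun α => ?_)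
      ((summable_norm_monomial hγ hz).mul_left (1 + ∫ w, ‖f w‖ ^ 2 ∂(vol γ)))
    have hN := monomialNormSq_pos hγ α.2
    have hF : 0 ≤ ∫ w, ‖f w‖ ^ 2 ∂(vol γ) := integral_nonneg fun w => by positivity
    have h2 : (0 : ℝ) < (monomialNormSq γ α)⁻¹ := by positivity
    simp_rw [kernelTerm_mul, norm_mul _ (conj _ * _)]
    rw [integral_const_mul, norm_div, Complex.norm_of_nonneg hN.le, div_eq_mul_inv]
    calc ‖monomial α z‖ * (monomialNormSq γ α)⁻¹ * ∫ w, ‖conj (monomial α w) * f w‖ ∂(vol γ)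
        ≤ ‖monomial α z‖ * (monomialNormSq γ α)⁻¹ *
            (monomialNormSq γ α + ∫ w, ‖f w‖ ^ 2 ∂(vol γ)) := by
          gcongr
          exact integral_norm_monomial_mul_le hf α.2
      _ = ‖monomial α z‖ * (1 + (∫ w, ‖f w‖ ^ 2 ∂(vol γ)) * (monomialNormSq γ α)⁻¹) := by
          field_simp
      _ ≤ ‖monomial α z‖ *
            ((1 + ∫ w, ‖f w‖ ^ 2 ∂(vol γ)) * (1 + (monomialNormSq γ α)⁻¹)) := by
          gcongr
          nlinarith
      _ = _ := by ring
  have hpt : ∀ᵐ w ∂(vol γ), Summable fun α : allowable γ p => kernelTerm γ z w α * f w := by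
    filter_upwards [ae_restrict_mem (measurableSet_domain hγ)] with w hw
    exact (summable_kernelTerm_allowable hγ hp hz hw).mul_right _
  constructor
  · have := integrable_tsum_of_summable_integral_norm hint hsum hpt
    simp_rw [subBergmanKernel_mul]
    exact this
  · have := hasSum_integral_of_summable_integral_norm hint hsum
    simp_rw [← subBergmanKernel_mul] at this
    have h2 : ∀ α : allowable γ p, monomial α z * monomialCoeff γ f α =
        ∫ w, kernelTerm γ z w α * f w ∂(vol γ) := by
      intro α
      rw [integral_congr_ae (Filter.Eventually.of_forall fun w => kernelTerm_mul γ z w α (f w)),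
        integral_const_mul, monomialCoeff]
      simp only [vol]
      ring
    simp_rw [h2]
    exact this

theorem differentiableOn_integralOp {γ : ℝ} (hγ : 0 < γ) {p : ℝ≥0∞} (hp : 2 ≤ p)
    {f : ℂ × ℂ → ℂ} (hf : MemLp f 2 (vol γ)) :
    DifferentiableOn ℂ (integralOp γ (subBergmanKernel γ p) f) (domain γ) := by
  have h1 : DifferentiableOn ℂ
      (fun z => ∑' α : allowable γ p, monomial α z * monomialCoeff γ f α) (domain γ) := by
    refine differentiableOn_tsum_of_locally_summable (isOpen_domain hγ) (fun α => ?_) ?_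
    · exact α.2.1.mul_const _
    · intro z hz
      obtain ⟨U, hU, a, ha, b, hb, hab⟩ := exists_nhds_norm_monomial_le hγ hz
      refine ⟨U, hU, fun α => ‖monomial α a‖ * ‖monomialCoeff γ f α‖ +
        ‖monomial α b‖ * ‖monomialCoeff γ f α‖, ?_, fun α w hw => ?_⟩
      · exact summable_subtype_mono (f := fun α => ‖monomial α a‖ * ‖monomialCoeff γ f α‖ +
          ‖monomial α b‖ * ‖monomialCoeff γ f α‖) (allowable_subset_two hγ hp)
          ((summable_norm_monomial_mul_coeff hγ hf ha).add
            (summable_norm_monomial_mul_coeff hγ hf hb))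
      · simp only [norm_mul]
        rw [← add_mul]
        gcongr
        exact hab _ (fst_nonneg_of_mem_allowable hγ (allowable_subset_two hγ hp α.2)) w hw
  refine h1.congr fun z hz => ?_
  exact (integrableOn_hasSum_integralOp hγ hp hf hz).2.tsum_eq.symm

/-! ### Torus averages -/

instance : IsProbabilityMeasure (volume : Measure UnitAddCircle) :=
  ⟨by rw [AddCircle.measure_univ]; simp⟩

instance : IsProbabilityMeasure (volume : Measure (UnitAddCircle × UnitAddCircle)) := by
  rw [Measure.volume_eq_prod]
  infer_instance

/-- The action of the two-dimensional torus on `ℂ²` by rotations. -/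
def torusAct (θ : UnitAddCircle × UnitAddCircle) (z : ℂ × ℂ) : ℂ × ℂ :=
  ((θ.1.toCircle : ℂ) * z.1, (θ.2.toCircle : ℂ) * z.2)

@[fun_prop]
theorem continuous_toCircle_coe : Continuous fun θ : UnitAddCircle => (θ.toCircle : ℂ) :=
  continuous_subtype_val.comp AddCircle.continuous_toCircle

@[simp]
theorem norm_toCircle_coe (θ : UnitAddCircle) : ‖(θ.toCircle : ℂ)‖ = 1 := Circle.norm_coe _

theorem continuous_torusAct :
    Continuous fun q : (UnitAddCircle × UnitAddCircle) × (ℂ × ℂ) => torusAct q.1 q.2 := by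
  have h := continuous_toCircle_coe
  unfold torusAct
  exact ((h.comp (by fun_prop)).mul (by fun_prop)).prodMk ((h.comp (by fun_prop)).mul (by fun_prop))

theorem continuous_torusAct_left (z : ℂ × ℂ) : Continuous fun θ => torusAct θ z :=
  continuous_torusAct.comp (by fun_prop : Continuous fun θ => (θ, z))

@[simp]
theorem norm_torusAct_fst (θ : UnitAddCircle × UnitAddCircle) (z : ℂ × ℂ) :
    ‖(torusAct θ z).1‖ = ‖z.1‖ := by simp [torusAct]

@[simp]
theorem norm_torusAct_snd (θ : UnitAddCircle × UnitAddCircle) (z : ℂ × ℂ) :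
    ‖(torusAct θ z).2‖ = ‖z.2‖ := by simp [torusAct]

theorem torusAct_mem_domain {γ : ℝ} (θ : UnitAddCircle × UnitAddCircle) {z : ℂ × ℂ} :
    torusAct θ z ∈ domain γ ↔ z ∈ domain γ := by
  simp [domain]

theorem torusAct_zero (z : ℂ × ℂ) : torusAct 0 z = z := by
  simp [torusAct]

theorem measurePreserving_torusAct {γ : ℝ} (hγ : 0 < γ) (θ : UnitAddCircle × UnitAddCircle) :
    MeasurePreserving (torusAct θ) (vol γ) (vol γ) := by
  have h1 : MeasurePreserving (torusAct θ) volume volume :=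
    (rotation θ.1.toCircle).measurePreserving.prod (rotation θ.2.toCircle).measurePreserving
  have h2 := h1.restrict_preimage (measurableSet_domain hγ)
  have h3 : torusAct θ ⁻¹' domain γ = domain γ := by
    ext z
    exact torusAct_mem_domain θ
  rwa [h3] at h2

theorem measurePreserving_torusAct_uncurry {γ : ℝ} (hγ : 0 < γ) :
    MeasurePreserving
      (fun q : (UnitAddCircle × UnitAddCircle) × (ℂ × ℂ) => torusAct q.1 q.2)
      (volume.prod (vol γ)) (vol γ) := by
  have := isFiniteMeasure_vol hγ
  have h := MeasurePreserving.skew_product (μc := vol γ) (μd := vol γ)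
    (MeasurePreserving.id (volume : Measure (UnitAddCircle × UnitAddCircle)))
    (g := torusAct) continuous_torusAct.measurable
    (Filter.Eventually.of_forall fun θ => (measurePreserving_torusAct hγ θ).map_eq)
  exact measurePreserving_snd.comp h

/-- Each rotation preserves the measure, so averaging over all rotations and exchanging the
integrals changes nothing. -/
theorem integral_eq_integral_torus {γ : ℝ} (hγ : 0 < γ) {F : ℂ × ℂ → ℂ}
    (hF : Integrable F (vol γ)) :
    ∫ z, F z ∂(vol γ) = ∫ z, (∫ θ, F (torusAct θ z)) ∂(vol γ) := by
  have := isFiniteMeasure_vol hγ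
  have hmp := measurePreserving_torusAct_uncurry hγ
  have hint : Integrable (fun q : (UnitAddCircle × UnitAddCircle) × (ℂ × ℂ) =>
      F (torusAct q.1 q.2)) (volume.prod (vol γ)) :=
    hmp.integrable_comp_of_integrable hF
  rw [← integral_prod_symm _ hint]
  conv_lhs => rw [← hmp.map_eq]
  exact integral_map hmp.measurable.aemeasurable (by rw [hmp.map_eq]; exact hF.1)

theorem lintegral_eq_lintegral_torus {γ : ℝ} (hγ : 0 < γ) {F : ℂ × ℂ → ℝ≥0∞}
    (hF : AEMeasurable F (vol γ)) :
    ∫⁻ z, F z ∂(vol γ) = ∫⁻ z, (∫⁻ θ, F (torusAct θ z)) ∂(vol γ) := by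
  have := isFiniteMeasure_vol hγ
  have hmp := measurePreserving_torusAct_uncurry hγ
  have hm : AEMeasurable (fun q : (UnitAddCircle × UnitAddCircle) × (ℂ × ℂ) =>
      F (torusAct q.1 q.2)) (volume.prod (vol γ)) :=
    hF.comp_quasiMeasurePreserving hmp.quasiMeasurePreserving
  rw [← lintegral_prod_symm _ hm]
  conv_lhs => rw [← hmp.map_eq]
  exact lintegral_map' (by rwa [hmp.map_eq]) hmp.measurable.aemeasurable

theorem integral_toCircle_eq_circleAverage (g : ℂ → ℂ) (ζ : ℂ) :
    ∫ θ : UnitAddCircle, g (θ.toCircle * ζ) = circleAverage g 0 ‖ζ‖ := by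
  rw [circleAverage_eq_integral_add ζ.arg, ← UnitAddCircle.intervalIntegral_preimage 0, zero_add]
  have h := intervalIntegral.integral_comp_mul_left (a := 0) (b := 1)
    (fun θ : ℝ => g (circleMap 0 ‖ζ‖ (θ + ζ.arg))) (c := 2 * π) (by positivity)
  rw [mul_zero, mul_one] at h
  rw [← h]
  congr 1
  ext x
  congr 1
  rw [AddCircle.toCircle_apply_mk, Circle.coe_exp]
  conv_lhs => rw [← Complex.norm_mul_exp_arg_mul_I ζ]
  simp only [circleMap, zero_add]
  rw [mul_left_comm, ← Complex.exp_add]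
  congr 2
  push_cast
  ring

/-- The average is `(2πi)⁻¹ ∮ g(z)/z dz`, and Cauchy's theorem on the closed annulus identifies the
two contours. -/
theorem circleAverage_eq_of_differentiable_on_annulus {g : ℂ → ℂ} {r R : ℝ} (hr : 0 < r)
    (hrR : r ≤ R) (hg : ∀ z : ℂ, r ≤ ‖z‖ → ‖z‖ ≤ R → DifferentiableAt ℂ g z) :
    circleAverage g 0 r = circleAverage g 0 R := by
  have hd : ∀ z : ℂ, r ≤ ‖z‖ → ‖z‖ ≤ R →
      DifferentiableAt ℂ (fun z => (z - 0)⁻¹ • g z) z := by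
    intro z h1 h2
    have hz : z - 0 ≠ 0 := by
      rw [sub_zero]
      exact norm_pos_iff.mp (hr.trans_le h1)
    have h3 : DifferentiableAt ℂ (fun z : ℂ => (z - 0)⁻¹) z :=
      (differentiableAt_id.sub_const (0 : ℂ)).inv hz
    exact h3.smul (hg z h1 h2)
  rw [circleAverage_eq_circleIntegral hr.ne', circleAverage_eq_circleIntegral (by linarith)]
  congr 1
  refine (Complex.circleIntegral_eq_of_differentiable_on_annulus_off_countable hr hrR
    countable_empty ?_ ?_).symm
  · intro z hz
    exact (hd z (by simpa using hz.2) (by simpa using hz.1)).continuousAt.continuousWithinAt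
  · rintro z ⟨⟨h1, h2⟩, -⟩
    exact hd z (by simpa using (not_le.mp (by simpa using h2)).le) (le_of_lt (by simpa using h1))

theorem integral_toCircle_mul_eq {g : ℂ → ℂ} {ζ ξ : ℂ} (h0 : ζ ≠ 0) (hle : ‖ζ‖ ≤ ‖ξ‖)
    (hg : ∀ z : ℂ, ‖ζ‖ ≤ ‖z‖ → ‖z‖ ≤ ‖ξ‖ → DifferentiableAt ℂ g z) :
    ∫ θ : UnitAddCircle, g (θ.toCircle * ζ) = ∫ θ : UnitAddCircle, g (θ.toCircle * ξ) := by
  rw [integral_toCircle_eq_circleAverage, integral_toCircle_eq_circleAverage]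
  exact circleAverage_eq_of_differentiable_on_annulus (norm_pos_iff.mpr h0) hle hg

/-- The average of `G` over the torus through `z`. -/
def torusMean (G : ℂ × ℂ → ℂ) (z : ℂ × ℂ) : ℂ := ∫ θ, G (torusAct θ z)

/-- The part of the domain off the axes. -/
def puncturedDomain (γ : ℝ) : Set (ℂ × ℂ) := {z | z ∈ domain γ ∧ z.1 ≠ 0}

theorem torusAct_mem_puncturedDomain {γ : ℝ} (θ : UnitAddCircle × UnitAddCircle) {z : ℂ × ℂ}
    (hz : z ∈ puncturedDomain γ) : torusAct θ z ∈ puncturedDomain γ := by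
  refine ⟨(torusAct_mem_domain θ).mpr hz.1, ?_⟩
  rw [← norm_pos_iff, norm_torusAct_fst]
  exact norm_pos_iff.mpr hz.2

theorem continuous_comp_torusAct {γ : ℝ} {G : ℂ × ℂ → ℂ}
    (hG : ∀ z ∈ puncturedDomain γ, DifferentiableAt ℂ G z) {z : ℂ × ℂ}
    (hz : z ∈ puncturedDomain γ) : Continuous fun θ => G (torusAct θ z) := by
  rw [continuous_iff_continuousAt]
  intro θ
  exact (hG _ (torusAct_mem_puncturedDomain θ hz)).continuousAt.comp
    (f := fun θ => torusAct θ z) (continuous_torusAct_left z).continuousAt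

theorem integrable_of_continuous_torus {g : UnitAddCircle × UnitAddCircle → ℂ}
    (hg : Continuous g) : Integrable g volume :=
  hg.integrable_of_hasCompactSupport (HasCompactSupport.of_compactSpace g)

theorem torusMean_eq_of_norm_fst_le {γ : ℝ} (hγ : 0 < γ) {G : ℂ × ℂ → ℂ}
    (hG : ∀ z ∈ puncturedDomain γ, DifferentiableAt ℂ G z) {z : ℂ × ℂ}
    (hz : z ∈ puncturedDomain γ) {ζ : ℂ} (hζ : ζ ≠ 0) (hle : ‖ζ‖ ≤ ‖z.1‖) :
    torusMean G (ζ, z.2) = torusMean G z := by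
  have hmem : ∀ w : ℂ × ℂ, w.1 ≠ 0 → ‖w.1‖ ≤ ‖z.1‖ → ‖w.2‖ = ‖z.2‖ → w ∈ puncturedDomain γ := by
    intro w h0 h1 h2
    have := (mem_domain_iff hγ).mp hz.1
    exact ⟨(mem_domain_iff hγ).mpr ⟨by rw [h2]; exact this.1, by rw [h2]; exact h1.trans_lt this.2⟩,
      h0⟩
  have hz' : (ζ, z.2) ∈ puncturedDomain γ := hmem _ hζ hle rfl
  rw [torusMean, torusMean, Measure.volume_eq_prod,
    integral_prod_symm _ (integrable_of_continuous_torus (continuous_comp_torusAct hG hz')),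
    integral_prod_symm _ (integrable_of_continuous_torus (continuous_comp_torusAct hG hz))]
  congr 1
  ext θ
  refine integral_toCircle_mul_eq (g := fun w => G (w, θ.toCircle * z.2)) hζ hle fun w h1 h2 => ?_
  have hw : w ≠ 0 := norm_pos_iff.mp ((norm_pos_iff.mpr hζ).trans_le h1)
  exact (hG _ (hmem (w, θ.toCircle * z.2) hw h2 (by simp))).comp w
    (differentiableAt_id.prodMk (differentiableAt_const _))

theorem torusMean_eq_of_norm_snd_le {γ : ℝ} {G : ℂ × ℂ → ℂ}
    (hG : ∀ z ∈ puncturedDomain γ, DifferentiableAt ℂ G z) {z : ℂ × ℂ}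
    (hz : z ∈ puncturedDomain γ) {ζ : ℂ} (hζ : ‖ζ‖ < 1) (hle : ‖z.2‖ ≤ ‖ζ‖) :
    torusMean G z = torusMean G (z.1, ζ) := by
  have hmem : ∀ w : ℂ × ℂ, ‖w.1‖ = ‖z.1‖ → ‖z.2‖ ≤ ‖w.2‖ → ‖w.2‖ < 1 → w ∈ puncturedDomain γ := by
    intro w h0 h1 h2
    refine ⟨⟨?_, h2⟩, norm_pos_iff.mp (by rw [h0]; exact norm_pos_iff.mpr hz.2)⟩
    rw [h0]
    exact hz.1.1.trans_le h1
  have hz' : (z.1, ζ) ∈ puncturedDomain γ := hmem _ rfl hle hζ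
  rw [torusMean, torusMean, Measure.volume_eq_prod,
    integral_prod _ (integrable_of_continuous_torus (continuous_comp_torusAct hG hz')),
    integral_prod _ (integrable_of_continuous_torus (continuous_comp_torusAct hG hz))]
  congr 1
  ext θ
  refine integral_toCircle_mul_eq (g := fun w => G (θ.toCircle * z.1, w))
    (snd_ne_zero_of_mem_domain hz.1) hle fun w h1 h2 => ?_
  exact (hG _ (hmem (θ.toCircle * z.1, w) (by simp) h1 (h2.trans_lt hζ))).comp w
    ((differentiableAt_const _).prodMk differentiableAt_id)

/-- Shrinking `‖z₁‖` and then enlarging `‖z₂‖` below `1` stays inside the domain. Any two tori can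
thus be moved, one coordinate at a time, to the common torus through `(a, b)`, where `a` is the
smaller first coordinate and `b` the larger second one. -/
theorem torusMean_eq {γ : ℝ} (hγ : 0 < γ) {G : ℂ × ℂ → ℂ}
    (hG : ∀ z ∈ puncturedDomain γ, DifferentiableAt ℂ G z) {z w : ℂ × ℂ}
    (hz : z ∈ puncturedDomain γ) (hw : w ∈ puncturedDomain γ) : torusMean G z = torusMean G w := by
  obtain ⟨a, ha0, haz, haw⟩ : ∃ a : ℂ, a ≠ 0 ∧ ‖a‖ ≤ ‖z.1‖ ∧ ‖a‖ ≤ ‖w.1‖ := by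
    rcases le_total ‖z.1‖ ‖w.1‖ with h | h
    · exact ⟨z.1, hz.2, le_rfl, h⟩
    · exact ⟨w.1, hw.2, h, le_rfl⟩
  obtain ⟨b, hb1, hbz, hbw⟩ : ∃ b : ℂ, ‖b‖ < 1 ∧ ‖z.2‖ ≤ ‖b‖ ∧ ‖w.2‖ ≤ ‖b‖ := by
    rcases le_total ‖z.2‖ ‖w.2‖ with h | h
    · exact ⟨w.2, hw.1.2, h, le_rfl⟩
    · exact ⟨z.2, hz.1.2, le_rfl, h⟩
  have hmem : ∀ v ∈ puncturedDomain γ, ‖a‖ ≤ ‖v.1‖ → (a, v.2) ∈ puncturedDomain γ := by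
    intro v hv hav
    have := (mem_domain_iff hγ).mp hv.1
    exact ⟨(mem_domain_iff hγ).mpr ⟨this.1, hav.trans_lt this.2⟩, ha0⟩
  have key : ∀ v ∈ puncturedDomain γ, ‖a‖ ≤ ‖v.1‖ → ‖v.2‖ ≤ ‖b‖ →
      torusMean G v = torusMean G (a, b) := by
    intro v hv h1 h2
    rw [← torusMean_eq_of_norm_fst_le hγ hG hv ha0 h1]
    exact torusMean_eq_of_norm_snd_le hG (hmem v hv h1) hb1 h2
  rw [key z hz haz hbz, key w hw haw hbw]

/-! ### The Laurent coefficients of a holomorphic function -/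

theorem monomial_neg (α : ℤ × ℤ) (z : ℂ × ℂ) : monomial (-α) z = (monomial α z)⁻¹ := by
  simp [monomial, mul_comm]

theorem monomial_ne_zero {γ : ℝ} (α : ℤ × ℤ) {z : ℂ × ℂ} (hz : z ∈ puncturedDomain γ) :
    monomial α z ≠ 0 :=
  mul_ne_zero (zpow_ne_zero _ hz.2) (zpow_ne_zero _ (snd_ne_zero_of_mem_domain hz.1))

theorem norm_monomial_torusAct (α : ℤ × ℤ) (θ : UnitAddCircle × UnitAddCircle) (z : ℂ × ℂ) :
    ‖monomial α (torusAct θ z)‖ = ‖monomial α z‖ := by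
  simp [norm_monomial]

theorem monomial_torusAct (α : ℤ × ℤ) (θ : UnitAddCircle × UnitAddCircle) (z : ℂ × ℂ) :
    monomial α (torusAct θ z) =
      (θ.1.toCircle : ℂ) ^ α.1 * (θ.2.toCircle : ℂ) ^ α.2 * monomial α z := by
  simp only [monomial, torusAct, mul_zpow]
  ring

theorem conj_monomial_eq {γ : ℝ} (α : ℤ × ℤ) {z : ℂ × ℂ} (hz : z ∈ puncturedDomain γ) :
    conj (monomial α z) = (‖monomial α z‖ ^ 2 : ℝ) * monomial (-α) z := by
  have h := monomial_ne_zero α hz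
  rw [monomial_neg, ← Complex.normSq_eq_norm_sq, Complex.normSq_eq_conj_mul_self, mul_assoc,
    mul_inv_cancel₀ h, mul_one]

theorem ae_mem_puncturedDomain {γ : ℝ} (hγ : 0 < γ) : ∀ᵐ z ∂(vol γ), z ∈ puncturedDomain γ := by
  have h : ∀ᵐ z : ℂ × ℂ ∂volume, z.1 ≠ 0 :=
    Measure.quasiMeasurePreserving_fst.ae (Measure.ae_ne volume (0 : ℂ))
  filter_upwards [ae_restrict_mem (measurableSet_domain hγ), ae_restrict_of_ae h] with z h1 h2
  exact ⟨h1, h2⟩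

theorem exists_torusMean_eq {γ : ℝ} (hγ : 0 < γ) {h : ℂ × ℂ → ℂ}
    (hh : DifferentiableOn ℂ h (domain γ)) (α : ℤ × ℤ) :
    ∃ c : ℂ, ∀ z ∈ puncturedDomain γ, torusMean (fun w => h w * monomial (-α) w) z = c := by
  by_cases hne : ∃ z, z ∈ puncturedDomain γ
  · obtain ⟨z₀, hz₀⟩ := hne
    refine ⟨torusMean (fun w => h w * monomial (-α) w) z₀, fun z hz => ?_⟩
    refine torusMean_eq hγ (fun w hw => ?_) hz hz₀
    refine (hh.differentiableAt ((isOpen_domain hγ).mem_nhds hw.1)).mul ?_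
    exact (differentiableAt_fst.zpow (Or.inl hw.2)).mul
      (differentiableAt_snd.zpow (Or.inl (snd_ne_zero_of_mem_domain hw.1)))
  · exact ⟨0, fun z hz => (hne ⟨z, hz⟩).elim⟩

/-- The Laurent coefficients of a holomorphic function on the domain. -/
def laurentCoeff {γ : ℝ} (hγ : 0 < γ) {h : ℂ × ℂ → ℂ} (hh : DifferentiableOn ℂ h (domain γ))
    (α : ℤ × ℤ) : ℂ := (exists_torusMean_eq hγ hh α).choose

theorem torusMean_eq_laurentCoeff {γ : ℝ} (hγ : 0 < γ) {h : ℂ × ℂ → ℂ}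
    (hh : DifferentiableOn ℂ h (domain γ)) (α : ℤ × ℤ) {z : ℂ × ℂ} (hz : z ∈ puncturedDomain γ) :
    ∫ θ, h (torusAct θ z) * monomial (-α) (torusAct θ z) = laurentCoeff hγ hh α :=
  (exists_torusMean_eq hγ hh α).choose_spec z hz

/-- Off the axes `conj e_α = |e_α|² e_{-α}`, and `|e_α|` is constant on tori. Averaging the inner
product integral over each torus leaves `|e_α|²` times the Laurent coefficient. -/
theorem monomialCoeff_eq_laurentCoeff {γ : ℝ} (hγ : 0 < γ) {h : ℂ × ℂ → ℂ}
    (hh : DifferentiableOn ℂ h (domain γ)) (hh2 : MemLp h 2 (vol γ)) {α : ℤ × ℤ}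
    (hα : α ∈ allowable γ 2) : monomialCoeff γ h α = laurentCoeff hγ hh α := by
  have hN := monomialNormSq_pos hγ hα
  have h1 : ∫ w, conj (monomial α w) * h w ∂(vol γ) =
      ∫ w, ((‖monomial α w‖ ^ 2 : ℝ) : ℂ) * laurentCoeff hγ hh α ∂(vol γ) := by
    rw [integral_eq_integral_torus hγ (integrable_conj_monomial_mul hh2 hα)]
    refine integral_congr_ae ?_
    filter_upwards [ae_mem_puncturedDomain hγ] with z hz
    rw [← torusMean_eq_laurentCoeff hγ hh α hz, ← integral_const_mul]
    congr 1
    ext θ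
    rw [conj_monomial_eq α (torusAct_mem_puncturedDomain θ hz), norm_monomial_torusAct]
    ring
  rw [monomialCoeff]
  change (∫ w, conj (monomial α w) * h w ∂(vol γ)) / _ = _
  have h2 : ∫ w, ((‖monomial α w‖ ^ 2 : ℝ) : ℂ) ∂(vol γ) = (monomialNormSq γ α : ℂ) :=
    integral_ofReal
  rw [h1, integral_mul_const, h2, mul_div_cancel_left₀ _ (by exact_mod_cast hN.ne')]

theorem rpow_lintegral_le_lintegral_rpow {X : Type*} [MeasurableSpace X] {μ : Measure X}
    [IsProbabilityMeasure μ] {g : X → ℂ} (hg : AEStronglyMeasurable g μ) {p : ℝ≥0∞}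
    (hp : 1 ≤ p) (hp' : p ≠ ∞) :
    (∫⁻ x, ‖g x‖ₑ ∂μ) ^ p.toReal ≤ ∫⁻ x, ‖g x‖ₑ ^ p.toReal ∂μ := by
  have hp0 : p ≠ 0 := by
    rintro rfl; simp at hp
  have hpr : 0 < p.toReal := ENNReal.toReal_pos hp0 hp'
  have h := eLpNorm_le_eLpNorm_of_exponent_le hp hg
  rw [eLpNorm_one_eq_lintegral_enorm, eLpNorm_eq_lintegral_rpow_enorm_toReal hp0 hp'] at h
  have := ENNReal.rpow_le_rpow h hpr.le
  rwa [← ENNReal.rpow_mul, one_div, inv_mul_cancel₀ hpr.ne', ENNReal.rpow_one] at this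

/-- On the torus through `z`, `|c| |e_α(z)|` is at most the mean of `|h|`. Raising to the power `p`,
applying Jensen and integrating gives `|c|^p ‖e_α‖_p^p ≤ ‖h‖_p^p < ∞`. -/
theorem mem_allowable_of_laurentCoeff_ne_zero {γ : ℝ} (hγ : 0 < γ) {p : ℝ≥0∞} (hp : 2 ≤ p)
    (hp' : p ≠ ∞) {h : ℂ × ℂ → ℂ} (hh : MemBergman γ p h) {α : ℤ × ℤ}
    (hc : laurentCoeff hγ hh.1 α ≠ 0) : α ∈ allowable γ p := by
  refine mem_allowable_of_lintegral_ne_top hγ hp hp' fun htop => ?_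
  have hp0 : p ≠ 0 := by
    rintro rfl; simp at hp
  have hpr : 0 < p.toReal := ENNReal.toReal_pos hp0 hp'
  set c := laurentCoeff hγ hh.1 α with hcdef
  have h1 : ∫⁻ z, ‖c‖ₑ ^ p.toReal * ‖monomial α z‖ₑ ^ p.toReal ∂(vol γ) ≤
      ∫⁻ z, ‖h z‖ₑ ^ p.toReal ∂(vol γ) := by
    rw [lintegral_eq_lintegral_torus hγ (hh.2.1.enorm.pow_const _)]
    refine lintegral_mono_ae ?_
    filter_upwards [ae_mem_puncturedDomain hγ] with z hz
    have hcont : Continuous fun θ => h (torusAct θ z) := continuous_comp_torusAct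
      (fun w hw => hh.1.differentiableAt ((isOpen_domain hγ).mem_nhds hw.1)) hz
    refine le_trans ?_ (rpow_lintegral_le_lintegral_rpow hcont.aestronglyMeasurable
      (one_le_two.trans hp) hp')
    rw [← ENNReal.mul_rpow_of_nonneg _ _ hpr.le]
    refine ENNReal.rpow_le_rpow ?_ hpr.le
    rw [hcdef, ← torusMean_eq_laurentCoeff hγ hh.1 α hz, ← enorm_mul, ← integral_mul_const]
    refine (enorm_integral_le_lintegral_enorm _).trans (lintegral_mono fun θ => le_of_eq ?_)
    have hne := monomial_ne_zero α hz
    rw [← ofReal_norm, ← ofReal_norm, norm_mul, norm_mul, monomial_neg, norm_inv,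
      norm_monomial_torusAct, mul_assoc, inv_mul_cancel₀ (norm_ne_zero_iff.mpr hne), mul_one]
  rw [lintegral_const_mul _ (by fun_prop)] at h1
  change ‖c‖ₑ ^ p.toReal * ∫⁻ v in domain γ, ‖monomial α v‖ₑ ^ p.toReal ≤ _ at h1
  rw [htop, ENNReal.mul_top] at h1
  · exact ((eLpNorm_lt_top_iff_lintegral_rpow_enorm_lt_top hp0 hp').mp hh.2.2).ne (top_le_iff.mp h1)
  · simp [ENNReal.rpow_eq_zero_iff, hc, hpr]

/-! ### The reproducing property -/

/-- Fourier coefficients are defined with normalised Haar measure, which on a circle of length one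
agrees with `volume`. -/
theorem mFourierCoeff_eq_integral_volume {d : Type*} [Fintype d] (f : UnitAddTorus d → ℂ)
    (k : d → ℤ) :
    UnitAddTorus.mFourierCoeff f k =
      ∫ x : d → UnitAddCircle, UnitAddTorus.mFourier (-k) x • f x := by
  have h : (AddCircle.measureSpace 1 : MeasureSpace UnitAddCircle) =
      ⟨AddCircle.haarAddCircle⟩ := by
    have h1 := AddCircle.volume_eq_smul_haarAddCircle (T := 1)
    rw [ENNReal.ofReal_one, one_smul] at h1
    rw [← h1]
    rfl
  rw [h]
  rfl

theorem mFourierCoeff_comp_torusAct {γ : ℝ} (hγ : 0 < γ) {h : ℂ × ℂ → ℂ}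
    (hh : DifferentiableOn ℂ h (domain γ)) {z : ℂ × ℂ} (hz : z ∈ puncturedDomain γ)
    (k : Fin 2 → ℤ) :
    UnitAddTorus.mFourierCoeff (fun x : UnitAddTorus (Fin 2) => h (torusAct (x 0, x 1) z)) k =
      laurentCoeff hγ hh (k 0, k 1) * monomial (k 0, k 1) z := by
  have hpt : ∀ x : UnitAddTorus (Fin 2),
      UnitAddTorus.mFourier (-k) x • h (torusAct (x 0, x 1) z) =
        h (torusAct (x 0, x 1) z) * monomial (-(k 0, k 1)) (torusAct (x 0, x 1) z) *
          monomial (k 0, k 1) z := by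
    intro x
    have hne := monomial_ne_zero (k 0, k 1) hz
    have h1 : monomial (-(k 0, k 1)) (torusAct (x 0, x 1) z) =
        UnitAddTorus.mFourier (-k) x * (monomial (k 0, k 1) z)⁻¹ := by
      rw [monomial_torusAct, monomial_neg]
      simp [UnitAddTorus.mFourier, fourier_apply, AddCircle.toCircle_neg,
        AddCircle.toCircle_zsmul]
      exact Or.inl (mul_comm _ _)
    rw [h1, smul_eq_mul]
    field_simp
  rw [← torusMean_eq_laurentCoeff hγ hh _ hz, ← integral_mul_const,
    mFourierCoeff_eq_integral_volume]
  simp_rw [hpt]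
  exact (volume_preserving_finTwoArrow UnitAddCircle).integral_comp'
    fun θ => h (torusAct θ z) * monomial (-(k 0, k 1)) (torusAct θ z) * monomial (k 0, k 1) z

/-- Off the axis, the series for the operator at `z` is the Fourier series of `θ ↦ h(θ · z)`
evaluated at the identity. It is absolutely summable and the function is continuous, so the sum is
`h(z)`. -/
theorem integralOp_eq_self {γ : ℝ} (hγ : 0 < γ) {p : ℝ≥0∞} (hp : 2 ≤ p) (hp' : p ≠ ∞)
    {h : ℂ × ℂ → ℂ} (hh : MemBergman γ p h) {z : ℂ × ℂ} (hz : z ∈ domain γ) :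
    integralOp γ (subBergmanKernel γ p) h z = h z := by
  have := isFiniteMeasure_vol hγ
  have hh2 : MemLp h 2 (vol γ) := hh.2.mono_exponent hp
  have key : ∀ z ∈ puncturedDomain γ, integralOp γ (subBergmanKernel γ p) h z = h z := by
    intro z hz
    have h1 := (integrableOn_hasSum_integralOp hγ hp hh2 hz.1).2
    have h2 : HasSum (fun α : ℤ × ℤ => laurentCoeff hγ hh.1 α * monomial α z)
        (integralOp γ (subBergmanKernel γ p) h z) := by
      -- Membership of `h` in `A^p` is needed here: its non-allowable coefficients vanish, so the
      -- sum over allowable indices is the full sum over `ℤ²`.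
      refine (hasSum_subtype_iff_of_support_subset (s := allowable γ p)
        (f := fun α => laurentCoeff hγ hh.1 α * monomial α z) fun α hα => ?_).mp ?_
      · exact mem_allowable_of_laurentCoeff_ne_zero hγ hp hp' hh (left_ne_zero_of_mul hα)
      · convert h1 using 2 with α
        rw [monomialCoeff_eq_laurentCoeff hγ hh.1 hh2 (allowable_subset_two hγ hp α.2), mul_comm]
        rfl
    have hcont : Continuous fun x : UnitAddTorus (Fin 2) => h (torusAct (x 0, x 1) z) :=
      (continuous_comp_torusAct
        (fun w hw => hh.1.differentiableAt ((isOpen_domain hγ).mem_nhds hw.1)) hz).comp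
        (by fun_prop : Continuous fun x : UnitAddTorus (Fin 2) => (x 0, x 1))
    have h3 : HasSum (fun k : Fin 2 → ℤ => laurentCoeff hγ hh.1 (k 0, k 1) *
        monomial (k 0, k 1) z) (integralOp γ (subBergmanKernel γ p) h z) :=
      (finTwoArrowEquiv ℤ).hasSum_iff.mpr h2
    have h4 : UnitAddTorus.mFourierCoeff (ContinuousMap.mk _ hcont) = fun k : Fin 2 → ℤ =>
        laurentCoeff hγ hh.1 (k 0, k 1) * monomial (k 0, k 1) z :=
      funext fun k => mFourierCoeff_comp_torusAct hγ hh.1 hz k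
    have h5 := UnitAddTorus.hasSum_mFourier_series_apply_of_summable
      (f := ContinuousMap.mk _ hcont) (by rw [h4]; exact h3.summable) 0
    rw [h4] at h5
    have h6 : h (torusAct ((0 : UnitAddTorus (Fin 2)) 0, (0 : UnitAddTorus (Fin 2)) 1) z) = h z :=
      congrArg h (torusAct_zero z)
    simp only [ContinuousMap.coe_mk, h6] at h5
    refine h3.unique ?_
    convert h5 using 2 with k
    simp [UnitAddTorus.mFourier]
  -- The axis `z₁ = 0` is a null set, and both sides are continuous on the domain.
  refine Measure.eqOn_open_of_ae_eq (μ := volume) (U := domain γ) ?_ (isOpen_domain hγ)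
    (differentiableOn_integralOp hγ hp hh2).continuousOn hh.1.continuousOn hz
  filter_upwards [ae_mem_puncturedDomain hγ] with z hz using key z hz

/-! ### The orthogonal projection -/

theorem exists_toCircle_zpow_ne_one {k : ℤ} (hk : k ≠ 0) :
    ∃ θ : UnitAddCircle, (θ.toCircle : ℂ) ^ k ≠ 1 := by
  -- The `k`-th power of this circle element is `exp (πi) = -1`.
  refine ⟨((1 / (2 * k) : ℝ) : UnitAddCircle), ?_⟩
  rw [AddCircle.toCircle_apply_mk, Circle.coe_exp, ← Complex.exp_int_mul]
  have hk' : (k : ℂ) ≠ 0 := by exact_mod_cast hk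
  have h : (k : ℂ) * (((2 * π / 1 * (1 / (2 * k)) : ℝ) : ℂ) * Complex.I) = π * Complex.I := by
    push_cast
    field_simp
  rw [h, Complex.exp_pi_mul_I]
  norm_num

/-- Some rotation multiplies the integrand by a constant `χ ≠ 1` while preserving the measure, so
the integral equals `χ` times itself. -/
theorem integral_conj_monomial_mul_monomial {γ : ℝ} (hγ : 0 < γ) {α β : ℤ × ℤ} (hne : α ≠ β) :
    ∫ w, conj (monomial α w) * monomial β w ∂(vol γ) = 0 := by
  have key : ∀ θ : UnitAddCircle × UnitAddCircle, ∀ χ : ℂ, χ ≠ 1 →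
      (∀ w, conj (monomial α (torusAct θ w)) * monomial β (torusAct θ w) =
        χ * (conj (monomial α w) * monomial β w)) →
      ∫ w, conj (monomial α w) * monomial β w ∂(vol γ) = 0 := by
    intro θ χ hχ h
    have hmp := measurePreserving_torusAct hγ θ
    have h1 : ∫ w, conj (monomial α w) * monomial β w ∂(vol γ) =
        χ * ∫ w, conj (monomial α w) * monomial β w ∂(vol γ) := by
      rw [← integral_const_mul]
      simp_rw [← h]
      conv_lhs => rw [← hmp.map_eq]
      exact integral_map hmp.measurable.aemeasurable
        (by fun_prop : Measurable fun w => conj (monomial α w) * monomial β w).aestronglyMeasurable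
    have h2 : (1 - χ) * ∫ w, conj (monomial α w) * monomial β w ∂(vol γ) = 0 := by
      rw [sub_mul, one_mul, ← h1, sub_self]
    exact (mul_eq_zero.mp h2).resolve_left (sub_ne_zero.mpr hχ.symm)
  have hconj : ∀ (t : UnitAddCircle) (i j : ℤ),
      conj ((t.toCircle : ℂ) ^ i) * (t.toCircle : ℂ) ^ j = (t.toCircle : ℂ) ^ (j - i) := by
    intro t i j
    have ht : (t.toCircle : ℂ) ≠ 0 := Circle.coe_ne_zero _
    rw [map_zpow₀, ← Circle.coe_inv_eq_conj, Circle.coe_inv, inv_zpow, zpow_sub₀ ht]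
    field_simp
  by_cases h1 : α.1 = β.1
  · have h2 : β.2 - α.2 ≠ 0 := fun h => hne (Prod.ext h1 (by omega))
    obtain ⟨t, ht⟩ := exists_toCircle_zpow_ne_one h2
    refine key (0, t) _ ht fun w => ?_
    rw [← hconj]
    simp only [monomial_torusAct, AddCircle.toCircle_zero, Circle.coe_one, one_zpow, one_mul,
      map_mul]
    ring
  · have h2 : β.1 - α.1 ≠ 0 := fun h => h1 (by omega)
    obtain ⟨t, ht⟩ := exists_toCircle_zpow_ne_one h2
    refine key (t, 0) _ ht fun w => ?_
    rw [← hconj]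
    simp only [monomial_torusAct, AddCircle.toCircle_zero, Circle.coe_one, one_zpow, mul_one,
      map_mul]
    ring

/-- The monomial `e_α` as an element of `L^2`. -/
def monomialLp {γ : ℝ} {α : ℤ × ℤ} (hα : α ∈ allowable γ 2) : L2 γ :=
  (memLp_monomial hα).toLp

theorem inner_monomialLp {γ : ℝ} {α : ℤ × ℤ} (hα : α ∈ allowable γ 2) {f : ℂ × ℂ → ℂ}
    (hf : MemLp f 2 (vol γ)) :
    inner ℂ (monomialLp hα) (hf.toLp f) = ∫ w, conj (monomial α w) * f w ∂(vol γ) := by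
  rw [L2.inner_def]
  refine integral_congr_ae ?_
  filter_upwards [(memLp_monomial hα).coeFn_toLp, hf.coeFn_toLp] with w h1 h2
  rw [monomialLp, h1, h2, RCLike.inner_apply, mul_comm]

theorem inner_monomialLp_eq_coeff {γ : ℝ} (hγ : 0 < γ) {α : ℤ × ℤ} (hα : α ∈ allowable γ 2)
    {f : ℂ × ℂ → ℂ} (hf : MemLp f 2 (vol γ)) :
    inner ℂ (monomialLp hα) (hf.toLp f) = monomialNormSq γ α * monomialCoeff γ f α := by
  have hN := monomialNormSq_pos hγ hα
  rw [inner_monomialLp, monomialCoeff, mul_div_cancel₀ _ (by exact_mod_cast hN.ne')]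
  rfl

theorem inner_monomialLp_self {γ : ℝ} {α : ℤ × ℤ} (hα : α ∈ allowable γ 2) :
    inner ℂ (monomialLp hα) (monomialLp hα) = (monomialNormSq γ α : ℂ) := by
  refine (inner_monomialLp hα (memLp_monomial hα)).trans ?_
  have h : ∀ w, conj (monomial α w) * monomial α w = ((‖monomial α w‖ ^ 2 : ℝ) : ℂ) := by
    intro w
    rw [← Complex.normSq_eq_norm_sq, Complex.normSq_eq_conj_mul_self]
  simp_rw [h]
  exact integral_ofReal

theorem norm_monomialLp_sq {γ : ℝ} {α : ℤ × ℤ} (hα : α ∈ allowable γ 2) :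
    ‖monomialLp hα‖ ^ 2 = monomialNormSq γ α := by
  have h := inner_monomialLp_self hα
  rw [inner_self_eq_norm_sq_to_K] at h
  exact Complex.ofReal_injective (by simpa using h)

theorem inner_monomialLp_ne {γ : ℝ} (hγ : 0 < γ) {α β : ℤ × ℤ} (hα : α ∈ allowable γ 2)
    (hβ : β ∈ allowable γ 2) (hne : α ≠ β) : inner ℂ (monomialLp hα) (monomialLp hβ) = 0 := by
  refine (inner_monomialLp hα (memLp_monomial hβ)).trans ?_
  exact integral_conj_monomial_mul_monomial hγ hne

/-- The normalized monomials. -/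
def unitMonomial {γ : ℝ} (s : Set (ℤ × ℤ)) (hs : s ⊆ allowable γ 2) (α : s) : L2 γ :=
  ((‖monomialLp (hs α.2)‖⁻¹ : ℝ) : ℂ) • monomialLp (hs α.2)

theorem orthonormal_unitMonomial {γ : ℝ} (hγ : 0 < γ) {s : Set (ℤ × ℤ)}
    (hs : s ⊆ allowable γ 2) : Orthonormal ℂ (unitMonomial s hs) := by
  constructor
  · intro α
    have h : ‖monomialLp (hs α.2)‖ ≠ 0 := by
      have h1 := monomialNormSq_pos hγ (hs α.2)
      rw [← norm_monomialLp_sq (hs α.2)] at h1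
      exact fun h => by simp [h] at h1
    rw [unitMonomial, norm_smul, Complex.norm_of_nonneg (by positivity), inv_mul_cancel₀ h]
  · intro α β hne
    rw [unitMonomial, unitMonomial, inner_smul_left, inner_smul_right,
      inner_monomialLp_ne hγ (hs α.2) (hs β.2) fun h => hne (Subtype.ext h)]
    simp

theorem inner_smul_unitMonomial {γ : ℝ} (hγ : 0 < γ) {s : Set (ℤ × ℤ)}
    (hs : s ⊆ allowable γ 2) {f : ℂ × ℂ → ℂ} (hf : MemLp f 2 (vol γ)) (α : s) :
    inner ℂ (unitMonomial s hs α) (hf.toLp f) • unitMonomial s hs α =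
      monomialCoeff γ f α • monomialLp (hs α.2) := by
  have h1 := monomialNormSq_pos hγ (hs α.2)
  rw [← norm_monomialLp_sq (hs α.2)] at h1
  have h : (‖monomialLp (hs α.2)‖ : ℂ) ≠ 0 := by
    norm_cast
    exact fun h => by simp [h] at h1
  rw [unitMonomial, inner_smul_left, inner_monomialLp_eq_coeff hγ, smul_smul,
    ← norm_monomialLp_sq (hs α.2), Complex.conj_ofReal]
  congr 1
  push_cast
  field_simp

/-- Bessel's inequality makes the orthogonal expansion of `f` along the monomials of `s` converge in
`L²`; orthogonality of the remainder is read off by pairing with one monomial. -/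
theorem exists_hasSum_coeff_smul {γ : ℝ} (hγ : 0 < γ) {s : Set (ℤ × ℤ)}
    (hs : s ⊆ allowable γ 2) {f : ℂ × ℂ → ℂ} (hf : MemLp f 2 (vol γ)) :
    ∃ F : L2 γ, HasSum (fun α : s => monomialCoeff γ f α • monomialLp (hs α.2)) F ∧
      ∀ α : s, inner ℂ (monomialLp (hs α.2)) (hf.toLp f - F) = 0 := by
  have ho := orthonormal_unitMonomial hγ hs
  have h1 := (ho.orthogonalFamily.summable_iff_norm_sq_summable
    fun α => inner ℂ (unitMonomial s hs α) (hf.toLp f)).mpr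
    (ho.inner_products_summable (hf.toLp f))
  simp only [LinearIsometry.toSpanSingleton_apply, inner_smul_unitMonomial hγ hs hf] at h1
  obtain ⟨F, hF⟩ := h1
  refine ⟨F, hF, fun α => ?_⟩
  have h2 := (innerSL ℂ (monomialLp (hs α.2))).hasSum hF
  have h3 : HasSum (fun β : s => innerSL ℂ (monomialLp (hs α.2))
      (monomialCoeff γ f β • monomialLp (hs β.2)))
      (innerSL ℂ (monomialLp (hs α.2)) (monomialCoeff γ f α • monomialLp (hs α.2))) := by
    refine hasSum_single α fun β hne => ?_
    rw [innerSL_apply_apply, inner_smul_right,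
      inner_monomialLp_ne hγ (hs α.2) (hs β.2) fun h => hne (Subtype.ext h.symm), mul_zero]
  have h4 := h2.unique h3
  rw [innerSL_apply_apply, innerSL_apply_apply, inner_smul_right, inner_monomialLp_self] at h4
  rw [inner_sub_right, h4, inner_monomialLp_eq_coeff hγ, mul_comm, sub_self]

/-- A sequence of the finite partial sums converging in `L²` converges almost everywhere, and its
limit must be the pointwise sum. -/
theorem ae_eq_of_hasSum_coeff_smul {γ : ℝ} (hγ : 0 < γ) {s : Set (ℤ × ℤ)}
    (hs : s ⊆ allowable γ 2) {c : ℤ × ℤ → ℂ} {F : L2 γ}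
    (hF : HasSum (fun α : s => c α • monomialLp (hs α.2)) F) {g : ℂ × ℂ → ℂ}
    (hg : ∀ z ∈ domain γ, HasSum (fun α : s => monomial α z * c α) (g z)) : F =ᵐ[vol γ] g := by
  obtain ⟨ns, hns, hae⟩ := (tendstoInMeasure_of_tendsto_Lp hF).exists_seq_tendsto_ae'
  have h1 : ∀ᵐ z ∂(vol γ), ∀ α : s, monomialLp (hs α.2) z = monomial α z :=
    ae_all_iff.mpr fun α => (memLp_monomial (hs α.2)).coeFn_toLp
  have h2 : ∀ᵐ z ∂(vol γ), ∀ α : s,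
      (c α • monomialLp (hs α.2) : L2 γ) z = c α • monomialLp (hs α.2) z :=
    ae_all_iff.mpr fun α => Lp.coeFn_smul _ _
  have h3 : ∀ᵐ z ∂(vol γ), ∀ k : ℕ,
      (∑ α ∈ ns k, c α • monomialLp (hs α.2) : L2 γ) z =
        ∑ α ∈ ns k, (c α • monomialLp (hs α.2) : L2 γ) z :=
    ae_all_iff.mpr fun k => Lp.coeFn_fun_finsetSum _ _
  filter_upwards [hae, h1, h2, h3, ae_restrict_mem (measurableSet_domain hγ)] with z k0 k1 k2 k3 hz
  refine tendsto_nhds_unique k0 (((hg z hz).comp hns).congr fun k => ?_)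
  rw [k3]
  refine Finset.sum_congr rfl fun α _ => ?_
  rw [k2, k1, smul_eq_mul, mul_comm]

theorem monomialLp_mem {γ : ℝ} (hγ : 0 < γ) {p : ℝ≥0∞} (hp : 2 ≤ p) {α : ℤ × ℤ}
    (hα : α ∈ allowable γ p) :
    monomialLp (allowable_subset_two hγ hp hα) ∈ bergmanSubspace γ p :=
  ⟨monomial α, hα, MemLp.coeFn_toLp _⟩

/-- The `L²` sum `F` of the expansion of `f` along allowable monomials represents the integral
operator and lies in the closure of `A^p`. It remains to see that `f - F` is orthogonal to all of
`A^p`, not only to monomials. -/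
theorem subBergmanProjection_ae_eq {γ : ℝ} (hγ : 0 < γ) {p : ℝ≥0∞} (hp : 2 ≤ p) (hp' : p ≠ ∞)
    {f : ℂ × ℂ → ℂ} (hf : MemLp f 2 (vol γ)) :
    subBergmanProjection γ p (hf.toLp f) =ᵐ[vol γ]
      integralOp γ (subBergmanKernel γ p) f := by
  have := isFiniteMeasure_vol hγ
  have hs := allowable_subset_two hγ hp
  obtain ⟨F, hF, hort⟩ := exists_hasSum_coeff_smul hγ hs hf
  have hFae : F =ᵐ[vol γ] integralOp γ (subBergmanKernel γ p) f :=
    ae_eq_of_hasSum_coeff_smul hγ hs hF fun z hz => (integrableOn_hasSum_integralOp hγ hp hf hz).2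
  have hFmem : F ∈ closedBergmanSubspace γ p := by
    refine (bergmanSubspace γ p).isClosed_topologicalClosure.mem_of_tendsto hF
      (Filter.Eventually.of_forall fun t => ?_)
    exact Submodule.sum_mem _ fun α _ => Submodule.smul_mem _ _
      (Submodule.le_topologicalClosure _ (monomialLp_mem hγ hp α.2))
  -- By the reproducing property, each element of `A^p` is itself the `L²` sum of its expansion
  -- along allowable monomials.
  have hperp : ∀ H ∈ bergmanSubspace γ p, inner ℂ (hf.toLp f - F) H = 0 := by
    rintro H ⟨h, hh, hHh⟩
    have hh2 : MemLp h 2 (vol γ) := hh.2.mono_exponent hp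
    obtain ⟨G, hG, -⟩ := exists_hasSum_coeff_smul hγ hs hh2
    have hGae : G =ᵐ[vol γ] h :=
      ae_eq_of_hasSum_coeff_smul hγ hs hG fun z hz => by
        rw [← integralOp_eq_self hγ hp hp' hh hz]
        exact (integrableOn_hasSum_integralOp hγ hp hh2 hz).2
    have hGH : G = H := Lp.ext (hGae.trans hHh.symm)
    have h2 := (innerSL ℂ (hf.toLp f - F)).hasSum hG
    have h3 : (fun α : allowable γ p => innerSL ℂ (hf.toLp f - F)
        (monomialCoeff γ h α • monomialLp (hs α.2))) = fun _ => 0 := by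
      ext α
      rw [innerSL_apply_apply, inner_smul_right, inner_eq_zero_symm.mp (hort α), mul_zero]
    change HasSum (fun α : allowable γ p => innerSL ℂ (hf.toLp f - F)
        (monomialCoeff γ h α • monomialLp (hs α.2))) _ at h2
    rw [h3] at h2
    rw [← hGH]
    exact h2.unique hasSum_zero
  have hproj : subBergmanProjection γ p (hf.toLp f) = F := by
    refine Submodule.eq_starProjection_of_mem_of_inner_eq_zero hFmem fun H hH => ?_
    have hcl : IsClosed {H : L2 γ | inner ℂ (hf.toLp f - F) H = 0} :=
      isClosed_eq (by fun_prop) continuous_const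
    exact closure_minimal (s := (bergmanSubspace γ p : Set (L2 γ))) hperp hcl hH
  rw [hproj]
  exact hFae

theorem isRepresentingKernel_subBergmanKernel {γ : ℝ} (hγ : 0 < γ) {p : ℝ≥0∞} (hp : 2 ≤ p)
    (hp' : p ≠ ∞) :
    IsRepresentingKernel γ (subBergmanKernel γ p) (subBergmanProjection γ p) := fun _ hf =>
  ⟨fun _ hz => (integrableOn_hasSum_integralOp hγ hp hf hz).1,
    differentiableOn_integralOp hγ hp hf, subBergmanProjection_ae_eq hγ hp hp' hf⟩

/-- A point of the closure is fixed by the projection, hence agrees almost everywhere with the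
integral operator applied to it, which is holomorphic. -/
theorem isClosed_bergmanSubspace {γ : ℝ} (hγ : 0 < γ) :
    IsClosed (bergmanSubspace γ 2 : Set (L2 γ)) := by
  refine isClosed_of_closure_subset fun F hF => ?_
  have h1 : subBergmanProjection γ 2 F = F :=
    Submodule.starProjection_eq_self_iff.mpr hF
  have hF2 : MemLp F 2 (vol γ) := Lp.memLp F
  have h2 := subBergmanProjection_ae_eq hγ le_rfl (by simp) hF2
  rw [Lp.toLp_coeFn, h1] at h2
  exact ⟨_, ⟨differentiableOn_integralOp hγ le_rfl hF2, (memLp_congr_ae h2).mp hF2⟩, h2⟩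

/-- Pythagoras in `L²`, as `g - P` is orthogonal to `P - h`. Equality forces `h = P` almost
everywhere, and then everywhere by continuity. -/
theorem eLpNorm_sub_integralOp_le {γ : ℝ} (hγ : 0 < γ) {p : ℝ≥0∞} (hp : 2 ≤ p) (hp' : p ≠ ∞)
    {g h : ℂ × ℂ → ℂ} (hg : MemLp g 2 (vol γ)) (hh : MemBergman γ p h) :
    eLpNorm (g - integralOp γ (subBergmanKernel γ p) g) 2 (vol γ) ≤
        eLpNorm (g - h) 2 (vol γ) ∧
      (eLpNorm (g - h) 2 (vol γ) =
          eLpNorm (g - integralOp γ (subBergmanKernel γ p) g) 2 (vol γ) →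
        EqOn h (integralOp γ (subBergmanKernel γ p) g) (domain γ)) := by
  have := isFiniteMeasure_vol hγ
  have hh2 : MemLp h 2 (vol γ) := hh.2.mono_exponent hp
  have hae := subBergmanProjection_ae_eq hγ hp hp' hg
  set P := subBergmanProjection γ p (hg.toLp g) with hP
  have e1 : eLpNorm (g - integralOp γ (subBergmanKernel γ p) g) 2 (vol γ) =
      ‖hg.toLp g - P‖ₑ := by
    rw [Lp.enorm_def]
    refine eLpNorm_congr_ae ?_
    filter_upwards [hae, hg.coeFn_toLp, Lp.coeFn_sub (hg.toLp g) P] with z h1 h2 h3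
    rw [h3, Pi.sub_apply, Pi.sub_apply, h1, h2]
  have e2 : eLpNorm (g - h) 2 (vol γ) = ‖hg.toLp g - hh2.toLp h‖ₑ := by
    rw [← MemLp.toLp_sub, Lp.enorm_toLp]
  have hhmem : hh2.toLp h ∈ closedBergmanSubspace γ p :=
    Submodule.le_topologicalClosure _ ⟨h, hh, hh2.coeFn_toLp⟩
  have hPmem : P ∈ closedBergmanSubspace γ p := Submodule.starProjection_apply_mem _ _
  have hpyth : ‖hg.toLp g - hh2.toLp h‖ ^ 2 =
      ‖hg.toLp g - P‖ ^ 2 + ‖P - hh2.toLp h‖ ^ 2 := by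
    have h0 : inner ℂ (hg.toLp g - P) (P - hh2.toLp h) = 0 :=
      Submodule.starProjection_inner_eq_zero _ _ (Submodule.sub_mem _ hPmem hhmem)
    have := norm_add_sq_eq_norm_sq_add_norm_sq_of_inner_eq_zero _ _ h0
    rw [sub_add_sub_cancel] at this
    simpa only [sq] using this
  rw [e1, e2]
  constructor
  · rw [← ofReal_norm, ← ofReal_norm]
    refine ENNReal.ofReal_le_ofReal ?_
    refine (sq_le_sq₀ (norm_nonneg _) (norm_nonneg _)).mp ?_
    nlinarith [sq_nonneg ‖P - hh2.toLp h‖]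
  · intro heq
    have h1 : ‖hg.toLp g - hh2.toLp h‖ = ‖hg.toLp g - P‖ := by
      have := congrArg ENNReal.toReal heq
      simpa using this
    rw [h1] at hpyth
    have h2 : P = hh2.toLp h := by
      rw [← sub_eq_zero, ← norm_eq_zero]
      exact pow_eq_zero_iff two_ne_zero |>.mp (by linarith)
    have h3 : h =ᵐ[vol γ] integralOp γ (subBergmanKernel γ p) g := by
      rw [h2] at hae
      exact hh2.coeFn_toLp.symm.trans hae
    exact Measure.eqOn_open_of_ae_eq h3 (isOpen_domain hγ) hh.1.continuousOn
      (differentiableOn_integralOp hγ hp hg).continuousOn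

/-! ### Pointwise bound of the kernel -/

theorem mem_allowable_rational_iff {m n : ℕ} (hm : 0 < m) (hn : 0 < n) {p : ℝ≥0∞} (hp : 2 ≤ p)
    (hp' : p ≠ ∞) {α : ℤ × ℤ} :
    α ∈ allowable ((m : ℝ) / n) p ↔
      0 ≤ α.1 ∧ -(2 * (m + n) / p.toReal) < (n * α.1 + m * α.2 : ℝ) := by
  have hm' : (0 : ℝ) < m := by exact_mod_cast hm
  have hn' : (0 : ℝ) < n := by exact_mod_cast hn
  have hpr : 2 ≤ p.toReal := by
    simpa using ENNReal.toReal_mono hp' hp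
  have hpr0 : 0 < p.toReal := by linarith
  rw [mem_allowable_iff (by positivity) hp hp']
  refine and_congr_right fun _ => ?_
  have h : (α.1 * p.toReal + 2) / ((m : ℝ) / n) + α.2 * p.toReal + 2 =
      p.toReal / m * ((n * α.1 + m * α.2) - -(2 * (m + n) / p.toReal)) := by
    field_simp
    ring
  rw [h, mul_pos_iff_of_pos_left (by positivity), sub_pos]

/-- The least `j` with `n r + m j > -τ`. -/
def leastExponent (m n : ℕ) (τ : ℝ) (r : ℕ) : ℤ := ⌊(-τ - n * r) / m⌋ + 1

theorem leastExponent_le_iff {m n : ℕ} (hm : 0 < m) {τ : ℝ} {r : ℕ} {j : ℤ} :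
    leastExponent m n τ r ≤ j ↔ -τ < (n * r + m * j : ℝ) := by
  have hm' : (0 : ℝ) < m := by exact_mod_cast hm
  rw [leastExponent, Int.add_one_le_iff, Int.floor_lt, div_lt_iff₀ hm']
  constructor <;> intro h <;> linarith

/-- The multi-index with first entry `m q + r` and `n α₁ + m α₂ = n r + m (j_r + l)`. -/
def gridIndex (m n : ℕ) (τ : ℝ) (k : Fin m × (ℕ × ℕ)) : ℤ × ℤ :=
  (m * k.2.1 + k.1, leastExponent m n τ k.1 + k.2.2 - n * k.2.1)

theorem gridIndex_injective (m n : ℕ) (τ : ℝ) : Function.Injective (gridIndex m n τ) := by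
  rintro ⟨r, q, l⟩ ⟨r', q', l'⟩ h
  simp only [gridIndex, Prod.mk.injEq] at h
  obtain ⟨h1, h2⟩ := h
  have h1' : m * q + r = m * q' + (r' : ℕ) := by exact_mod_cast h1
  have hr : (r : ℕ) = r' := by
    have := congrArg (· % m) h1'
    simpa [Nat.mod_eq_of_lt r.2, Nat.mod_eq_of_lt r'.2] using this
  have hmpos : 0 < m := lt_of_le_of_lt (Nat.zero_le _) r.2
  have hq : q = q' := by
    rw [hr] at h1'
    exact Nat.eq_of_mul_eq_mul_left hmpos (Nat.add_right_cancel h1')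
  rw [hr, hq] at h2
  have hl : l = l' := by omega
  rw [Fin.ext hr, hq, hl]

/-- Division with remainder of `α₁` by `m` selects `r` and `q`. Since `(m, -n)` leaves `n α₁ + m α₂`
unchanged, the constraint depends only on `r` and `α₂ + n q`, the least admissible value of which is
`leastExponent`. -/
theorem range_gridIndex {m n : ℕ} (hm : 0 < m) (hn : 0 < n) {p : ℝ≥0∞} (hp : 2 ≤ p)
    (hp' : p ≠ ∞) :
    Set.range (gridIndex m n (2 * (m + n) / p.toReal)) = allowable ((m : ℝ) / n) p := by
  ext ⟨i, j⟩
  rw [mem_allowable_rational_iff hm hn hp hp']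
  constructor
  · rintro ⟨⟨r, q, l⟩, h⟩
    simp only [gridIndex, Prod.mk.injEq] at h
    obtain ⟨rfl, rfl⟩ := h
    refine ⟨by positivity, ?_⟩
    have h := (leastExponent_le_iff (n := n) (τ := 2 * (m + n) / p.toReal) (r := r) hm).mp
      (le_add_of_nonneg_right (Int.natCast_nonneg l))
    refine h.trans_le (le_of_eq ?_)
    push_cast
    ring
  · rintro ⟨hi, h⟩
    obtain ⟨k, rfl⟩ := Int.eq_ofNat_of_zero_le hi
    obtain ⟨q, r, hr, rfl⟩ : ∃ q r : ℕ, r < m ∧ k = m * q + r :=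
      ⟨k / m, k % m, Nat.mod_lt k hm, (Nat.div_add_mod k m).symm⟩
    have hle : leastExponent m n (2 * (m + n) / p.toReal) r ≤ j + n * q := by
      rw [leastExponent_le_iff hm]
      refine h.trans_le (le_of_eq ?_)
      push_cast
      ring
    obtain ⟨l, hl⟩ := Int.eq_ofNat_of_zero_le (sub_nonneg.mpr hle)
    refine ⟨(⟨r, hr⟩, q, l), ?_⟩
    simp only [gridIndex, Prod.mk.injEq]
    refine ⟨by push_cast; ring, ?_⟩
    rw [← hl]
    ring

/-- In the inverse squared norm, `q` cancels from `(α₁+1)/γ + α₂ + 1`. The term is therefore a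
function of `q` times a function of `l`, and the double sum for each `r` factors. -/
theorem kernelTerm_gridIndex {m n : ℕ} (hm : 0 < m) (hn : 0 < n) {p : ℝ≥0∞} (hp : 2 ≤ p)
    (hp' : p ≠ ∞) {z w : ℂ × ℂ} (hz : z.2 ≠ 0) (hw : w.2 ≠ 0) (r : Fin m) (q l : ℕ) :
    kernelTerm ((m : ℝ) / n) z w (gridIndex m n (2 * (m + n) / p.toReal) (r, q, l)) =
      ((z.1 * conj w.1) ^ (r : ℕ) *
        (z.2 * conj w.2) ^ leastExponent m n (2 * (m + n) / p.toReal) r / (π ^ 2 * m)) *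
      ((m * q + (r + 1)) * ((z.1 * conj w.1) ^ m / (z.2 * conj w.2) ^ n) ^ q *
        ((m * l + (m * (leastExponent m n (2 * (m + n) / p.toReal) r + 1) + n * (r + 1))) *
          (z.2 * conj w.2) ^ l)) := by
  have hm' : (0 : ℝ) < m := by exact_mod_cast hm
  have hn' : (0 : ℝ) < n := by exact_mod_cast hn
  have hmC : (m : ℂ) ≠ 0 := by exact_mod_cast hm.ne'
  have hnC : (n : ℂ) ≠ 0 := by exact_mod_cast hn.ne'
  have hγ : 0 < (m : ℝ) / n := by positivity
  set τ := 2 * (m + n) / p.toReal with hτ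
  set j := leastExponent m n τ r with hj
  have hmem : gridIndex m n τ (r, q, l) ∈ allowable ((m : ℝ) / n) 2 :=
    allowable_subset_two hγ hp (by rw [← range_gridIndex hm hn hp hp']; exact mem_range_self _)
  have ht : z.2 * conj w.2 ≠ 0 := mul_ne_zero hz (by simpa using hw)
  have hN := inv_monomialNormSq hγ hmem
  have h1 : kernelTerm ((m : ℝ) / n) z w (gridIndex m n τ (r, q, l)) =
      (z.1 * conj w.1) ^ (m * q + r : ℤ) * (z.2 * conj w.2) ^ (j + l - n * q : ℤ) *
        (((monomialNormSq ((m : ℝ) / n) (gridIndex m n τ (r, q, l)))⁻¹ : ℝ) : ℂ) := by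
    simp only [kernelTerm, monomial, monomialNormSq, gridIndex, map_mul, map_zpow₀, mul_zpow,
      Complex.ofReal_inv]
    ring
  rw [h1, hN]
  generalize z.2 * conj w.2 = t at ht
  generalize z.1 * conj w.1 = s
  have h2 : s ^ (m * q + r : ℤ) = s ^ (r : ℕ) * (s ^ m) ^ q := by
    rw [show (m * q + r : ℤ) = ((r + m * q : ℕ) : ℤ) by push_cast; ring, zpow_natCast, pow_add,
      pow_mul]
  have h3 : t ^ (j + l - n * q : ℤ) = t ^ j * t ^ l * ((t ^ n) ^ q)⁻¹ := by
    rw [zpow_sub₀ ht, zpow_add₀ ht, zpow_natCast,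
      show (n * q : ℤ) = ((n * q : ℕ) : ℤ) by push_cast; ring, zpow_natCast, pow_mul,
      div_eq_mul_inv]
  rw [h2, h3, div_pow]
  simp only [gridIndex]
  rw [← hj]
  push_cast
  have hπ : (π : ℂ) ≠ 0 := by exact_mod_cast Real.pi_ne_zero
  have htn : (t ^ n) ^ q ≠ 0 := by positivity
  field_simp
  ring

theorem hasSum_linear_mul_geometric {u : ℂ} (hu : ‖u‖ < 1) (a d : ℂ) :
    HasSum (fun q : ℕ => (a * q + d) * u ^ q) (a * (u / (1 - u) ^ 2) + d * (1 - u)⁻¹) := by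
  have h1 := (hasSum_coe_mul_geometric_of_norm_lt_one hu).mul_left a
  have h2 := (hasSum_geometric_of_norm_lt_one hu).mul_left d
  have h3 : (fun q : ℕ => (a * q + d) * u ^ q) = fun q : ℕ => a * (q * u ^ q) + d * u ^ q :=
    funext fun q => by ring
  rw [h3]
  exact h1.add h2

theorem summable_norm_linear_mul_geometric {u : ℂ} (hu : ‖u‖ < 1) (a d : ℂ) :
    Summable fun q : ℕ => ‖(a * q + d) * u ^ q‖ := by
  have hu' : ‖(‖u‖ : ℝ)‖ < 1 := by simpa using hu
  have h1 := (hasSum_coe_mul_geometric_of_norm_lt_one hu').summable.mul_left ‖a‖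
  have h2 := (hasSum_geometric_of_norm_lt_one hu').summable.mul_left ‖d‖
  refine Summable.of_nonneg_of_le (fun q => norm_nonneg _) (fun q => ?_) (h1.add h2)
  rw [norm_mul, norm_pow, ← mul_assoc, ← add_mul]
  gcongr
  refine (norm_add_le _ _).trans (le_of_eq ?_)
  simp

/-- The sum is `(a u + d (1 - u)) / (1 - u)²`, and `‖1 - u‖ ≤ 2`. -/
theorem norm_tsum_linear_mul_geometric_le {u : ℂ} (hu : ‖u‖ < 1) (a d : ℂ) :
    ‖∑' q : ℕ, (a * q + d) * u ^ q‖ ≤ (‖a‖ + 2 * ‖d‖) * (‖1 - u‖ ^ 2)⁻¹ := by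
  have hne : 1 - u ≠ 0 := by
    intro h
    rw [← sub_eq_zero.mp h] at hu
    simp at hu
  have h1 : a * (u / (1 - u) ^ 2) + d * (1 - u)⁻¹ = (a * u + d * (1 - u)) / (1 - u) ^ 2 := by
    field_simp
  rw [(hasSum_linear_mul_geometric hu a d).tsum_eq, h1, norm_div, norm_pow, div_eq_mul_inv]
  gcongr
  have h2 : ‖1 - u‖ ≤ 2 := (norm_sub_le _ _).trans (by rw [norm_one]; linarith)
  calc ‖a * u + d * (1 - u)‖ ≤ ‖a‖ * ‖u‖ + ‖d‖ * ‖1 - u‖ := by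
        refine (norm_add_le _ _).trans (le_of_eq ?_)
        rw [norm_mul, norm_mul]
    _ ≤ ‖a‖ * 1 + ‖d‖ * 2 := by gcongr
    _ = _ := by ring

theorem exists_norm_subBergmanKernel_le {m n : ℕ} (hm : 0 < m) (hn : 0 < n) {p : ℝ≥0∞}
    (hp : 2 ≤ p) (hp' : p ≠ ∞) :
    ∃ c : ℝ, 0 ≤ c ∧ c * p.toReal < 2 + 2 * ((m : ℝ) / n)⁻¹ ∧ ∃ C : ℝ, 0 ≤ C ∧
      ∀ z ∈ domain ((m : ℝ) / n), ∀ w ∈ domain ((m : ℝ) / n),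
        ‖subBergmanKernel ((m : ℝ) / n) p z w‖ ≤
          C * ((‖z.2‖ * ‖w.2‖) ^ (-c) *
            (‖1 - (z.1 * conj w.1) ^ m / (z.2 * conj w.2) ^ n‖ ^ 2)⁻¹ *
            (‖1 - z.2 * conj w.2‖ ^ 2)⁻¹) := by
  have hm' : (0 : ℝ) < m := by exact_mod_cast hm
  have hn' : (0 : ℝ) < n := by exact_mod_cast hn
  have hγ : 0 < (m : ℝ) / n := by positivity
  have hpr : 2 ≤ p.toReal := by
    simpa using ENNReal.toReal_mono hp' hp
  have hpr0 : 0 < p.toReal := by linarith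
  set τ := 2 * (m + n) / p.toReal with hτ
  have hτ0 : 0 < τ := by positivity
  -- `⌊-τ⌋ + 1` is the least integer above `-τ`, hence a lower bound for `n α₁ + m α₂` on allowable
  -- indices. Being strictly above `-τ`, it gives `c < τ / m`, that is `c p < 2 + 2/γ`. The maximum
  -- with `0` keeps `c ≥ 0`, as the choice of Schur weights requires.
  set c : ℝ := max 0 (-(⌊-τ⌋ + 1) / m) with hc
  have hcτ : c < τ / m := by
    refine max_lt (by positivity) ?_
    have := Int.lt_floor_add_one (-τ)
    gcongr
    linarith
  set A : Fin m → ℝ := fun r => ‖(m : ℂ)‖ + 2 * ‖((r : ℕ) + 1 : ℂ)‖ with hA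
  set B : Fin m → ℝ := fun r => ‖(m : ℂ)‖ +
    2 * ‖(m * (leastExponent m n τ r + 1) + n * ((r : ℕ) + 1) : ℂ)‖ with hB
  have hA0 : ∀ r, 0 ≤ A r := fun r => by positivity
  have hB0 : ∀ r, 0 ≤ B r := fun r => by positivity
  refine ⟨c, le_max_left _ _, ?_, ∑ r, (π ^ 2 * m)⁻¹ * (A r * B r),
    Finset.sum_nonneg fun r _ => mul_nonneg (by positivity) (mul_nonneg (hA0 r) (hB0 r)), ?_⟩
  · calc c * p.toReal < τ / m * p.toReal := by gcongr
      _ = 2 + 2 * ((m : ℝ) / n)⁻¹ := by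
        rw [hτ]
        field_simp
  intro z hz w hw
  have hz2 := snd_ne_zero_of_mem_domain hz
  have hw2 := snd_ne_zero_of_mem_domain hw
  set s := z.1 * conj w.1 with hs
  set t := z.2 * conj w.2 with ht
  set u := s ^ m / t ^ n with hu
  have hst : ‖t‖ < 1 ∧ ‖s‖ < ‖t‖ ^ ((m : ℝ) / n)⁻¹ := by
    have := (mem_domain_iff hγ).mp (mul_mem_domain hγ hz hw)
    simpa [hs, ht] using this
  have ht0 : 0 < ‖t‖ := norm_pos_iff.mpr (mul_ne_zero hz2 (by simpa using hw2))
  have htn : ‖z.2‖ * ‖w.2‖ = ‖t‖ := by simp [ht]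
  have hu1 : ‖u‖ < 1 := by
    rw [hu, norm_div, norm_pow, norm_pow, div_lt_one (by positivity)]
    calc ‖s‖ ^ m < (‖t‖ ^ ((m : ℝ) / n)⁻¹) ^ m :=
          pow_lt_pow_left₀ hst.2 (norm_nonneg _) hm.ne'
      _ = ‖t‖ ^ n := by
          rw [← Real.rpow_natCast, ← Real.rpow_mul ht0.le, ← Real.rpow_natCast]
          congr 1
          field_simp
  have hterm : ∀ k : Fin m × (ℕ × ℕ), kernelTerm ((m : ℝ) / n) z w (gridIndex m n τ k) =
      (s ^ (k.1 : ℕ) * t ^ leastExponent m n τ k.1 / (π ^ 2 * m)) *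
        ((m * k.2.1 + (k.1 + 1)) * u ^ k.2.1 *
          ((m * k.2.2 + (m * (leastExponent m n τ k.1 + 1) + n * (k.1 + 1))) * t ^ k.2.2)) :=
    fun k => kernelTerm_gridIndex hm hn hp hp' hz2 hw2 k.1 k.2.1 k.2.2
  let e := (Equiv.ofInjective _ (gridIndex_injective m n τ)).trans
    (Equiv.setCongr (range_gridIndex hm hn hp hp'))
  have hsum : Summable fun k : Fin m × (ℕ × ℕ) =>
      kernelTerm ((m : ℝ) / n) z w (gridIndex m n τ k) :=
    e.summable_iff.mpr (summable_kernelTerm_allowable hγ hp hz hw)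
  have hK : subBergmanKernel ((m : ℝ) / n) p z w =
      ∑ r : Fin m, (s ^ (r : ℕ) * t ^ leastExponent m n τ r / (π ^ 2 * m)) *
        ((∑' q : ℕ, (m * q + ((r : ℕ) + 1)) * u ^ q) *
          ∑' l : ℕ, (m * l + (m * (leastExponent m n τ r + 1) + n * ((r : ℕ) + 1))) * t ^ l) := by
    rw [subBergmanKernel, ← e.tsum_eq]
    change ∑' k : Fin m × (ℕ × ℕ), kernelTerm ((m : ℝ) / n) z w (gridIndex m n τ k) = _
    rw [hsum.tsum_prod, tsum_fintype]
    refine Finset.sum_congr rfl fun r _ => ?_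
    simp_rw [hterm]
    rw [tsum_mul_left, tsum_mul_tsum_of_summable_norm
      (summable_norm_linear_mul_geometric hu1 _ _)
      (summable_norm_linear_mul_geometric hst.1 _ _)]
  -- Since `‖s‖ < ‖t‖^{n/m}`, the left side is at most `‖t‖` to the power `(n r + m j_r)/m`, whose
  -- numerator is an integer above `-τ`.
  have hpow : ∀ r : Fin m, ‖s‖ ^ (r : ℕ) * ‖t‖ ^ leastExponent m n τ r ≤ ‖t‖ ^ (-c) := by
    intro r
    have h1 : ‖s‖ ^ (r : ℕ) ≤ (‖t‖ ^ ((m : ℝ) / n)⁻¹) ^ (r : ℕ) := by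
      have := hst.2.le
      gcongr
    calc ‖s‖ ^ (r : ℕ) * ‖t‖ ^ leastExponent m n τ r
        ≤ (‖t‖ ^ ((m : ℝ) / n)⁻¹) ^ (r : ℕ) * ‖t‖ ^ leastExponent m n τ r := by gcongr
      _ = ‖t‖ ^ (((m : ℝ) / n)⁻¹ * (r : ℕ) + leastExponent m n τ r) := by
          rw [Real.rpow_add ht0, Real.rpow_mul ht0.le, Real.rpow_natCast, Real.rpow_intCast]
      _ ≤ ‖t‖ ^ (-c) := by
          refine Real.rpow_le_rpow_of_exponent_ge ht0 hst.1.le ?_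
          have h2 := (leastExponent_le_iff (n := n) (τ := τ) (r := r) hm).mp le_rfl
          have h3 : ⌊-τ⌋ + 1 ≤ n * (r : ℕ) + m * leastExponent m n τ r := by
            rw [Int.add_one_le_iff, Int.floor_lt]
            push_cast
            exact h2
          have h4 : ((⌊-τ⌋ : ℝ) + 1) ≤ n * (r : ℕ) + m * leastExponent m n τ r := by
            exact_mod_cast h3
          have h5 : -(⌊-τ⌋ + 1) / m ≤ c := le_max_right _ _
          have h6 : ((m : ℝ) / n)⁻¹ * (r : ℕ) + leastExponent m n τ r =
              (n * (r : ℕ) + m * leastExponent m n τ r) / m := by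
            field_simp
          rw [h6, neg_le, ← neg_div]
          refine le_trans ?_ h5
          gcongr
  rw [hK, htn, Finset.sum_mul]
  refine (norm_sum_le _ _).trans (Finset.sum_le_sum fun r _ => ?_)
  rw [norm_mul, norm_mul, norm_div, norm_mul, norm_pow, norm_zpow]
  have hπ : ‖(π ^ 2 * m : ℂ)‖ = π ^ 2 * m := by
    simp [abs_of_pos Real.pi_pos]
  rw [hπ]
  calc ‖s‖ ^ (r : ℕ) * ‖t‖ ^ leastExponent m n τ r / (π ^ 2 * m) *
        (‖∑' q : ℕ, (m * q + ((r : ℕ) + 1)) * u ^ q‖ *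
          ‖∑' l : ℕ, (m * l + (m * (leastExponent m n τ r + 1) + n * ((r : ℕ) + 1))) * t ^ l‖)
      ≤ ‖t‖ ^ (-c) / (π ^ 2 * m) *
        ((A r * (‖1 - u‖ ^ 2)⁻¹) * (B r * (‖1 - t‖ ^ 2)⁻¹)) := by
        have hA0' := hA0 r
        gcongr
        · exact hpow r
        · exact norm_tsum_linear_mul_geometric_le hu1 _ _
        · exact norm_tsum_linear_mul_geometric_le hst.1 _ _
    _ = _ := by
        rw [div_eq_mul_inv]
        ring

/-! ### Schur's test -/

/-- Schur's test: Hölder applied to `Q^{1/q} h · Q^{1/p} h⁻¹ F` uses the first hypothesis, and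
Tonelli followed by the second one finishes. The constants combine as `C^{p/q} C = C^p`. -/
theorem lintegral_rpow_lintegral_mul_le {X : Type*} [MeasurableSpace X] {μ : Measure X}
    [SFinite μ] {p q : ℝ} (hpq : p.HolderConjugate q) {Q : X → X → ℝ≥0∞}
    (hQ : Measurable (Function.uncurry Q)) {h : X → ℝ≥0∞} (hh : Measurable h)
    (hh0 : ∀ᵐ x ∂μ, h x ≠ 0) (hht : ∀ᵐ x ∂μ, h x ≠ ⊤) {C : ℝ≥0}
    (h1 : ∀ᵐ x ∂μ, ∫⁻ y, Q x y * h y ^ q ∂μ ≤ C * h x ^ q)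
    (h2 : ∀ᵐ y ∂μ, ∫⁻ x, Q x y * h x ^ p ∂μ ≤ C * h y ^ p)
    {F : X → ℝ≥0∞} (hF : AEMeasurable F μ) :
    ∫⁻ x, (∫⁻ y, Q x y * F y ∂μ) ^ p ∂μ ≤ (C : ℝ≥0∞) ^ p * ∫⁻ x, F x ^ p ∂μ := by
  have hp0 : 0 < p := hpq.pos
  have hq0 : 0 < q := hpq.symm.pos
  have hQx : ∀ x, Measurable (Q x) := fun x => hQ.comp measurable_prodMk_left
  have hpt : ∀ᵐ x ∂μ, (∫⁻ y, Q x y * F y ∂μ) ^ p ≤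
      (C : ℝ≥0∞) ^ (p / q) * ∫⁻ y, Q x y * h x ^ p * ((h y)⁻¹ * F y) ^ p ∂μ := by
    filter_upwards [h1, hh0, hht] with x hx hx0 hxt
    have e1 : ∫⁻ y, Q x y * F y ∂μ =
        ∫⁻ y, ((fun y => Q x y ^ (1 / q) * h y) *
          fun y => Q x y ^ (1 / p) * ((h y)⁻¹ * F y)) y ∂μ := by
      refine lintegral_congr_ae ?_
      filter_upwards [hh0, hht] with y hy0 hyt
      simp only [Pi.mul_apply]
      have : Q x y = Q x y ^ (1 / q) * Q x y ^ (1 / p) := by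
        rw [← ENNReal.rpow_add_of_nonneg _ _ (by positivity) (by positivity), add_comm,
          one_div, one_div, hpq.inv_add_inv_eq_one, ENNReal.rpow_one]
      calc Q x y * F y = Q x y ^ (1 / q) * Q x y ^ (1 / p) * (h y * (h y)⁻¹) * F y := by
            rw [ENNReal.mul_inv_cancel hy0 hyt, mul_one, ← this]
        _ = _ := by ring
    have e2 := ENNReal.lintegral_mul_le_Lp_mul_Lq μ hpq.symm
      (f := fun y => Q x y ^ (1 / q) * h y) (g := fun y => Q x y ^ (1 / p) * ((h y)⁻¹ * F y))
      (((hQx x).pow_const _).mul hh).aemeasurable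
      (((hQx x).pow_const _).aemeasurable.mul (hh.inv.aemeasurable.mul hF))
    rw [← e1] at e2
    have e3 : ∀ y, (Q x y ^ (1 / q) * h y) ^ q = Q x y * h y ^ q := by
      intro y
      rw [ENNReal.mul_rpow_of_nonneg _ _ hq0.le, ← ENNReal.rpow_mul, one_div,
        inv_mul_cancel₀ hq0.ne', ENNReal.rpow_one]
    have e4 : ∀ y, (Q x y ^ (1 / p) * ((h y)⁻¹ * F y)) ^ p = Q x y * ((h y)⁻¹ * F y) ^ p := by
      intro y
      rw [ENNReal.mul_rpow_of_nonneg _ _ hp0.le, ← ENNReal.rpow_mul, one_div,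
        inv_mul_cancel₀ hp0.ne', ENNReal.rpow_one]
    simp_rw [e3, e4] at e2
    calc (∫⁻ y, Q x y * F y ∂μ) ^ p
        ≤ ((C * h x ^ q) ^ (1 / q) *
            (∫⁻ y, Q x y * ((h y)⁻¹ * F y) ^ p ∂μ) ^ (1 / p)) ^ p := by
          refine ENNReal.rpow_le_rpow (e2.trans ?_) hp0.le
          gcongr
      _ = (C : ℝ≥0∞) ^ (p / q) * (h x ^ p * ∫⁻ y, Q x y * ((h y)⁻¹ * F y) ^ p ∂μ) := by
          have e5 : ((h x ^ q) ^ (1 / q)) ^ p = h x ^ p := by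
            rw [← ENNReal.rpow_mul (h x), mul_one_div_cancel hq0.ne', ENNReal.rpow_one]
          have e6 : ((C : ℝ≥0∞) ^ (1 / q)) ^ p = (C : ℝ≥0∞) ^ (p / q) := by
            rw [← ENNReal.rpow_mul, one_div_mul_eq_div]
          rw [ENNReal.mul_rpow_of_nonneg _ _ hp0.le,
            ENNReal.mul_rpow_of_nonneg _ _ (by positivity : 0 ≤ 1 / q),
            ENNReal.mul_rpow_of_nonneg _ _ hp0.le, e5, e6, ← ENNReal.rpow_mul,
            one_div_mul_cancel hp0.ne', ENNReal.rpow_one, mul_assoc]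
      _ = _ := by
          congr 1
          rw [← lintegral_const_mul' _ _ (ENNReal.rpow_ne_top_of_nonneg hp0.le hxt)]
          congr 1
          ext y
          ring
  have hmeas : AEMeasurable
      (Function.uncurry fun x y => Q x y * h x ^ p * ((h y)⁻¹ * F y) ^ p) (μ.prod μ) := by
    have a1 : AEMeasurable (fun r : X × X => Q r.1 r.2) (μ.prod μ) := hQ.aemeasurable
    have a2 : AEMeasurable (fun r : X × X => h r.1) (μ.prod μ) :=
      (hh.comp measurable_fst).aemeasurable
    have a3 : AEMeasurable (fun r : X × X => h r.2) (μ.prod μ) :=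
      (hh.comp measurable_snd).aemeasurable
    have a4 : AEMeasurable (fun r : X × X => F r.2) (μ.prod μ) := hF.comp_snd
    exact (a1.mul (a2.pow_const _)).mul ((a3.inv.mul a4).pow_const _)
  calc ∫⁻ x, (∫⁻ y, Q x y * F y ∂μ) ^ p ∂μ
      ≤ ∫⁻ x, (C : ℝ≥0∞) ^ (p / q) *
          ∫⁻ y, Q x y * h x ^ p * ((h y)⁻¹ * F y) ^ p ∂μ ∂μ := lintegral_mono_ae hpt
    _ = (C : ℝ≥0∞) ^ (p / q) *
          ∫⁻ y, ∫⁻ x, Q x y * h x ^ p * ((h y)⁻¹ * F y) ^ p ∂μ ∂μ := by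
        rw [lintegral_const_mul' _ _
          (ENNReal.rpow_ne_top_of_nonneg (by positivity) ENNReal.coe_ne_top),
          lintegral_lintegral_swap hmeas]
    _ ≤ (C : ℝ≥0∞) ^ (p / q) * ∫⁻ y, C * F y ^ p ∂μ := by
        gcongr 1
        refine lintegral_mono_ae ?_
        filter_upwards [h2, hh0, hht] with y hy hy0 hyt
        have m1 : Measurable fun x => Q x y * h x ^ p :=
          (hQ.comp (measurable_id.prodMk measurable_const)).mul (hh.pow_const _)
        rw [lintegral_mul_const _ m1]
        calc (∫⁻ x, Q x y * h x ^ p ∂μ) * ((h y)⁻¹ * F y) ^ p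
            ≤ C * h y ^ p * ((h y)⁻¹ * F y) ^ p := by gcongr
          _ = C * F y ^ p := by
              rw [mul_assoc, ← ENNReal.mul_rpow_of_nonneg _ _ hp0.le, ← mul_assoc (h y),
                ENNReal.mul_inv_cancel hy0 hyt, one_mul]
    _ = (C : ℝ≥0∞) ^ p * ∫⁻ x, F x ^ p ∂μ := by
        rw [lintegral_const_mul' _ _ ENNReal.coe_ne_top, ← mul_assoc]
        congr 1
        conv_lhs => rw [← ENNReal.rpow_one (C : ℝ≥0∞), ← ENNReal.rpow_mul, mul_comm (1 : ℝ)]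
        rw [← ENNReal.rpow_add_of_nonneg _ _ (by positivity) zero_le_one]
        congr 1
        have := hpq.inv_add_inv_eq_one
        field_simp at this ⊢
        linarith

/-! ### The weighted integral of the kernel bound -/

/-- The majorant of the kernel. -/
def kernelMajorant (m n : ℕ) (c : ℝ) (z w : ℂ × ℂ) : ℝ :=
  (‖z.2‖ * ‖w.2‖) ^ (-c) * (‖1 - (z.1 * conj w.1) ^ m / (z.2 * conj w.2) ^ n‖ ^ 2)⁻¹ *
    (‖1 - z.2 * conj w.2‖ ^ 2)⁻¹

theorem kernelMajorant_nonneg (m n : ℕ) (c : ℝ) (z w : ℂ × ℂ) : 0 ≤ kernelMajorant m n c z w := by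
  unfold kernelMajorant
  positivity

theorem kernelMajorant_comm (m n : ℕ) (c : ℝ) (z w : ℂ × ℂ) :
    kernelMajorant m n c z w = kernelMajorant m n c w z := by
  have h1 : ‖1 - z.2 * conj w.2‖ = ‖1 - w.2 * conj z.2‖ := by
    rw [← RCLike.norm_conj]
    simp [mul_comm]
  have h2 : ‖1 - (z.1 * conj w.1) ^ m / (z.2 * conj w.2) ^ n‖ =
      ‖1 - (w.1 * conj z.1) ^ m / (w.2 * conj z.2) ^ n‖ := by
    rw [← RCLike.norm_conj]
    simp [mul_comm]
  rw [kernelMajorant, kernelMajorant, h1, h2, mul_comm ‖z.2‖]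

theorem measurable_kernelMajorant (m n : ℕ) (c : ℝ) :
    Measurable fun q : (ℂ × ℂ) × (ℂ × ℂ) => kernelMajorant m n c q.1 q.2 := by
  unfold kernelMajorant
  fun_prop

/-- The weights of Schur's test. -/
def schurWeight (γ ε β : ℝ) (w : ℂ × ℂ) : ℝ :=
  (1 - ‖w.1‖ / ‖w.2‖ ^ γ⁻¹) ^ (-ε) * (1 - ‖w.2‖) ^ (-ε) * ‖w.2‖ ^ (-β)

theorem schurWeight_pos {γ : ℝ} (hγ : 0 < γ) (ε β : ℝ) {w : ℂ × ℂ} (hw : w ∈ domain γ) :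
    0 < schurWeight γ ε β w := by
  have h := (mem_domain_iff hγ).mp hw
  have hw2 : 0 < ‖w.2‖ := norm_pos_iff.mpr (snd_ne_zero_of_mem_domain hw)
  have h1 : 0 < 1 - ‖w.2‖ := by linarith [h.1]
  have h2 : 0 < 1 - ‖w.1‖ / ‖w.2‖ ^ γ⁻¹ := by
    rw [sub_pos, div_lt_one (by positivity)]
    exact h.2
  unfold schurWeight
  positivity

theorem schurWeight_rpow {γ : ℝ} (hγ : 0 < γ) (ε β x : ℝ) {w : ℂ × ℂ} (hw : w ∈ domain γ) :
    schurWeight γ ε β w ^ x = schurWeight γ (ε * x) (β * x) w := by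
  have h := (mem_domain_iff hγ).mp hw
  have hw2 : 0 < ‖w.2‖ := norm_pos_iff.mpr (snd_ne_zero_of_mem_domain hw)
  have h1 : 0 < 1 - ‖w.2‖ := by linarith [h.1]
  have h2 : 0 < 1 - ‖w.1‖ / ‖w.2‖ ^ γ⁻¹ := by
    rw [sub_pos, div_lt_one (by positivity)]
    exact h.2
  unfold schurWeight
  rw [Real.mul_rpow (by positivity) (by positivity), Real.mul_rpow (by positivity) (by positivity),
    ← Real.rpow_mul h2.le, ← Real.rpow_mul h1.le, ← Real.rpow_mul hw2.le, neg_mul, neg_mul]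

@[fun_prop]
theorem measurable_schurWeight (γ ε β : ℝ) : Measurable (schurWeight γ ε β) := by
  unfold schurWeight
  fun_prop

theorem lintegral_Ioo_comp_div {ρ : ℝ} (hρ : 0 < ρ) {g : ℝ → ℝ≥0∞} (hg : Measurable g) :
    ∫⁻ r in Ioo 0 ρ, g (r / ρ) = ENNReal.ofReal ρ * ∫⁻ y in Ioo (0 : ℝ) 1, g y := by
  have h1 : ∀ r : ℝ, (Ioo 0 ρ).indicator (fun r => g (r / ρ)) r =
      (Ioo (0 : ℝ) 1).indicator g (ρ⁻¹ * r) := by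
    intro r
    have : r ∈ Ioo 0 ρ ↔ ρ⁻¹ * r ∈ Ioo (0 : ℝ) 1 := by
      rw [mul_comm, ← div_eq_mul_inv, mem_Ioo, mem_Ioo, div_lt_one hρ]
      refine and_congr_left fun _ => ⟨fun h => by positivity, fun h => ?_⟩
      by_contra h'
      exact absurd (div_nonpos_of_nonpos_of_nonneg (not_lt.mp h') hρ.le) (not_le.mpr h)
    by_cases hr : r ∈ Ioo 0 ρ
    · rw [indicator_of_mem hr, indicator_of_mem (this.mp hr), mul_comm, div_eq_mul_inv]
    · rw [indicator_of_notMem hr, indicator_of_notMem (fun h => hr (this.mpr h))]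
  rw [← lintegral_indicator measurableSet_Ioo, ← lintegral_indicator measurableSet_Ioo]
  simp_rw [h1]
  rw [← lintegral_map (hg.indicator measurableSet_Ioo) (measurable_const_mul ρ⁻¹),
    Real.map_volume_mul_left (inv_ne_zero hρ.ne'), lintegral_smul_measure, inv_inv,
    abs_of_pos hρ, smul_eq_mul]

theorem inv_one_sub_sq_le {x Y y : ℝ} {k : ℕ} (hk : k ≠ 0) (hY0 : 0 ≤ Y) (hY1 : Y < 1)
    (hy0 : 0 < y) (hy1 : y < 1) (hx : x = (Y * y) ^ k) : (1 - x ^ 2)⁻¹ ≤ (1 - y * Y)⁻¹ := by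
  have h0 : 0 ≤ Y * y := by positivity
  have h1 : Y * y < 1 := by nlinarith
  have h2 : x ≤ Y * y := hx ▸ pow_le_of_le_one h0 h1.le hk
  have h3 : 0 ≤ x := hx ▸ by positivity
  have h4 : x ^ 2 ≤ y * Y := by nlinarith
  have h5 : 0 < 1 - y * Y := by nlinarith
  gcongr

/-- The angular integral is a Poisson integral, and scaling `r = ρ y` turns the radial one into the
singular weight on `(0, 1)`. The exponent `m` disappears because `(1 - (Y y)^{2m})⁻¹ ≤ (1 - y Y)⁻¹`.
-/
theorem lintegral_inner_kernel_le {m : ℕ} (hm : 0 < m) {ε : ℝ} (hε0 : 0 < ε) (hε1 : ε < 1)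
    {a : ℂ} {ρ Y : ℝ} (hρ : 0 < ρ) (hY0 : 0 ≤ Y) (hY1 : Y < 1) (ha : ‖a‖ * ρ ^ m = Y ^ m) :
    ∫⁻ w in Metric.ball (0 : ℂ) ρ, ENNReal.ofReal (‖1 - a * w ^ m‖ ^ 2)⁻¹ *
        ENNReal.ofReal ((1 - ‖w‖ / ρ) ^ (-ε)) ≤
      ENNReal.ofReal (2 * π * ρ ^ 2 * (1 / (1 - ε) + 1 / ε) * (1 - Y) ^ (-ε)) := by
  have hε' : 0 < 1 - ε := by linarith
  rw [lintegral_complex_kernel hm (φ := fun r => ENNReal.ofReal ((1 - r / ρ) ^ (-ε)))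
    (by fun_prop) (by rw [ha]; exact pow_le_one₀ hY0 hY1.le) hρ]
  have hle : ∫⁻ r in Ioo 0 ρ, ENNReal.ofReal (r * (1 - (‖a‖ * r ^ m) ^ 2)⁻¹) *
        ENNReal.ofReal ((1 - r / ρ) ^ (-ε)) ≤
      ∫⁻ r in Ioo 0 ρ, ENNReal.ofReal ρ *
        (fun y => ENNReal.ofReal ((1 - y) ^ (-ε) * (1 - y * Y)⁻¹)) (r / ρ) := by
    refine setLIntegral_mono' measurableSet_Ioo fun r hr => ?_
    have hy0 : 0 < r / ρ := div_pos hr.1 hρ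
    have hy1 : r / ρ < 1 := (div_lt_one hρ).mpr hr.2
    have hx : ‖a‖ * r ^ m = (Y * (r / ρ)) ^ m := by
      rw [mul_pow, ← ha, div_pow]
      field_simp
    have h1 := inv_one_sub_sq_le hm.ne' hY0 hY1 hy0 hy1 hx
    have h2 : 0 < 1 - r / ρ := by linarith
    have h3 : 0 < 1 - r / ρ * Y := by nlinarith
    have h4 : 0 ≤ (1 - (‖a‖ * r ^ m) ^ 2)⁻¹ := by
      rw [hx]
      have h0 : 0 ≤ Y * (r / ρ) := by positivity
      have := pow_le_one₀ (n := m) h0 (by nlinarith)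
      have h5 := pow_nonneg h0 m
      refine inv_nonneg.mpr ?_
      nlinarith
    rw [← ENNReal.ofReal_mul (mul_nonneg hr.1.le h4), ← ENNReal.ofReal_mul hρ.le]
    refine ENNReal.ofReal_le_ofReal ?_
    calc r * (1 - (‖a‖ * r ^ m) ^ 2)⁻¹ * (1 - r / ρ) ^ (-ε)
        ≤ ρ * (1 - r / ρ * Y)⁻¹ * (1 - r / ρ) ^ (-ε) := by
          gcongr
          exact hr.2.le
      _ = _ := by ring
  have hm1 : Measurable fun y : ℝ => ENNReal.ofReal ((1 - y) ^ (-ε) * (1 - y * Y)⁻¹) := by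
    fun_prop
  calc _ ≤ ENNReal.ofReal (2 * π) * (ENNReal.ofReal ρ * (ENNReal.ofReal ρ *
        ENNReal.ofReal ((1 / (1 - ε) + 1 / ε) * (1 - Y) ^ (-ε)))) := by
        gcongr
        refine hle.trans ?_
        rw [lintegral_const_mul' _ _ ENNReal.ofReal_ne_top, lintegral_Ioo_comp_div hρ hm1]
        gcongr
        exact lintegral_singular_weight_le hε0 hε1 hY0 hY1
    _ = _ := by
        rw [← ENNReal.ofReal_mul hρ.le, ← ENNReal.ofReal_mul hρ.le,
          ← ENNReal.ofReal_mul (by positivity)]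
        congr 1
        ring

theorem exists_lintegral_outer_kernel_le {δ ε : ℝ} (hδ : 0 < δ) (hε0 : 0 < ε) (hε1 : ε < 1) :
    ∃ C : ℝ, 0 ≤ C ∧ ∀ a : ℂ, ‖a‖ < 1 →
      ∫⁻ w in Metric.ball (0 : ℂ) 1, ENNReal.ofReal (‖1 - a * w ^ 1‖ ^ 2)⁻¹ *
        ENNReal.ofReal (‖w‖ ^ (δ - 2) * (1 - ‖w‖) ^ (-ε)) ≤
      ENNReal.ofReal (C * (1 - ‖a‖) ^ (-ε)) := by
  obtain ⟨C, hC0, hC⟩ := exists_lintegral_weight_le hδ hε0 hε1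
  refine ⟨2 * π * C, by positivity, fun a ha => ?_⟩
  rw [lintegral_complex_kernel one_pos
    (φ := fun r => ENNReal.ofReal (r ^ (δ - 2) * (1 - r) ^ (-ε))) (by fun_prop)
    (by simpa using ha.le) one_pos]
  have hle : ∫⁻ r in Ioo (0 : ℝ) 1, ENNReal.ofReal (r * (1 - (‖a‖ * r ^ 1) ^ 2)⁻¹) *
        ENNReal.ofReal (r ^ (δ - 2) * (1 - r) ^ (-ε)) ≤
      ∫⁻ r in Ioo (0 : ℝ) 1,
        ENNReal.ofReal (r ^ (δ - 1) * (1 - r) ^ (-ε) * (1 - r * ‖a‖)⁻¹) := by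
    refine setLIntegral_mono' measurableSet_Ioo fun r hr => ?_
    have h1 := inv_one_sub_sq_le one_ne_zero (norm_nonneg a) ha hr.1 hr.2 rfl
    rw [mul_pow, pow_one] at h1
    have hr0 := hr.1
    have hr1 : 0 < 1 - r := by linarith [hr.2]
    have h3 : 0 < 1 - r * ‖a‖ := by nlinarith [norm_nonneg a]
    have h4 : 0 ≤ (1 - (‖a‖ * r ^ 1) ^ 2)⁻¹ := by
      have h0 : 0 ≤ ‖a‖ * r ^ 1 := by positivity
      have h5 : ‖a‖ * r ^ 1 ≤ 1 := by nlinarith [norm_nonneg a]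
      refine inv_nonneg.mpr ?_
      nlinarith
    rw [← ENNReal.ofReal_mul (mul_nonneg hr0.le h4)]
    refine ENNReal.ofReal_le_ofReal ?_
    calc r * (1 - (‖a‖ * r ^ 1) ^ 2)⁻¹ * (r ^ (δ - 2) * (1 - r) ^ (-ε))
        ≤ r * (1 - r * ‖a‖)⁻¹ * (r ^ (δ - 2) * (1 - r) ^ (-ε)) := by gcongr
      _ = (r ^ (δ - 2) * r) * (1 - r) ^ (-ε) * (1 - r * ‖a‖)⁻¹ := by ring
      _ = _ := by
          rw [← Real.rpow_add_one hr0.ne']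
          congr 3
          ring
  calc _ ≤ ENNReal.ofReal (2 * π) * ENNReal.ofReal (C * (1 - ‖a‖) ^ (-ε)) := by
        gcongr
        exact hle.trans (hC _ (norm_nonneg a) ha)
    _ = _ := by
        rw [← ENNReal.ofReal_mul (by positivity), mul_assoc (2 * π)]

/-- For fixed `v`, the first-variable integral is the inner estimate with `ρ = ‖v‖^{1/γ}` and `Y =
‖z₁‖ / ‖z₂‖^{1/γ}`. The factor `ρ²` contributes `‖v‖^{2/γ}`, which explains the remaining power of
`‖v‖`. -/
theorem lintegral_inner_schur_le {m n : ℕ} (hm : 0 < m) (hn : 0 < n) {c ε β : ℝ}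
    (hε0 : 0 < ε) (hε1 : ε < 1) {z : ℂ × ℂ} (hz : z ∈ domain ((m : ℝ) / n)) {v : ℂ} (hv : v ≠ 0)
    (hv1 : ‖v‖ < 1) :
    ∫⁻ w in Metric.ball (0 : ℂ) (‖v‖ ^ ((m : ℝ) / n)⁻¹),
        ENNReal.ofReal (kernelMajorant m n c z (w, v)) *
          ENNReal.ofReal (schurWeight ((m : ℝ) / n) ε β (w, v)) ≤
      ENNReal.ofReal (2 * π * (1 / (1 - ε) + 1 / ε) *
          (1 - ‖z.1‖ / ‖z.2‖ ^ ((m : ℝ) / n)⁻¹) ^ (-ε) * ‖z.2‖ ^ (-c)) *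
        (ENNReal.ofReal (‖1 - conj z.2 * v ^ 1‖ ^ 2)⁻¹ *
          ENNReal.ofReal (‖v‖ ^ ((2 + 2 * ((m : ℝ) / n)⁻¹ - c - β) - 2) * (1 - ‖v‖) ^ (-ε))) := by
  have hm' : (0 : ℝ) < m := by exact_mod_cast hm
  have hn' : (0 : ℝ) < n := by exact_mod_cast hn
  have hγ : 0 < (m : ℝ) / n := by positivity
  set γ : ℝ := (m : ℝ) / n with hγd
  have hγm : γ⁻¹ * m = n := by rw [hγd]; field_simp
  obtain ⟨hR1, hx⟩ := (mem_domain_iff hγ).mp hz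
  have hR0 : 0 < ‖z.2‖ := norm_pos_iff.mpr (snd_ne_zero_of_mem_domain hz)
  have hv0 : 0 < ‖v‖ := norm_pos_iff.mpr hv
  have hε' : 0 < 1 - ε := by linarith
  set R := ‖z.2‖ with hR
  set Y := ‖z.1‖ / R ^ γ⁻¹ with hY
  set ρ := ‖v‖ ^ γ⁻¹ with hρd
  have hρ : 0 < ρ := by positivity
  have hY0 : 0 ≤ Y := by positivity
  have hY1 : Y < 1 := (div_lt_one (by positivity)).mpr hx
  have hpow : ∀ x : ℝ, 0 ≤ x → (x ^ γ⁻¹) ^ m = x ^ n := by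
    intro x hx
    rw [← Real.rpow_natCast, ← Real.rpow_mul hx, hγm, Real.rpow_natCast]
  set a : ℂ := conj z.1 ^ m / (conj z.2 * v) ^ n with ha
  have haY : ‖a‖ * ρ ^ m = Y ^ m := by
    rw [ha, hρd, hY, hpow _ hv0.le, div_pow, hpow _ hR0.le, norm_div, norm_pow, norm_pow, norm_mul,
      RCLike.norm_conj, RCLike.norm_conj, mul_pow, ← hR]
    field_simp
  set D : ℝ := (R * ‖v‖) ^ (-c) * (‖1 - conj z.2 * v ^ 1‖ ^ 2)⁻¹ * (1 - ‖v‖) ^ (-ε) * ‖v‖ ^ (-β)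
    with hD
  have hv1' : 0 < 1 - ‖v‖ := by linarith
  have hD0 : 0 ≤ D := by positivity
  have hint : ∀ w ∈ Metric.ball (0 : ℂ) ρ, ENNReal.ofReal (kernelMajorant m n c z (w, v)) *
      ENNReal.ofReal (schurWeight γ ε β (w, v)) =
      (ENNReal.ofReal (‖1 - a * w ^ m‖ ^ 2)⁻¹ * ENNReal.ofReal ((1 - ‖w‖ / ρ) ^ (-ε))) *
        ENNReal.ofReal D := by
    intro w hw
    have hw' : 0 < 1 - ‖w‖ / ρ := by
      rw [sub_pos, div_lt_one hρ]
      simpa using hw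
    have h1 : ‖1 - z.2 * conj v‖ = ‖1 - conj z.2 * v ^ 1‖ := by
      rw [← RCLike.norm_conj]
      simp
    have h2 : ‖1 - (z.1 * conj w) ^ m / (z.2 * conj v) ^ n‖ = ‖1 - a * w ^ m‖ := by
      rw [← RCLike.norm_conj, ha]
      congr 1
      simp only [map_sub, map_one, map_div₀, map_pow, map_mul, Complex.conj_conj]
      ring
    rw [← ENNReal.ofReal_mul (kernelMajorant_nonneg _ _ _ _ _),
      ← ENNReal.ofReal_mul (by positivity), ← ENNReal.ofReal_mul (by positivity)]
    congr 1
    simp only [kernelMajorant, schurWeight, h1, h2, hD]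
    ring
  rw [setLIntegral_congr_fun Metric.isOpen_ball.measurableSet hint,
    lintegral_mul_const' _ _ ENNReal.ofReal_ne_top]
  calc _ ≤ ENNReal.ofReal (2 * π * ρ ^ 2 * (1 / (1 - ε) + 1 / ε) * (1 - Y) ^ (-ε)) *
        ENNReal.ofReal D := by
        gcongr
        exact lintegral_inner_kernel_le hm hε0 hε1 hρ hY0 hY1 haY
    _ = _ := by
        have hY1' : 0 < 1 - Y := by linarith
        rw [← ENNReal.ofReal_mul (by positivity), ← ENNReal.ofReal_mul (by positivity),
          ← ENNReal.ofReal_mul (by positivity)]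
        congr 1
        have h3 : ‖v‖ ^ ((2 + 2 * γ⁻¹ - c - β) - 2) = ρ ^ 2 * ‖v‖ ^ (-c) * ‖v‖ ^ (-β) := by
          rw [hρd, ← Real.rpow_natCast, ← Real.rpow_mul hv0.le, ← Real.rpow_add hv0,
            ← Real.rpow_add hv0]
          congr 1
          push_cast
          ring
        rw [h3, hD, Real.mul_rpow hR0.le hv0.le]
        ring

/-- The bound on `c + β` is integrability at the origin of the `v`-disc. The condition `c ≤ β`
absorbs the factor `‖z₂‖^{-c}` into the `‖z₂‖^{-β}` of the weight. -/
theorem exists_lintegral_kernelMajorant_le {m n : ℕ} (hm : 0 < m) (hn : 0 < n) {c ε β : ℝ}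
    (hε0 : 0 < ε) (hε1 : ε < 1) (hcβ : c ≤ β) (hsum : c + β < 2 + 2 * ((m : ℝ) / n)⁻¹) :
    ∃ C : ℝ≥0, ∀ z ∈ domain ((m : ℝ) / n),
      ∫⁻ w in domain ((m : ℝ) / n), ENNReal.ofReal (kernelMajorant m n c z w) *
          ENNReal.ofReal (schurWeight ((m : ℝ) / n) ε β w) ≤
        C * ENNReal.ofReal (schurWeight ((m : ℝ) / n) ε β z) := by
  have hm' : (0 : ℝ) < m := by exact_mod_cast hm
  have hn' : (0 : ℝ) < n := by exact_mod_cast hn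
  have hγ : 0 < (m : ℝ) / n := by positivity
  have hε' : 0 < 1 - ε := by linarith
  obtain ⟨C, hC0, hC⟩ := exists_lintegral_outer_kernel_le
    (δ := 2 + 2 * ((m : ℝ) / n)⁻¹ - c - β) (by linarith) hε0 hε1
  refine ⟨(2 * π * (1 / (1 - ε) + 1 / ε) * C).toNNReal, fun z hz => ?_⟩
  obtain ⟨hR1, hx⟩ := (mem_domain_iff hγ).mp hz
  have hR0 : 0 < ‖z.2‖ := norm_pos_iff.mpr (snd_ne_zero_of_mem_domain hz)
  have hY1 : 0 < 1 - ‖z.1‖ / ‖z.2‖ ^ ((m : ℝ) / n)⁻¹ := by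
    rw [sub_pos, div_lt_one (by positivity)]
    exact hx
  have hR1' : 0 < 1 - ‖z.2‖ := by linarith
  have hmeas : Measurable fun w => ENNReal.ofReal (kernelMajorant m n c z w) *
      ENNReal.ofReal (schurWeight ((m : ℝ) / n) ε β w) :=
    ((measurable_kernelMajorant m n c).comp measurable_prodMk_left).ennreal_ofReal.mul
      (measurable_schurWeight _ _ _).ennreal_ofReal
  rw [lintegral_domain hγ hmeas]
  set A : ℝ := 2 * π * (1 / (1 - ε) + 1 / ε) *
    (1 - ‖z.1‖ / ‖z.2‖ ^ ((m : ℝ) / n)⁻¹) ^ (-ε) * ‖z.2‖ ^ (-c) with hA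
  have hA0 : 0 ≤ A := by positivity
  calc _ ≤ ∫⁻ v in Metric.ball (0 : ℂ) 1, ENNReal.ofReal A *
        (ENNReal.ofReal (‖1 - conj z.2 * v ^ 1‖ ^ 2)⁻¹ *
          ENNReal.ofReal
            (‖v‖ ^ ((2 + 2 * ((m : ℝ) / n)⁻¹ - c - β) - 2) * (1 - ‖v‖) ^ (-ε))) := by
        refine lintegral_mono_ae ?_
        filter_upwards [(Measure.ae_ne (volume.restrict (Metric.ball (0 : ℂ) 1)) (0 : ℂ)),
          ae_restrict_mem Metric.isOpen_ball.measurableSet] with v hv hv1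
        exact lintegral_inner_schur_le hm hn hε0 hε1 hz hv (by simpa using hv1)
    _ ≤ ENNReal.ofReal A * ENNReal.ofReal (C * (1 - ‖z.2‖) ^ (-ε)) := by
        rw [lintegral_const_mul' _ _ ENNReal.ofReal_ne_top]
        gcongr
        simpa using hC (conj z.2) (by simpa using hR1)
    _ ≤ _ := by
        rw [← ENNReal.ofReal_mul hA0]
        change _ ≤ ENNReal.ofReal (2 * π * (1 / (1 - ε) + 1 / ε) * C) * _
        rw [← ENNReal.ofReal_mul (by positivity)]
        refine ENNReal.ofReal_le_ofReal ?_
        have h1 : ‖z.2‖ ^ (-c) ≤ ‖z.2‖ ^ (-β) :=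
          Real.rpow_le_rpow_of_exponent_ge hR0 hR1.le (by linarith)
        calc A * (C * (1 - ‖z.2‖) ^ (-ε))
            = 2 * π * (1 / (1 - ε) + 1 / ε) * C *
              ((1 - ‖z.1‖ / ‖z.2‖ ^ ((m : ℝ) / n)⁻¹) ^ (-ε) * (1 - ‖z.2‖) ^ (-ε) *
                ‖z.2‖ ^ (-c)) := by rw [hA]; ring
          _ ≤ 2 * π * (1 / (1 - ε) + 1 / ε) * C *
              ((1 - ‖z.1‖ / ‖z.2‖ ^ ((m : ℝ) / n)⁻¹) ^ (-ε) * (1 - ‖z.2‖) ^ (-ε) *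
                ‖z.2‖ ^ (-β)) := by gcongr
          _ = _ := rfl

/-! ### Boundedness on `L^p` -/

theorem exists_lintegral_subBergmanKernel_le {m n : ℕ} (hm : 0 < m) (hn : 0 < n) {p : ℝ≥0∞}
    (hp : 2 ≤ p) (hp' : p ≠ ∞) :
    ∃ C : ℝ≥0, ∀ F : ℂ × ℂ → ℝ≥0∞, AEMeasurable F (vol ((m : ℝ) / n)) →
      ∫⁻ z, (∫⁻ w, ‖subBergmanKernel ((m : ℝ) / n) p z w‖ₑ * F w ∂(vol ((m : ℝ) / n))) ^ p.toReal
          ∂(vol ((m : ℝ) / n)) ≤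
        (C : ℝ≥0∞) ^ p.toReal * ∫⁻ z, F z ^ p.toReal ∂(vol ((m : ℝ) / n)) := by
  have hm' : (0 : ℝ) < m := by exact_mod_cast hm
  have hn' : (0 : ℝ) < n := by exact_mod_cast hn
  have hγ : 0 < (m : ℝ) / n := by positivity
  have := isFiniteMeasure_vol hγ
  have hpr : 2 ≤ p.toReal := by
    simpa using ENNReal.toReal_mono hp' hp
  obtain ⟨c, hc0, hcp, C₀, hC₀, hK⟩ := exists_norm_subBergmanKernel_le hm hn hp hp'
  set γ : ℝ := (m : ℝ) / n with hγd
  set P := p.toReal with hP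
  set q := P.conjExponent with hq
  have hpq : P.HolderConjugate q := Real.HolderConjugate.conjExponent (by linarith)
  have hP0 : 0 < P := by linarith
  have hq0 : 0 < q := hpq.symm.pos
  have hPq : P / q = P - 1 := by
    rw [hq, Real.conjExponent]
    have : P - 1 ≠ 0 := by linarith
    field_simp
  have hP1 : 1 / P < 1 := by
    rw [div_lt_one hP0]; linarith
  have hq1 : 1 / q < 1 := by
    rw [div_lt_one hq0]; exact hpq.symm.lt
  -- This use of `p ≥ 2` gives both `2c < 2 + 2/γ` for the first Schur condition and `c ≤ c (P - 1)`
  -- for the second.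
  have h2c : 2 * c ≤ c * P := by nlinarith
  obtain ⟨C₁, hC₁⟩ := exists_lintegral_kernelMajorant_le hm hn (c := c) (ε := 1 / P) (β := c)
    (by positivity) hP1 le_rfl (by linarith)
  obtain ⟨C₂, hC₂⟩ := exists_lintegral_kernelMajorant_le hm hn (c := c) (ε := 1 / q)
    (β := c * (P - 1)) (by positivity) hq1 (by nlinarith) (by linarith)
  -- The exponents are chosen so that `h^q` has `ε = 1/P`, `β = c`, and `h^P` has `ε = 1/q`, `β = c
  -- P/q = c (P - 1)`. In the second case `c + β = c P`, exactly the quantity controlled by the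
  -- kernel bound.
  set h : ℂ × ℂ → ℝ≥0∞ := fun w => ENNReal.ofReal (schurWeight γ (1 / (P * q)) (c / q) w) with hh
  have hhm : Measurable h := (measurable_schurWeight _ _ _).ennreal_ofReal
  have hhx : ∀ w ∈ domain γ, ∀ x : ℝ, 0 ≤ x →
      h w ^ x = ENNReal.ofReal (schurWeight γ (1 / (P * q) * x) (c / q * x) w) := by
    intro w hw x hx
    rw [hh, ENNReal.ofReal_rpow_of_pos (schurWeight_pos hγ _ _ hw), schurWeight_rpow hγ _ _ _ hw]
  have hhq : ∀ w ∈ domain γ, h w ^ q = ENNReal.ofReal (schurWeight γ (1 / P) c w) := by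
    intro w hw
    rw [hhx w hw q hq0.le]
    congr 2 <;> field_simp
  have hhP : ∀ w ∈ domain γ, h w ^ P = ENNReal.ofReal (schurWeight γ (1 / q) (c * (P - 1)) w) := by
    intro w hw
    rw [hhx w hw P hP0.le, ← hPq]
    congr 2 <;> field_simp
  have hmem : ∀ᵐ w ∂(vol γ), w ∈ domain γ := ae_restrict_mem (measurableSet_domain hγ)
  have hschur := fun (F : ℂ × ℂ → ℝ≥0∞) (hF : AEMeasurable F (vol γ)) =>
    lintegral_rpow_lintegral_mul_le (μ := vol γ) hpq
      (Q := fun z w => ENNReal.ofReal (kernelMajorant m n c z w))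
      (measurable_kernelMajorant m n c).ennreal_ofReal hhm
      (by
        filter_upwards [hmem] with w hw
        simpa [hh] using schurWeight_pos hγ _ _ hw)
      (Filter.Eventually.of_forall fun w => ENNReal.ofReal_ne_top) (C := max C₁ C₂)
      (by
        filter_upwards [hmem] with z hz
        rw [hhq z hz]
        calc _ = ∫⁻ w in domain γ, ENNReal.ofReal (kernelMajorant m n c z w) *
              ENNReal.ofReal (schurWeight γ (1 / P) c w) := by
              refine setLIntegral_congr_fun (measurableSet_domain hγ) fun w hw => ?_
              simp only [hhq w hw]
          _ ≤ C₁ * ENNReal.ofReal (schurWeight γ (1 / P) c z) := hC₁ z hz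
          _ ≤ _ := by
              gcongr
              exact le_max_left _ _)
      (by
        filter_upwards [hmem] with z hz
        rw [hhP z hz]
        calc _ = ∫⁻ w in domain γ, ENNReal.ofReal (kernelMajorant m n c z w) *
              ENNReal.ofReal (schurWeight γ (1 / q) (c * (P - 1)) w) := by
              refine setLIntegral_congr_fun (measurableSet_domain hγ) fun w hw => ?_
              simp only [hhP w hw, kernelMajorant_comm m n c w z]
          _ ≤ C₂ * ENNReal.ofReal (schurWeight γ (1 / q) (c * (P - 1)) z) := hC₂ z hz
          _ ≤ _ := by
              gcongr
              exact le_max_right _ _) hF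
  refine ⟨C₀.toNNReal * max C₁ C₂, fun F hF => ?_⟩
  calc ∫⁻ z, (∫⁻ w, ‖subBergmanKernel γ p z w‖ₑ * F w ∂(vol γ)) ^ P ∂(vol γ)
      ≤ ∫⁻ z, (ENNReal.ofReal C₀ *
          ∫⁻ w, ENNReal.ofReal (kernelMajorant m n c z w) * F w ∂(vol γ)) ^ P ∂(vol γ) := by
        refine lintegral_mono_ae ?_
        filter_upwards [hmem] with z hz
        refine ENNReal.rpow_le_rpow ?_ hP0.le
        rw [← lintegral_const_mul' _ _ ENNReal.ofReal_ne_top]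
        refine lintegral_mono_ae ?_
        filter_upwards [hmem] with w hw
        rw [← mul_assoc, ← ENNReal.ofReal_mul hC₀, ← ofReal_norm]
        gcongr
        exact hK z hz w hw
    _ = ENNReal.ofReal C₀ ^ P *
          ∫⁻ z, (∫⁻ w, ENNReal.ofReal (kernelMajorant m n c z w) * F w ∂(vol γ)) ^ P
            ∂(vol γ) := by
        rw [← lintegral_const_mul' _ _ (ENNReal.rpow_ne_top_of_nonneg hP0.le
          ENNReal.ofReal_ne_top)]
        simp_rw [ENNReal.mul_rpow_of_nonneg _ _ hP0.le]
    _ ≤ ENNReal.ofReal C₀ ^ P * (((max C₁ C₂ : ℝ≥0) : ℝ≥0∞) ^ P * ∫⁻ z, F z ^ P ∂(vol γ)) := by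
        gcongr
        exact hschur F hF
    _ = _ := by
        rw [← mul_assoc, ← ENNReal.mul_rpow_of_nonneg _ _ hP0.le, ENNReal.coe_mul]
        rfl

theorem aestronglyMeasurable_subBergmanKernel {γ : ℝ} (hγ : 0 < γ) {p : ℝ≥0∞} (hp : 2 ≤ p) :
    AEStronglyMeasurable (fun q : (ℂ × ℂ) × (ℂ × ℂ) => subBergmanKernel γ p q.1 q.2)
      ((vol γ).prod (vol γ)) := by
  refine aestronglyMeasurable_of_tendsto_ae Filter.atTop
    (f := fun (s : Finset (allowable γ p)) q => ∑ α ∈ s, kernelTerm γ q.1 q.2 α)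
    (fun s => ?_) ?_
  · refine Finset.aestronglyMeasurable_fun_sum s fun α _ => Measurable.aestronglyMeasurable ?_
    unfold kernelTerm
    have h1 : Measurable fun q : (ℂ × ℂ) × (ℂ × ℂ) => monomial α q.1 :=
      (measurable_monomial α).comp measurable_fst
    have h2 : Measurable fun q : (ℂ × ℂ) × (ℂ × ℂ) => monomial α q.2 :=
      (measurable_monomial α).comp measurable_snd
    exact (h1.mul (RCLike.continuous_conj.measurable.comp h2)).div_const _
  · have h : (vol γ).prod (vol γ) = volume.restrict (domain γ ×ˢ domain γ) := by
      rw [Measure.volume_eq_prod, ← Measure.prod_restrict]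
      rfl
    rw [h]
    filter_upwards [ae_restrict_mem ((measurableSet_domain hγ).prod (measurableSet_domain hγ))]
      with q hq
    exact (summable_kernelTerm_allowable hγ hp hq.1 hq.2).hasSum

theorem aestronglyMeasurable_subBergmanKernel_right {γ : ℝ} (hγ : 0 < γ) {p : ℝ≥0∞} (hp : 2 ≤ p)
    {z : ℂ × ℂ} (hz : z ∈ domain γ) :
    AEStronglyMeasurable (subBergmanKernel γ p z) (vol γ) := by
  refine aestronglyMeasurable_of_tendsto_ae Filter.atTop
    (f := fun (s : Finset (allowable γ p)) w => ∑ α ∈ s, kernelTerm γ z w α)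
    (fun s => ?_) ?_
  · refine Finset.aestronglyMeasurable_fun_sum s fun α _ => Measurable.aestronglyMeasurable ?_
    unfold kernelTerm
    fun_prop
  · filter_upwards [ae_restrict_mem (measurableSet_domain hγ)] with w hw
    exact (summable_kernelTerm_allowable hγ hp hz hw).hasSum

/-- Only the modulus of the kernel enters the estimate, so one argument with a free `L` covers both
the kernel and its absolute value. Absolute convergence at every point follows from the `L²` case,
as `L^p ⊆ L²` on a finite measure space. -/
theorem isBoundedOnLp_of_norm_eq {m n : ℕ} (hm : 0 < m) (hn : 0 < n) {p : ℝ≥0∞}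
    (hp : 2 ≤ p) (hp' : p ≠ ∞) {L : ℂ × ℂ → ℂ × ℂ → ℂ}
    (hL : ∀ z w, ‖L z w‖ = ‖subBergmanKernel ((m : ℝ) / n) p z w‖)
    (hLm : AEStronglyMeasurable (fun q : (ℂ × ℂ) × (ℂ × ℂ) => L q.1 q.2)
      ((vol ((m : ℝ) / n)).prod (vol ((m : ℝ) / n))))
    (hLz : ∀ z ∈ domain ((m : ℝ) / n), AEStronglyMeasurable (L z) (vol ((m : ℝ) / n))) :
    IsBoundedOnLp ((m : ℝ) / n) p L := by
  have hm' : (0 : ℝ) < m := by exact_mod_cast hm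
  have hn' : (0 : ℝ) < n := by exact_mod_cast hn
  have hγ : 0 < (m : ℝ) / n := by positivity
  have := isFiniteMeasure_vol hγ
  have hp0 : p ≠ 0 := by
    rintro rfl; simp at hp
  have hpr : 0 < p.toReal := ENNReal.toReal_pos hp0 hp'
  obtain ⟨C, hC⟩ := exists_lintegral_subBergmanKernel_le hm hn hp hp'
  refine ⟨C, fun f hf => ?_⟩
  have hf2 : MemLp f 2 (vol ((m : ℝ) / n)) := hf.mono_exponent hp
  have hle : eLpNorm (integralOp ((m : ℝ) / n) L f) p (vol ((m : ℝ) / n)) ≤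
      C * eLpNorm f p (vol ((m : ℝ) / n)) := by
    rw [eLpNorm_eq_lintegral_rpow_enorm_toReal hp0 hp',
      eLpNorm_eq_lintegral_rpow_enorm_toReal hp0 hp']
    have h1 : ∫⁻ z, ‖integralOp ((m : ℝ) / n) L f z‖ₑ ^ p.toReal ∂(vol ((m : ℝ) / n)) ≤
        (C : ℝ≥0∞) ^ p.toReal * ∫⁻ z, ‖f z‖ₑ ^ p.toReal ∂(vol ((m : ℝ) / n)) := by
      refine (lintegral_mono fun z => ?_).trans (hC _ hf.1.enorm)
      refine ENNReal.rpow_le_rpow ?_ hpr.le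
      refine (enorm_integral_le_lintegral_enorm _).trans (lintegral_mono fun w => ?_)
      rw [enorm_mul, ← ofReal_norm (L z w), hL, ofReal_norm]
    refine (ENNReal.rpow_le_rpow h1 (by positivity)).trans (le_of_eq ?_)
    rw [ENNReal.mul_rpow_of_nonneg _ _ (by positivity), ← ENNReal.rpow_mul,
      mul_one_div_cancel hpr.ne', ENNReal.rpow_one]
  refine ⟨fun z hz => ?_, ⟨?_, hle.trans_lt (ENNReal.mul_lt_top ENNReal.coe_lt_top hf.2)⟩, hle⟩
  · refine Integrable.mono (integrableOn_hasSum_integralOp hγ hp hf2 hz).1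
      ((hLz z hz).mul hf.1) ?_
    exact Filter.Eventually.of_forall fun w => by rw [norm_mul, norm_mul, hL]
  · exact (hLm.mul hf.1.comp_snd).integral_prod_right'

end GenHartogs

end

/-! ### Assembly of the theorem. -/

theorem theoremT (m n : ℕ) (hm : 0 < m) (hn : 0 < n) (hmn : Nat.Coprime m n)
    (p : ℝ≥0∞) (hp : 2 ≤ p) (hp_fin : p ≠ ∞)
    (γ : ℝ) (hγ : γ = (m : ℝ) / (n : ℝ))
    (K : ℂ × ℂ → ℂ × ℂ → ℂ) (hK : K = GenHartogs.subBergmanKernel γ p) :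
    -- the Bergman kernel is the full series over the `L^2`-allowable multi-indices
    (IsClosed (GenHartogs.bergmanSubspace γ 2 : Set (GenHartogs.L2 γ)) ∧
      GenHartogs.IsRepresentingKernel γ (GenHartogs.subBergmanKernel γ 2)
        (GenHartogs.subBergmanProjection γ 2) ∧
      GenHartogs.allowable γ p ⊆ GenHartogs.allowable γ 2 ∧
      ∀ z ∈ GenHartogs.domain γ, ∀ w ∈ GenHartogs.domain γ,
        Summable (fun α : GenHartogs.allowable γ 2 => GenHartogs.kernelTerm γ z w α)) ∧
    -- the sub-Bergman projection has the subseries `K` as its kernel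
    GenHartogs.IsRepresentingKernel γ K (GenHartogs.subBergmanProjection γ p) ∧
    -- the absolute-value operator is bounded on `L^p`
    GenHartogs.IsBoundedOnLp γ p (GenHartogs.absKernel K) ∧
    -- the sub-Bergman projection maps `L^p` boundedly into `A^p`
    GenHartogs.IsBoundedOnLp γ p K ∧
    (∀ f : ℂ × ℂ → ℂ, MemLp f p (GenHartogs.vol γ) →
      GenHartogs.MemBergman γ p (GenHartogs.integralOp γ K f)) ∧
    -- it reproduces `A^p`
    (∀ h : ℂ × ℂ → ℂ, GenHartogs.MemBergman γ p h →
      ∀ z ∈ GenHartogs.domain γ, GenHartogs.integralOp γ K h z = h z) ∧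
    -- it gives the unique `L^2`-nearest element of `A^p`
    (∀ g : ℂ × ℂ → ℂ, MemLp g p (GenHartogs.vol γ) →
      ∀ h : ℂ × ℂ → ℂ, GenHartogs.MemBergman γ p h →
        eLpNorm (g - GenHartogs.integralOp γ K g) 2 (GenHartogs.vol γ)
            ≤ eLpNorm (g - h) 2 (GenHartogs.vol γ) ∧
        (eLpNorm (g - h) 2 (GenHartogs.vol γ)
            = eLpNorm (g - GenHartogs.integralOp γ K g) 2 (GenHartogs.vol γ) →
          Set.EqOn h (GenHartogs.integralOp γ K g) (GenHartogs.domain γ))) := by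
  subst hγ hK
  have hγ : (0 : ℝ) < (m : ℝ) / n := by positivity
  have := GenHartogs.isFiniteMeasure_vol hγ
  have hB : GenHartogs.IsBoundedOnLp ((m : ℝ) / n) p (GenHartogs.subBergmanKernel ((m : ℝ) / n) p) :=
    GenHartogs.isBoundedOnLp_of_norm_eq hm hn hp hp_fin (fun _ _ => rfl)
      (GenHartogs.aestronglyMeasurable_subBergmanKernel hγ hp)
      (fun _ hz => GenHartogs.aestronglyMeasurable_subBergmanKernel_right hγ hp hz)
  obtain ⟨C, hC⟩ := id hB
  exact ⟨⟨GenHartogs.isClosed_bergmanSubspace hγ,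
      GenHartogs.isRepresentingKernel_subBergmanKernel hγ le_rfl (by simp),
      GenHartogs.allowable_subset_two hγ hp,
      fun z hz w hw => GenHartogs.summable_kernelTerm hγ hz hw⟩,
    GenHartogs.isRepresentingKernel_subBergmanKernel hγ hp hp_fin,
    GenHartogs.isBoundedOnLp_of_norm_eq hm hn hp hp_fin
      (fun z w => by simp [GenHartogs.absKernel])
      (Complex.continuous_ofReal.comp_aestronglyMeasurable
        (GenHartogs.aestronglyMeasurable_subBergmanKernel hγ hp).norm)
      (fun _ hz => Complex.continuous_ofReal.comp_aestronglyMeasurable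
        (GenHartogs.aestronglyMeasurable_subBergmanKernel_right hγ hp hz).norm),
    hB,
    fun f hf => ⟨GenHartogs.differentiableOn_integralOp hγ hp (hf.mono_exponent hp),
      (hC f hf).2.1⟩,
    fun h hh z hz => GenHartogs.integralOp_eq_self hγ hp hp_fin hh hz,
    fun g hg h hh =>
      GenHartogs.eLpNorm_sub_integralOp_le hγ hp hp_fin (hg.mono_exponent hp) hh⟩
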